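/- All graphs are finite and simple; $G\subseteq H$ means that $G$ is isomorphic to a subgraph of $H$. For $k\le c-k+1\le n$ let $W_{n,k,c}$ be the $n$-vertex graph obtained from a clique $K_{c-k+1}$ by adding $n-(c-k+1)$ pairwise non-adjacent vertices, each joined to the same $k$ vertices of $K_{c-k+1}$ and to no others. For odd $c$, a graph $H$ on $n$ vertices belongs to $\mathcal X_{n,c}$ if $V(H)$ is a disjoint union $A\cup B\cup X$ such that $A$ is a clique with $\lfloor c/2\rfloor$ vertices, $B$ and $X$ are stable, every vertex of $A$ is adjacent to every vertex of $B$, and there are vertices $a\in A$ and $b\in B$ with $N_H(x)=\{a,b\}$ for all $x\in X$. For odd $c$, a graph $H$ on $n$ vertices belongs to $\mathcal Y_{n,c}$ if $V(H)$ is a disjoint union $A\cup B\cup Y$ such that $A$ is a clique with $\lfloor c/2\rfloor$ vertices, $B$ is stable, every vertex of $A$ is adjacent to every vertex of $B$, $H[Y]$ is a disjoint union of at least two stars, each having at least one edge, and there are two distinct vertices $a,b\in A$ such that every star $S$ of $H[Y]$ satisfies: the set of vertices outside $S$ with a neighbour in $S$ is exactly $\{a,b\}$, and if $|V(S)|\ge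 3$, then all leaves of $S$ have degree $2$ in $H$ and have a common neighbour in $\{a,b\}$. **Theorem 1.13.** Let $G$ be a 2-connected graph on $n$ vertices and let $C$ be a longest cycle in $G$, of length $c$, where $10\le c\le n-1$. If the number of edges of $G$ with at most one endpoint in $V(C)$ is more than $\left(\lfloor c/2\rfloor-1\right)(n-c)$, then either $G\subseteq W_{n,\lfloor c/2\rfloor,c}$, or $c$ is odd and $G$ is a subgraph of a member of $\mathcal X_{n,c}\cup\mathcal Y_{n,c}$. -/

import Mathlib

namespace BondyStability

variable {V : Type*}

/-- A graph is 2-connected if it has at least three vertices, is connected, and stays connected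
after the deletion of any one vertex. -/
def IsTwoConnected [Fintype V] (G : SimpleGraph V) : Prop :=
  3 ≤ Fintype.card V ∧ G.Connected ∧ ∀ v : V, (G.induce {v}ᶜ).Connected

/-- The closed walk `C` is a cycle of maximum length in `G`. -/
def IsLongestCycle {G : SimpleGraph V} {v : V} (C : G.Walk v v) : Prop :=
  C.IsCycle ∧ ∀ (w : V) (D : G.Walk w w), D.IsCycle → D.length ≤ C.length

/-- The set of edges of `G` with at most one endpoint in the vertex set `S`. -/
def edgesAtMostOneEnd (G : SimpleGraph V) (S : Set V) : Set (Sym2 V) :=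
  {e ∈ G.edgeSet | ¬ ∀ v ∈ e, v ∈ S}

/-- The graph `W_{n,k,c}` (for `k ≤ c - k + 1 ≤ n`): the vertices `0, …, c - k` form a clique
`K_{c-k+1}`, and each of the other `n - (c - k + 1)` vertices is joined exactly to the `k` clique
vertices `0, …, k - 1`. -/
def W (n k c : ℕ) : SimpleGraph (Fin n) where
  Adj i j := i ≠ j ∧
    ((i.val < c + 1 - k ∧ j.val < c + 1 - k) ∨
      (i.val < k ∧ c + 1 - k ≤ j.val) ∨ (j.val < k ∧ c + 1 - k ≤ i.val))
  symm := ⟨fun i j h => ⟨h.1.symm, by have := h.2; tauto⟩⟩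
  loopless := ⟨fun i h => h.1 rfl⟩

/-- The external neighbourhood `N_G(S)`: the vertices outside `S` with a neighbour in `S`. -/
def extNeighbors (G : SimpleGraph V) (S : Set V) : Set V :=
  {v | v ∉ S ∧ ∃ u ∈ S, G.Adj u v}

/-- `G[S]` is a star with at least one edge, with center `z` and leaves the vertices of `S \ {z}`.
(If the star is a single edge, either end may serve as center.) -/
def IsStarOn (G : SimpleGraph V) (S : Set V) (z : V) : Prop :=
  z ∈ S ∧ (S \ {z}).Nonempty ∧ ∀ u ∈ S, ∀ v ∈ S, (G.Adj u v ↔ u ≠ v ∧ (u = z ∨ v = z))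

/-- `𝒮` is the set of (vertex sets of) stars of `G[Y]`, exhibiting `G[Y]` as a nontrivial star
forest: a disjoint union, without edges between different members, of at least two stars,
each of which has at least one edge. -/
structure IsNontrivialStarForestOn (G : SimpleGraph V) (Y : Set V) (𝒮 : Set (Set V)) : Prop where
  star : ∀ S ∈ 𝒮, ∃ z, IsStarOn G S z
  disjoint : ∀ S ∈ 𝒮, ∀ T ∈ 𝒮, S ≠ T → Disjoint S T
  union : ⋃₀ 𝒮 = Y
  no_edge : ∀ S ∈ 𝒮, ∀ T ∈ 𝒮, S ≠ T → ∀ u ∈ S, ∀ v ∈ T, ¬ G.Adj u v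
  two_stars : 𝒮.Nontrivial

/-- The star `S` of `G` is `{a,b}`-feasible: `N_G(S) = {a,b}`, and if `|S| ≥ 3`, then all leaves
of `S` have degree 2 in `G` and have a common neighbour in `{a,b}`.
(A star on at least three vertices has only one center.) -/
def IsFeasible (G : SimpleGraph V) (a b : V) (S : Set V) : Prop :=
  extNeighbors G S = {a, b} ∧
    (3 ≤ S.ncard → ∀ z, IsStarOn G S z →
      (∀ l ∈ S \ {z}, (G.neighborSet l).ncard = 2) ∧
        ∃ w ∈ ({a, b} : Set V), ∀ l ∈ S \ {z}, G.Adj l w)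

/-- `V(G) = A ∪ B ∪ R` is a partition such that `A` is a clique on `⌊c/2⌋` vertices, `B` is stable
and `(A, B)` is complete bipartite. -/
structure IsBase (c : ℕ) (G : SimpleGraph V) (A B R : Set V) : Prop where
  union : A ∪ B ∪ R = Set.univ
  disjoint_AB : Disjoint A B
  disjoint_AR : Disjoint A R
  disjoint_BR : Disjoint B R
  card_A : A.ncard = c / 2
  clique_A : G.IsClique A
  stable_B : G.IsIndepSet B
  complete_AB : ∀ x ∈ A, ∀ y ∈ B, G.Adj x y

/-- Membership in the family `𝒳_{n,c}`. -/
def InX [Fintype V] (n c : ℕ) (G : SimpleGraph V) : Prop :=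
  Fintype.card V = n ∧ ∃ A B X : Set V, IsBase c G A B X ∧ G.IsIndepSet X ∧
    ∃ a ∈ A, ∃ b ∈ B, ∀ x ∈ X, G.neighborSet x = {a, b}

/-- Membership in the family `𝒴_{n,c}`. -/
def InY [Fintype V] (n c : ℕ) (G : SimpleGraph V) : Prop :=
  Fintype.card V = n ∧ ∃ A B Y : Set V, IsBase c G A B Y ∧
    ∃ 𝒮 : Set (Set V), IsNontrivialStarForestOn G Y 𝒮 ∧
      ∃ a ∈ A, ∃ b ∈ A, a ≠ b ∧ ∀ S ∈ 𝒮, IsFeasible G a b S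

end BondyStability

/-!
Let `C` be a longest cycle of the 2-connected graph `G`, of length `c`, and let `k = ⌊c/2⌋ ≥ 5`.

**A vertex with many neighbours on `C`.** A component `D` of `G - C` with at least two vertices is
incident with at most `(k - 1) |D|` edges (`phi_le`). What matters about such a component is recorded
in `Attached`: every path through `D` between two vertices of `C` leaves room on both arcs of `C`.
These conditions survive the contraction of an edge of `D` whose ends do not separate a part of `D`
from `C` (`Attached.contract`), and if the ends of the edge have fewer than `k - 1` common neighbours,
the contraction loses at most `k - 1` edges and one vertex. So it remains to consider the case
`Rigid`, in which no such edge exists. There, a longest path through `D` between vertices with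
distinct neighbours on `C` has at least `k - 1` common neighbours of its first two vertices, whereas
few of them can lie on `C` (`Attached.union_card`, `Attached.common_card`). This leaves only the case
that `D` is a clique on `k - 1` vertices with the same two neighbours on `C` (`LongestEar.clique`,
`LongestEar.covers`), which satisfies the bound.

By the hypothesis on the number of edges, not all components can obey the bound, so there is a vertex
`x` off `C` with no neighbour off `C` and at least `k` neighbours on `C`. No two of these are
consecutive; so `C = u 0, u 1, …` may be numbered such that `x` is joined exactly to
`u 0, u 2, …, u (2k - 2)` (`Config`, `IsCyc.exists_config`). If `c = 2k + 1`, this leaves the two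
consecutive exceptional vertices `p = u (2k - 1)` and `q = u (2k)`.

**The rest of the graph.** A path off `C` between two vertices of `C` can often be combined with a
detour through `x` to a cycle longer than `C` (`IsCyc.hop`). Hence a vertex of `C` between two
consecutive neighbours of `x` is joined to neighbours of `x` only (`Config.mid_nbr`), the vertices off
`C` joined to `p` have only `p` and `u 0` as neighbours (`Config.adj_exc_iff`), and paths off `C` with
at least two vertices exist only between `u 0` and `u (2k - 2)` of an odd cycle, and have exactly two
vertices (`Config.link_two_le`). The last fact makes a component of `G - C` with at least two vertices
a feasible star (`Narrow.feasible`, `Config.multi_spec`).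

Let `A` be the set of the `k` neighbours of `x`. If `G - C` has an edge, then the components of `G - A`
with an edge are the stars required for `𝒴`; the component of `p` and `q` is no exception, since the
edge `pq` of `C` may be exchanged for an edge of another star (`Config.exchange`). If `G - C` has no
edge, but `p`, say, has a neighbour `y` off `C`, the exchange of `q` for `y` shows that `q` is also
joined to `p` and `u 0` only, which gives `𝒳`. If neither is the case, then all edges of `G` but
possibly `pq` meet `A`, and `G` is contained in `W`.
-/

namespace BondyStability
/-! ### Paths as lists -/
section Basics
variable {V : Type*} {G : SimpleGraph V}

/-- The list `l` is the vertex sequence of a path of `G` from `a` to `b`. -/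
structure ListPath (G : SimpleGraph V) (a b : V) (l : List V) : Prop where
  head : l.head? = some a
  last : l.getLast? = some b
  chain : l.IsChain G.Adj
  nodup : l.Nodup

namespace ListPath

theorem singleton (a : V) : ListPath G a a [a] :=
  ⟨rfl, rfl, .singleton a, List.nodup_singleton a⟩

theorem ne_nil {a b : V} {l : List V} (h : ListPath G a b l) : l ≠ [] := by
  rintro rfl; simpa using h.head

theorem length_pos {a b : V} {l : List V} (h : ListPath G a b l) : 1 ≤ l.length :=
  List.length_pos_iff.2 h.ne_nil

theorem head_mem {a b : V} {l : List V} (h : ListPath G a b l) : a ∈ l :=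
  List.mem_of_head? h.head

theorem last_mem {a b : V} {l : List V} (h : ListPath G a b l) : b ∈ l :=
  List.mem_of_getLast? h.last

theorem reverse {a b : V} {l : List V} (h : ListPath G a b l) : ListPath G b a l.reverse where
  head := by simpa using h.last
  last := by simpa using h.head
  chain := by
    rw [List.isChain_reverse]
    exact h.chain.imp fun _ _ h => h.symm
  nodup := List.nodup_reverse.2 h.nodup

theorem append {a b c d : V} {l m : List V} (h : ListPath G a b l) (h' : ListPath G c d m)
    (hbc : G.Adj b c) (hd : ∀ x ∈ l, x ∉ m) : ListPath G a d (l ++ m) where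
  head := by simp [h.head]
  last := by simp [h'.last]
  chain := by
    refine h.chain.append h'.chain ?_
    intro x hx y hy
    rw [h.last] at hx; rw [h'.head] at hy
    cases hx; cases hy; exact hbc
  nodup := List.nodup_append'.2 ⟨h.nodup, h'.nodup, fun x hx hx' => hd x hx hx'⟩

theorem cons {a c d : V} {m : List V} (h' : ListPath G c d m)
    (hbc : G.Adj a c) (hd : a ∉ m) : ListPath G a d (a :: m) :=
  (singleton a).append h' hbc (by simpa using hd)

theorem concat {a c d : V} {m : List V} (h' : ListPath G c d m)
    (hbc : G.Adj d a) (hd : a ∉ m) : ListPath G c a (m ++ [a]) :=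
  h'.append (singleton a) hbc (by rintro x hx hx'; simp at hx'; exact hd (hx' ▸ hx))

theorem of_walk {a b : V} (p : G.Walk a b) (hp : p.IsPath) : ListPath G a b p.support where
  head := by
    rw [List.head?_eq_some_head p.support_ne_nil]; simp
  last := by
    rw [List.getLast?_eq_some_getLast p.support_ne_nil]; simp
  chain := p.isChain_adj_support
  nodup := hp.support_nodup

theorem exists_walk {a b : V} {l : List V} (h : ListPath G a b l) :
    ∃ p : G.Walk a b, p.IsPath ∧ p.support = l := by
  have h1 : l.head h.ne_nil = a := by
    have := h.head; rw [List.head?_eq_some_head h.ne_nil] at this; simpa using this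
  have h2 : l.getLast h.ne_nil = b := by
    have := h.last; rw [List.getLast?_eq_some_getLast h.ne_nil] at this; simpa using this
  refine ⟨(SimpleGraph.Walk.ofSupport l h.ne_nil h.chain).copy h1 h2, ?_, ?_⟩
  · rw [SimpleGraph.Walk.isPath_def]; simpa using h.nodup
  · simp

theorem mono {G' : SimpleGraph V} (hG : G ≤ G') {a b : V} {l : List V} (h : ListPath G a b l) :
    ListPath G' a b l :=
  ⟨h.head, h.last, h.chain.imp fun _ _ h => hG h, h.nodup⟩

theorem left {a b q : V} {P S : List V} (h : ListPath G a b (P ++ q :: S)) :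
    ListPath G a q (P ++ [q]) where
  head := by
    have := h.head
    cases P <;> simpa using this
  last := by simp
  chain := (List.isChain_split.1 h.chain).1
  nodup := (List.nodup_append'.1 (show (P ++ [q] ++ S).Nodup by simpa using h.nodup)).1

theorem right {a b q : V} {P S : List V} (h : ListPath G a b (P ++ q :: S)) :
    ListPath G q b (q :: S) where
  head := rfl
  last := by
    have := h.last
    rwa [List.getLast?_append_of_ne_nil _ (by simp)] at this
  chain := (List.isChain_split.1 h.chain).2
  nodup := (List.nodup_append'.1 h.nodup).2.1

theorem tail {a b q : V} {S : List V} (h : ListPath G a b (a :: q :: S)) :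
    ListPath G q b (q :: S) :=
  h.right (P := [a])

end ListPath

/-- Every cycle of `G`, given as a cyclic list of vertices, has length at most `c`. -/
def CircLE (G : SimpleGraph V) (c : ℕ) : Prop :=
  ∀ a b l, ListPath G a b l → G.Adj b a → 3 ≤ l.length → l.length ≤ c

theorem IsLongestCycle.circLE {v : V} {C : G.Walk v v} (hC : IsLongestCycle C) :
    CircLE G C.length := by
  intro a b l hl hba h3
  obtain ⟨p, hp, rfl⟩ := hl.exists_walk
  have hlen : p.support.length = p.length + 1 := p.length_support
  rw [hlen] at h3 ⊢
  have hcyc : (SimpleGraph.Walk.cons hba p).IsCycle := by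
    rw [SimpleGraph.Walk.cons_isCycle_iff]
    refine ⟨hp, fun hmem => ?_⟩
    have := hp.length_eq_one_of_mem_edges (Sym2.eq_swap ▸ hmem)
    omega
  simpa using hC.2 _ _ hcyc

/-- `u` runs around a cycle of length `c` of `G`, periodically. -/
structure IsCyc (G : SimpleGraph V) (c : ℕ) (u : ℤ → V) : Prop where
  three_le : 3 ≤ c
  eq_iff : ∀ s t, u s = u t ↔ (c : ℤ) ∣ s - t
  adj : ∀ s, G.Adj (u s) (u (s + 1))

theorem exists_isCyc {v : V} {C : G.Walk v v} (hC : C.IsCycle) :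
    ∃ u : ℤ → V, IsCyc G C.length u ∧ Set.range u = {w | w ∈ C.support} := by
  have h3 := hC.three_le_length
  set c := C.length with hc
  have hpos : (0 : ℤ) < c := by omega
  have hem : ∀ s : ℤ, ((s % c).toNat : ℤ) = s % c := fun s =>
    Int.toNat_of_nonneg (Int.emod_nonneg _ hpos.ne')
  have hlt : ∀ s : ℤ, (s % c).toNat < c := fun s => by
    have := Int.emod_lt_of_pos s hpos
    have := hem s
    omega
  refine ⟨fun s => C.getVert (s % c).toNat, ⟨h3, fun s t => ?_, fun s => ?_⟩, ?_⟩
  · constructor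
    · intro h
      have := hC.getVert_injOn' (x₁ := (s % c).toNat) (x₂ := (t % c).toNat)
        (by have := hlt s; simp; omega) (by have := hlt t; simp; omega) h
      have h1 := hem s
      have h2 := hem t
      rw [this, h2] at h1
      exact (Int.emod_emod_of_dvd _ dvd_rfl ▸ Int.emod_eq_emod_iff_emod_sub_eq_zero.1 h1.symm |>
        Int.dvd_of_emod_eq_zero)
    · intro h
      have : s % c = t % c := Int.emod_eq_emod_iff_emod_sub_eq_zero.2 (Int.emod_eq_zero_of_dvd h)
      simp [this]
  · have h1 := C.adj_getVert_succ (hlt s)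
    have h0 := hlt s
    have e1 := hem s
    have e2 := hem (s + 1)
    by_cases hs : (s % c).toNat + 1 = c
    · have : ((s + 1) % c).toNat = 0 := by
        have : (s + 1) % c = 0 := by
          rw [Int.add_emod]
          have : s % c = c - 1 := by omega
          rw [this]
          rw [Int.emod_eq_of_lt (a := 1) (by omega) (by omega)]; simp
        rw [this]; rfl
      rw [this]
      rw [hs, hc, C.getVert_length] at h1
      simpa using h1
    · have : ((s + 1) % c).toNat = (s % c).toNat + 1 := by
        have : (s + 1) % c = s % c + 1 := by
          rw [Int.add_emod, Int.emod_eq_of_lt (a := 1) (by omega) (by omega)]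
          exact Int.emod_eq_of_lt (by omega) (by omega)
        omega
      rw [this]; exact h1
  · ext w
    simp only [Set.mem_range, Set.mem_ofPred_eq]
    constructor
    · rintro ⟨s, rfl⟩; exact C.getVert_mem_support _
    · intro hw
      obtain ⟨n, hn, hn'⟩ := SimpleGraph.Walk.mem_support_iff_exists_getVert.1 hw
      rcases hn'.lt_or_eq with h | h
      · refine ⟨n, ?_⟩
        rw [Int.emod_eq_of_lt (by omega) (by omega)]; simpa using hn
      · refine ⟨0, ?_⟩
        rw [h, C.getVert_length] at hn; simpa using hn

namespace IsCyc
variable {c : ℕ} {u : ℤ → V}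

theorem inj (h : IsCyc G c u) {s t : ℤ} (e : u s = u t) (h1 : s < t + c) (h2 : t < s + c) :
    s = t := by
  obtain ⟨k, hk⟩ := (h.eq_iff s t).1 e
  have := h.three_le
  have h3 : k < 1 := by by_contra hh; have : (c : ℤ) * 1 ≤ c * k := by gcongr; omega
                        omega
  have h4 : -1 < k := by by_contra hh; have : (c : ℤ) * k ≤ c * (-1) := by gcongr; omega
                         omega
  have : k = 0 := by omega
  subst this; omega

theorem add_c (h : IsCyc G c u) (s : ℤ) : u (s + c) = u s :=
  (h.eq_iff _ _).2 ⟨1, by ring⟩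

theorem neg (h : IsCyc G c u) : IsCyc G c (fun s => u (-s)) where
  three_le := h.three_le
  eq_iff s t := by
    rw [h.eq_iff, ← dvd_neg]; ring_nf
  adj s := by
    have := (h.adj (-(s + 1))).symm
    rwa [show -(s + 1) + 1 = -s by ring] at this

theorem shift (h : IsCyc G c u) (r : ℤ) : IsCyc G c (fun s => u (s + r)) where
  three_le := h.three_le
  eq_iff s t := by rw [h.eq_iff]; ring_nf
  adj s := by
    have := h.adj (s + r)
    rwa [show s + r + 1 = s + 1 + r by ring] at this

/-- The first `n` vertices met from position `i` on. -/
def arc (u : ℤ → V) (i : ℤ) (n : ℕ) : List V := (List.range n).map fun t : ℕ => u (i + t)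

theorem mem_arc {i : ℤ} {n : ℕ} {a : V} :
    a ∈ arc u i n ↔ ∃ s, i ≤ s ∧ s < i + n ∧ u s = a := by
  simp only [arc, List.mem_map, List.mem_range]
  constructor
  · rintro ⟨t, ht, rfl⟩; exact ⟨i + t, by omega, by omega, rfl⟩
  · rintro ⟨s, h1, h2, rfl⟩
    exact ⟨(s - i).toNat, by omega, by congr 1; omega⟩

@[simp] theorem length_arc {i : ℤ} {n : ℕ} : (arc u i n).length = n := by simp [arc]

theorem arc_path (h : IsCyc G c u) (i j : ℤ) (hij : i ≤ j) (hj : j < i + c) :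
    ListPath G (u i) (u j) (arc u i (j - i + 1).toNat) := by
  obtain ⟨n, rfl⟩ : ∃ n : ℕ, j = i + n := ⟨(j - i).toNat, by omega⟩
  have : (i + n - i + 1).toNat = n + 1 := by omega
  rw [this]
  clear hij this
  induction n with
  | zero => simpa [arc] using ListPath.singleton (G := G) (u i)
  | succ n ih =>
    have := ih (by push_cast at hj; omega)
    have e : arc u i (n + 1 + 1) = arc u i (n + 1) ++ [u (i + ((n + 1 : ℕ) : ℤ))] := by
      rw [arc, List.range_succ, List.map_append]; rfl
    rw [e]
    refine this.concat ?_ ?_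
    · have := h.adj (i + n)
      rwa [show i + (n : ℤ) + 1 = i + ((n + 1 : ℕ) : ℤ) by push_cast; ring] at this
    · rw [mem_arc]
      rintro ⟨s, h1, h2, h3⟩
      have := h.inj h3 (by push_cast at *; omega) (by push_cast at *; omega)
      push_cast at *; omega

/-- A path avoiding the cycle, between the ends of an arc of it, closes that arc to a cycle. -/
theorem gap (h : IsCyc G c u) (hG : CircLE G c) {i j : ℤ} (hij : i < j) (hj : j < i + c)
    {d e : V} {R : List V} (hR : ListPath G d e R) (hRu : ∀ a ∈ R, a ∉ Set.range u)
    (hd : G.Adj (u i) d) (he : G.Adj (u j) e) : j - i + 1 + R.length ≤ c := by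
  have hp := (h.arc_path i j hij.le hj).append hR.reverse he (by
    intro x hx hx'
    obtain ⟨s, -, -, rfl⟩ := mem_arc.1 hx
    exact hRu _ (List.mem_reverse.1 hx') ⟨s, rfl⟩)
  have := hR.length_pos
  have := hG _ _ _ hp hd.symm (by simp; omega)
  simp at this; omega

/-- The path from `u i` to `u j` which covers two arcs `u i, …, u l` and `u l', …, u j`,
linked through a vertex `x` off the cycle. -/
theorem hop_path (h : IsCyc G c u) {x : V} (hx : x ∉ Set.range u) {i l j l' : ℤ}
    (hil : i ≤ l) (hlj : l < j) (hjl : j ≤ l') (hl' : l' < i + c)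
    (hxl : G.Adj x (u l)) (hxl' : G.Adj x (u l')) :
    ListPath G (u i) (u j)
      (arc u i (l - i + 1).toNat ++ x :: (arc u j (l' - j + 1).toNat).reverse) := by
  have h1 := (h.arc_path j l' hjl (by omega)).reverse.cons hxl' (by
    rw [List.mem_reverse, mem_arc]; rintro ⟨s, -, -, e⟩; exact hx ⟨s, e⟩)
  refine (h.arc_path i l hil (by omega)).append h1 hxl.symm ?_
  intro a ha
  obtain ⟨s, hs1, hs2, rfl⟩ := mem_arc.1 ha
  simp only [List.mem_cons, List.mem_reverse, not_or, mem_arc, not_exists, not_and]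
  refine ⟨fun e => hx ⟨s, e⟩, fun t ht1 ht2 e => ?_⟩
  have := h.inj e (by omega) (by omega)
  omega

/-- If the ends `u i` and `u j` of the path of `hop_path` are adjacent, this edge closes it to a
cycle. -/
theorem hop_adj (h : IsCyc G c u) (hG : CircLE G c) {x : V} (hx : x ∉ Set.range u) {i l j l' : ℤ}
    (hil : i ≤ l) (hlj : l < j) (hjl : j ≤ l') (hl' : l' < i + c)
    (hxl : G.Adj x (u l)) (hxl' : G.Adj x (u l')) (hij : G.Adj (u j) (u i)) :
    (l - i) + (l' - j) + 3 ≤ c := by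
  have := hG _ _ _ (h.hop_path hx hil hlj hjl hl' hxl hxl') hij (by simp; omega)
  simp at this; omega

/-- A path `R` off the cycle between the ends `u j` and `u i` of the path of `hop_path` closes it
to a cycle. -/
theorem hop (h : IsCyc G c u) (hG : CircLE G c) {x : V} (hx : x ∉ Set.range u) {i l j l' : ℤ}
    (hil : i ≤ l) (hlj : l < j) (hjl : j ≤ l') (hl' : l' < i + c)
    (hxl : G.Adj x (u l)) (hxl' : G.Adj x (u l')) {d e : V} {R : List V}
    (hR : ListPath G d e R) (hRu : ∀ a ∈ R, a ∉ Set.range u) (hxR : x ∉ R)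
    (hd : G.Adj (u j) d) (he : G.Adj (u i) e) :
    (l - i) + (l' - j) + 3 + R.length ≤ c := by
  have hp := (h.hop_path hx hil hlj hjl hl' hxl hxl').append hR hd (by
    intro a ha haR
    simp only [List.mem_append, List.mem_cons, List.mem_reverse, mem_arc] at ha
    obtain ⟨s, -, -, rfl⟩ | rfl | ⟨s, -, -, rfl⟩ := ha
    · exact hRu _ haR ⟨s, rfl⟩
    · exact hxR haR
    · exact hRu _ haR ⟨s, rfl⟩)
  have := hG _ _ _ hp he.symm (by simp; omega)
  simp at this; omega

/-- The mirror image of `hop`: the two arcs are linked through `x` at their first vertices `u i`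
and `u j`, and the path `R` joins their last vertices. -/
theorem hop' (h : IsCyc G c u) (hG : CircLE G c) {x : V} (hx : x ∉ Set.range u) {i l j l' : ℤ}
    (hil : i ≤ l) (hlj : l < j) (hjl : j ≤ l') (hl' : l' < i + c)
    (hxi : G.Adj x (u i)) (hxj : G.Adj x (u j)) {d e : V} {R : List V}
    (hR : ListPath G d e R) (hRu : ∀ a ∈ R, a ∉ Set.range u) (hxR : x ∉ R)
    (hd : G.Adj (u l) d) (he : G.Adj (u l') e) :
    (l - i) + (l' - j) + 3 + R.length ≤ c := by
  have hr : Set.range (fun s => u (-s)) = Set.range u :=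
    (Equiv.neg ℤ).surjective.range_comp u
  have := h.neg.hop hG (x := x) (by rwa [hr]) (i := -l') (l := -j) (j := -l) (l' := -i)
    (by omega) (by omega) (by omega) (by omega) (by simpa using hxj) (by simpa using hxi) hR
    (by rwa [hr]) hxR (by simpa using hd) (by simpa using he)
  omega

/-- The mirror image of `hop_adj`. -/
theorem hop_adj' (h : IsCyc G c u) (hG : CircLE G c) {x : V} (hx : x ∉ Set.range u)
    {i l j l' : ℤ} (hil : i ≤ l) (hlj : l < j) (hjl : j ≤ l') (hl' : l' < i + c)
    (hxi : G.Adj x (u i)) (hxj : G.Adj x (u j)) (hij : G.Adj (u l) (u l')) :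
    (l - i) + (l' - j) + 3 ≤ c := by
  have hr : Set.range (fun s => u (-s)) = Set.range u :=
    (Equiv.neg ℤ).surjective.range_comp u
  have := h.neg.hop_adj hG (x := x) (by rwa [hr]) (i := -l') (l := -j) (j := -l) (l' := -i)
    (by omega) (by omega) (by omega) (by omega) (by simpa using hxj) (by simpa using hxi)
    (by simpa using hij)
  omega

end IsCyc

/-! ### Reachability inside a vertex set -/

/-- The edges of `G` with both ends in `S`, as a graph on the same vertex type. -/
def within (G : SimpleGraph V) (S : Set V) : SimpleGraph V where
  Adj a b := G.Adj a b ∧ a ∈ S ∧ b ∈ S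
  symm := ⟨fun _ _ h => ⟨h.1.symm, h.2.2, h.2.1⟩⟩
  loopless := ⟨fun a h => G.loopless.irrefl a h.1⟩

theorem within_mono {S T : Set V} (h : S ⊆ T) : within G S ≤ within G T :=
  fun _ _ hab => ⟨hab.1, h hab.2.1, h hab.2.2⟩

theorem reachable_induction {a b : V} (h : G.Reachable a b) (P : V → Prop) (ha : P a)
    (hP : ∀ x y, P x → G.Adj x y → P y) : P b := by
  obtain ⟨p⟩ := h
  induction p with
  | nil => exact ha
  | cons hadj _ ih => exact ih (hP _ _ ha hadj)

/-- A path leaving the set of vertices with property `P` has a first step out of it. -/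
theorem exists_exit {a b : V} (h : G.Reachable a b) (P : V → Prop) (ha : P a) (hb : ¬ P b) :
    ∃ x y, P x ∧ ¬ P y ∧ G.Adj x y := by
  by_contra! hcon
  exact hb (reachable_induction h P ha fun x y hx hxy => by
    by_contra hy; exact hcon x y hx hy hxy)

theorem mem_of_within_reachable {S : Set V} {a b : V} (h : (within G S).Reachable a b)
    (ha : a ∈ S) : b ∈ S :=
  reachable_induction h (· ∈ S) ha fun _ _ _ h => h.2.2

theorem exists_listPath {S : Set V} {a b : V} (h : (within G S).Reachable a b) (ha : a ∈ S) :
    ∃ l, ListPath G a b l ∧ ∀ x ∈ l, x ∈ S ∧ (within G S).Reachable a x := by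
  obtain ⟨p, hp⟩ := h.exists_isPath
  refine ⟨p.support, (ListPath.of_walk p hp).mono (fun _ _ (h : (within G S).Adj _ _) => h.1),
    fun x hx => ?_⟩
  classical
  exact ⟨mem_of_within_reachable ⟨p.takeUntil x hx⟩ ha, ⟨p.takeUntil x hx⟩⟩

theorem ListPath.reachable {S : Set V} {a b : V} {l : List V} (h : ListPath G a b l)
    (hl : ∀ x ∈ l, x ∈ S) : (within G S).Reachable a b := by
  have : ListPath (within G S) a b l :=
    ⟨h.head, h.last, h.chain.imp_of_mem_imp fun x y hx hy hxy => ⟨hxy, hl x hx, hl y hy⟩, h.nodup⟩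
  obtain ⟨p, -⟩ := this.exists_walk
  exact ⟨p⟩

end Basics
end BondyStability

namespace BondyStability
/-! ### Counting separated positions -/

/-- Integers in the interval `[a, b)` at mutual distance at least `r`: the intervals of length `r`
starting at them are disjoint. -/
theorem separated_card {S : Finset ℤ} {a b : ℤ} {r : ℕ} (hab : a ≤ b + r - 1)
    (hS : ∀ s ∈ S, a ≤ s ∧ s < b) (hsep : ∀ s ∈ S, ∀ t ∈ S, s < t → s + r ≤ t) :
    (r : ℤ) * S.card ≤ b - a + r - 1 := by
  have : (S ×ˢ Finset.range r).card ≤ (Finset.Ico a (b + r - 1)).card := by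
    refine Finset.card_le_card_of_injOn (fun x => x.1 + (x.2 : ℤ)) ?_ ?_
    · rintro ⟨s, t⟩ h
      simp only [Finset.coe_product, Set.mem_prod, Finset.mem_coe, Finset.mem_range] at h
      have := hS s h.1
      simp only [Finset.coe_Ico, Set.mem_Ico]
      omega
    · rintro ⟨s, t⟩ h ⟨s', t'⟩ h' e
      simp only [Finset.coe_product, Set.mem_prod, Finset.mem_coe, Finset.mem_range] at h h' e
      have h1 := hsep s h.1 s' h'.1
      have h2 := hsep s' h'.1 s h.1
      have : s = s' := by
        rcases lt_trichotomy s s' with hlt | rfl | hlt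
        · have := h1 hlt; omega
        · rfl
        · have := h2 hlt; omega
      subst this
      simp at e
      simp [e]
  rw [Finset.card_product, Finset.card_range, Int.card_Ico] at this
  have h2 : ((S.card * r : ℕ) : ℤ) ≤ ((b + r - 1 - a).toNat : ℤ) := by exact_mod_cast this
  rw [Int.toNat_of_nonneg (by omega)] at h2
  push_cast at h2
  linarith

section
open scoped Classical

/-- Two periodic sets `p`, `q` of positions on a cycle of length `c`, such that distinct positions
are at distance at least two, and a position in `p` and a distinct position in `q` are at distance
more than `m`. Going round the cycle one changes from `p` to `q` and back to `p`, and each of the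
two changes wastes `m - 1` further positions. -/
theorem two_sets_card {p q : ℤ → Prop} {c m : ℕ} (hm : 1 ≤ m) (hpc : ∀ s, p (s + c) ↔ p s)
    (hsep : ∀ s t : ℤ, s < t → t < s + c → (p s ∨ q s) → (p t ∨ q t) → s + 2 ≤ t ∧ t + 2 ≤ s + c)
    (hpq : ∀ s t : ℤ, s < t → t < s + c → p s → q t → s + (m + 1) ≤ t ∧ t + (m + 1) ≤ s + c)
    (hqp : ∀ s t : ℤ, s < t → t < s + c → q s → p t → s + (m + 1) ≤ t ∧ t + (m + 1) ≤ s + c)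
    {x y : ℤ} (hxy : x < y) (hy : y < x + c) (hpx : p x) (hqy : q y) :
    2 * (((Finset.Ico x (x + c)).filter fun s => p s ∨ q s).card : ℤ) + 2 * (m - 1) ≤ c := by
  obtain ⟨s₁, hs₁, hmax₁⟩ := Finset.exists_max_image ((Finset.Ico x y).filter p) id
    ⟨x, by simp [hxy, hpx]⟩
  obtain ⟨s₂, hs₂, hmax₂⟩ := Finset.exists_max_image ((Finset.Ico y (x + c)).filter q) id
    ⟨y, by simp [hy, hqy]⟩
  simp only [Finset.mem_filter, Finset.mem_Ico, id] at hs₁ hs₂ hmax₁ hmax₂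
  set S := (Finset.Ico x (x + c)).filter fun s => p s ∨ q s with hSdef
  have hS : ∀ s ∈ S, x ≤ s ∧ s < x + c ∧ (p s ∨ q s) := by
    intro s hs
    simpa [hSdef, and_assoc] using hs
  have h12 := hpq s₁ s₂ (by omega) (by omega) hs₁.2 hs₂.2
  have h2x := hqp s₂ (x + c) (by omega) (by omega) hs₂.2 ((hpc x).2 hpx)
  have hsplit : S ⊆ (S.filter (· ≤ s₁)) ∪ (S.filter fun s => s₁ + (m + 1) ≤ s ∧ s ≤ s₂) ∪
      (S.filter (s₂ + (m + 1) ≤ ·)) := by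
    intro s hs
    have hs' := hS s hs
    simp only [Finset.mem_union, Finset.mem_filter, hs, true_and]
    by_cases h1 : s ≤ s₁
    · exact .inl (.inl h1)
    by_cases h2 : s ≤ s₂
    · refine .inl (.inr ⟨?_, h2⟩)
      rcases hs'.2.2 with hp | hq
      · by_cases hsy : s < y
        · have := hmax₁ s ⟨⟨hs'.1, hsy⟩, hp⟩; omega
        · have h3 : s₁ + (m + 1) ≤ y := (hpq s₁ y (by omega) (by omega) hs₁.2 hqy).1
          omega
      · exact (hpq s₁ s (by omega) (by omega) hs₁.2 hq).1
    · refine .inr ?_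
      rcases hs'.2.2 with hp | hq
      · exact (hqp s₂ s (by omega) (by omega) hs₂.2 hp).1
      · have := hmax₂ s ⟨⟨by omega, hs'.2.1⟩, hq⟩; omega
  have hsep' : ∀ s ∈ S, ∀ t ∈ S, s < t → s + (2 : ℕ) ≤ t := by
    intro s hs t ht hst
    have h1 := hS s hs
    have h2 := hS t ht
    have := (hsep s t hst (by omega) h1.2.2 h2.2.2).1
    simp only [Nat.cast_ofNat]; exact this
  have c1 := separated_card (S := S.filter (· ≤ s₁)) (a := x) (b := s₁ + 1) (r := 2)
    (by omega) (by
      intro s hs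
      have := hS s (Finset.mem_filter.1 hs).1
      have := (Finset.mem_filter.1 hs).2
      omega)
    (fun s hs t ht => hsep' s (Finset.mem_filter.1 hs).1 t (Finset.mem_filter.1 ht).1)
  have c2 := separated_card (S := S.filter fun s => s₁ + (m + 1) ≤ s ∧ s ≤ s₂)
    (a := s₁ + (m + 1)) (b := s₂ + 1) (r := 2)
    (by omega) (by
      intro s hs
      have := (Finset.mem_filter.1 hs).2
      omega)
    (fun s hs t ht => hsep' s (Finset.mem_filter.1 hs).1 t (Finset.mem_filter.1 ht).1)
  have c3 := separated_card (S := S.filter (s₂ + (m + 1) ≤ ·))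
    (a := s₂ + (m + 1)) (b := x + c - 1) (r := 2)
    (by omega) (by
      intro s hs
      have h1 := hS s (Finset.mem_filter.1 hs).1
      have h2 := (Finset.mem_filter.1 hs).2
      have := (hsep s (x + c) (by omega) (by omega) h1.2.2 (.inl ((hpc x).2 hpx))).1
      omega)
    (fun s hs t ht => hsep' s (Finset.mem_filter.1 hs).1 t (Finset.mem_filter.1 ht).1)
  have hcard := (Finset.card_le_card hsplit).trans ((Finset.card_union_le _ _).trans
    (Nat.add_le_add_right (Finset.card_union_le _ _) _))
  push_cast at c1 c2 c3
  zify at hcard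
  linarith

/-! ### Attachment systems -/
section Attached
variable {V : Type*} {G : SimpleGraph V} {c : ℕ} {u : ℤ → V} {K D : Finset V}

/-- The neighbours of `v` in `S`. -/
noncomputable def nbrs (G : SimpleGraph V) (S : Finset V) (v : V) : Finset V :=
  S.filter (G.Adj v)

theorem mem_nbrs {S : Finset V} {v a : V} : a ∈ nbrs G S v ↔ a ∈ S ∧ G.Adj v a := by
  simp [nbrs]

/-- The vertex set `D` is connected and 2-connectedly attached to the set `K`, whose elements are
placed on a cycle of length `c` by the periodic map `u`, such that no path through `D` between two
elements of `K` is longer than it could be if the cycle were a longest one. -/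
structure Attached (G : SimpleGraph V) (c : ℕ) (u : ℤ → V) (K D : Finset V) : Prop where
  pos : 0 < c
  eq_iff : ∀ s t, u s = u t ↔ (c : ℤ) ∣ s - t
  mem_K : ∀ z, z ∈ K ↔ ∃ s, u s = z
  disj : ∀ v ∈ D, v ∉ K
  conn : ∀ a ∈ D, ∀ b ∈ D, (within G D).Reachable a b
  two : ∀ x, ∀ v ∈ D, v ≠ x → ∃ w ∈ D, ∃ z ∈ K, (within G {a | a ∈ D ∧ a ≠ x}).Reachable v w ∧
    z ≠ x ∧ G.Adj w z
  gap : ∀ i j : ℤ, i < j → j < i + c → ∀ d e R, ListPath G d e R → (∀ a ∈ R, a ∈ D) →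
    G.Adj d (u i) → G.Adj e (u j) → j - i + 1 + R.length ≤ c

namespace Attached

theorem add_c (h : Attached G c u K D) (s : ℤ) : u (s + c) = u s :=
  (h.eq_iff _ _).2 ⟨1, by ring⟩

theorem gap_both (h : Attached G c u K D) {i j : ℤ} (hij : i < j) (hj : j < i + c) {d e : V}
    {R : List V} (hR : ListPath G d e R) (hRD : ∀ a ∈ R, a ∈ D) (hd : G.Adj d (u i))
    (he : G.Adj e (u j)) : i + (R.length + 1) ≤ j ∧ j + (R.length + 1) ≤ i + c := by
  have h1 := h.gap i j hij hj d e R hR hRD hd he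
  have h2 := h.gap j (i + c) hj (by omega) e d R.reverse hR.reverse (by simpa using hRD) he
    (by rwa [h.add_c])
  simp at h2
  omega

theorem exists_pos (h : Attached G c u K D) {z : V} (hz : z ∈ K) (a : ℤ) :
    ∃ s, a ≤ s ∧ s < a + c ∧ u s = z := by
  obtain ⟨s, rfl⟩ := (h.mem_K z).1 hz
  have hc : (0 : ℤ) < c := by exact_mod_cast h.pos
  refine ⟨a + (s - a) % c, ?_, ?_, ?_⟩
  · have := Int.emod_nonneg (s - a) hc.ne'; omega
  · have := Int.emod_lt_of_pos (s - a) hc; omega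
  · rw [h.eq_iff]
    refine ⟨-((s - a) / c), ?_⟩
    have := Int.emod_add_mul_ediv (s - a) c
    linarith

theorem inj (h : Attached G c u K D) {s t : ℤ} (e : u s = u t) (h1 : s < t + c) (h2 : t < s + c) :
    s = t := by
  obtain ⟨k, hk⟩ := (h.eq_iff s t).1 e
  have hc : (0 : ℤ) < c := by exact_mod_cast h.pos
  have h3 : k < 1 := by by_contra hh; have : (c : ℤ) * 1 ≤ c * k := by gcongr; omega
                        omega
  have h4 : -1 < k := by by_contra hh; have : (c : ℤ) * k ≤ c * (-1) := by gcongr; omega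
                         omega
  have : k = 0 := by omega
  subst this; omega

/-- Elements of `K` may be counted by their positions in any window of length `c`. -/
theorem card_eq (h : Attached G c u K D) (P : V → Prop) [DecidablePred P] (a : ℤ) :
    (K.filter P).card = ((Finset.Ico a (a + c)).filter fun s => P (u s)).card := by
  symm
  refine Finset.card_bij (fun s _ => u s) ?_ ?_ ?_
  · intro s hs
    simp only [Finset.mem_filter] at hs ⊢
    exact ⟨(h.mem_K _).2 ⟨s, rfl⟩, hs.2⟩
  · intro s hs t ht e
    simp only [Finset.mem_filter, Finset.mem_Ico] at hs ht
    exact h.inj e (by omega) (by omega)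
  · intro z hz
    simp only [Finset.mem_filter] at hz
    obtain ⟨s, h1, h2, rfl⟩ := h.exists_pos hz.1 a
    exact ⟨s, by simp [h1, h2, hz.2], rfl⟩

/-- Two elements of `K` joined by a path through `D` are far apart on the cycle, in both directions,
so the cycle is at least twice as long as the path. -/
theorem two_mul_length_le (h : Attached G c u K D) {d e z z' : V} {R : List V}
    (hR : ListPath G d e R) (hRD : ∀ a ∈ R, a ∈ D) (hz : z ∈ K) (hz' : z' ∈ K) (hne : z ≠ z')
    (hd : G.Adj d z) (he : G.Adj e z') : 2 * (R.length + 1) ≤ c := by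
  obtain ⟨i, -, -, rfl⟩ := h.exists_pos hz 0
  obtain ⟨j, h1, h2, rfl⟩ := h.exists_pos hz' i
  have hij : i < j := h1.lt_of_ne (by rintro rfl; exact hne rfl)
  have := h.gap_both hij h2 hR hRD hd he
  omega

/-- The two ends of a path through `D` together have few neighbours on the cycle, by
`two_sets_card`. -/
theorem union_card (h : Attached G c u K D) {d e z z' : V} {R : List V}
    (hR : ListPath G d e R) (hRD : ∀ a ∈ R, a ∈ D) (hz : z ∈ K) (hz' : z' ∈ K) (hne : z ≠ z')
    (hd : G.Adj d z) (he : G.Adj e z') :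
    2 * (nbrs G K d ∪ nbrs G K e).card + 2 * (R.length - 1) ≤ c := by
  obtain ⟨i, -, -, rfl⟩ := h.exists_pos hz 0
  obtain ⟨j, h1, h2, rfl⟩ := h.exists_pos hz' i
  have hij : i < j := h1.lt_of_ne (by rintro rfl; exact hne rfl)
  have hlen := hR.length_pos
  have hself : ∀ a ∈ D, ∀ s t : ℤ, s < t → t < s + c → G.Adj a (u s) → G.Adj a (u t) →
      s + 2 ≤ t ∧ t + 2 ≤ s + c := fun a ha s t hst ht h1 h2 => by
    have := h.gap_both hst ht (ListPath.singleton a) (by simpa using ha) h1 h2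
    simp at this; omega
  have hdD := hRD d hR.head_mem
  have heD := hRD e hR.last_mem
  have hpq : ∀ s t : ℤ, s < t → t < s + c → G.Adj d (u s) → G.Adj e (u t) →
      s + (R.length + 1) ≤ t ∧ t + (R.length + 1) ≤ s + c := fun s t hst ht h1 h2 =>
    h.gap_both hst ht hR hRD h1 h2
  have hqp : ∀ s t : ℤ, s < t → t < s + c → G.Adj e (u s) → G.Adj d (u t) →
      s + (R.length + 1) ≤ t ∧ t + (R.length + 1) ≤ s + c := fun s t hst ht h1 h2 => by
    have := h.gap_both hst ht hR.reverse (by simpa using hRD) h1 h2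
    simpa using this
  have := two_sets_card (p := fun s => G.Adj d (u s)) (q := fun s => G.Adj e (u s)) (c := c)
    (m := R.length) hR.length_pos (fun s => by rw [h.add_c])
    (fun s t hst ht hs ht' => by
      rcases hs with hs | hs <;> rcases ht' with ht' | ht'
      · exact hself d hdD s t hst ht hs ht'
      · have := hpq s t hst ht hs ht'; omega
      · have := hqp s t hst ht hs ht'; omega
      · exact hself e heD s t hst ht hs ht')
    hpq hqp hij h2 hd he
  have hu : nbrs G K d ∪ nbrs G K e = K.filter fun z => G.Adj d z ∨ G.Adj e z := by
    ext a; simp [mem_nbrs]; tauto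
  rw [hu, h.card_eq (fun z => G.Adj d z ∨ G.Adj e z) i]
  omega

/-- If the ends of a path through `D` have the same neighbours on the cycle, then any two of these
are at distance more than the number of vertices of the path. -/
theorem common_card (h : Attached G c u K D) {d e : V} {R : List V}
    (hR : ListPath G d e R) (hRD : ∀ a ∈ R, a ∈ D) (heq : nbrs G K d = nbrs G K e)
    (h2 : 2 ≤ (nbrs G K d).card) : (R.length + 1) * (nbrs G K d).card ≤ c := by
  obtain ⟨z, hz, z', hz', hne⟩ := Finset.one_lt_card.1 h2
  have hzK := mem_nbrs.1 hz
  obtain ⟨i, -, -, rfl⟩ := h.exists_pos hzK.1 0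
  have hlen := h.two_mul_length_le hR hRD hzK.1 (mem_nbrs.1 hz').1 hne hzK.2
    (mem_nbrs.1 (heq ▸ hz')).2
  have hde : ∀ s, G.Adj d (u s) → G.Adj e (u s) := fun s hs =>
    (mem_nbrs.1 (heq ▸ mem_nbrs.2 ⟨(h.mem_K _).2 ⟨s, rfl⟩, hs⟩)).2
  have hS : ∀ s ∈ (Finset.Ico i (i + c)).filter (fun s => G.Adj d (u s)),
      i ≤ s ∧ s < i + c ∧ G.Adj d (u s) := by
    intro s hs; simpa [and_assoc] using hs
  have := separated_card (S := (Finset.Ico i (i + c)).filter fun s => G.Adj d (u s))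
    (a := i) (b := i + c - R.length) (r := R.length + 1) (by omega)
    (by
      intro s hs
      obtain ⟨h1, h2, h3⟩ := hS s hs
      refine ⟨h1, ?_⟩
      rcases h1.eq_or_lt with rfl | h1
      · omega
      · have := h.gap_both h1 h2 hR hRD hzK.2 (hde s h3)
        omega)
    (by
      intro s hs t ht hst
      obtain ⟨h1, h2, h3⟩ := hS s hs
      obtain ⟨h4, h5, h6⟩ := hS t ht
      have := h.gap_both hst (by omega) hR hRD h3 (hde t h6)
      push_cast
      omega)
  rw [nbrs, h.card_eq _ i]
  zify
  push_cast at this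
  linarith

/-- If `D` has at least two vertices and is attached to `z`, there are disjoint edges from `D` to
`z` and to another vertex of `K`. -/
theorem exists_pair (h : Attached G c u K D) (hD : 2 ≤ D.card) {a z : V} (ha : a ∈ D)
    (hz : z ∈ K) (haz : G.Adj a z) :
    ∃ d ∈ D, ∃ e ∈ D, d ≠ e ∧ ∃ z' ∈ K, z' ≠ z ∧ G.Adj d z ∧ G.Adj e z' := by
  obtain ⟨b, hb, hba⟩ := Finset.exists_mem_ne hD a
  obtain ⟨w, hw, z₁, hz₁, hbw, -, hwz₁⟩ := h.two a b hb hba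
  have hwa : w ≠ a := (mem_of_within_reachable hbw ⟨hb, hba⟩).2
  by_cases hzz : z₁ = z
  · subst hzz
    obtain ⟨w₂, hw₂, z₂, hz₂, -, hne, hwz₂⟩ := h.two z₁ b hb (fun e => h.disj b hb (e ▸ hz))
    by_cases hwa₂ : w₂ = a
    · subst hwa₂
      exact ⟨w, hw, w₂, hw₂, hwa, z₂, hz₂, hne, hwz₁, hwz₂⟩
    · exact ⟨a, ha, w₂, hw₂, Ne.symm hwa₂, z₂, hz₂, hne, haz, hwz₂⟩
  · exact ⟨a, ha, w, hw, hwa.symm, z₁, hz₁, hzz, haz, hwz₁⟩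

end Attached
end Attached
end
end BondyStability

namespace BondyStability
section
open scoped Classical
variable {V : Type*} {G : SimpleGraph V} {c : ℕ} {u : ℤ → V} {K D : Finset V}

/-! ### Edge counts -/

/-- Twice the number of edges with an end in `D` and the other end in `D ∪ K`. -/
noncomputable def phi (G : SimpleGraph V) (K D : Finset V) : ℕ :=
  ∑ v ∈ D, ((nbrs G D v).card + 2 * (nbrs G K v).card)

theorem phi_insert {v : V} (hv : v ∉ D) :
    phi G K (insert v D) = phi G K D + 2 * (nbrs G D v).card + 2 * (nbrs G K v).card := by
  have h1 : nbrs G (insert v D) v = nbrs G D v := by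
    ext a; simp only [mem_nbrs, Finset.mem_insert]
    constructor
    · rintro ⟨rfl | h, h'⟩
      · exact (G.loopless.irrefl _ h').elim
      · exact ⟨h, h'⟩
    · rintro ⟨h, h'⟩; exact ⟨.inr h, h'⟩
  have h2 : ∀ a ∈ D, (nbrs G (insert v D) a).card =
      (nbrs G D a).card + if G.Adj v a then 1 else 0 := by
    intro a _
    rw [nbrs, Finset.filter_insert]
    simp only [G.adj_comm a v]
    split_ifs with h
    · rw [Finset.card_insert_of_notMem (by simp [hv])]; rfl
    · rfl
  rw [phi, Finset.sum_insert hv, h1]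
  have h3 : ∑ a ∈ D, ((nbrs G (insert v D) a).card + 2 * (nbrs G K a).card) =
      phi G K D + (nbrs G D v).card := by
    rw [phi, nbrs, Finset.card_filter, ← Finset.sum_add_distrib]
    refine Finset.sum_congr rfl fun a ha => ?_
    rw [h2 a ha]; ring
  rw [h3]; ring

theorem nbrs_congr {G' : SimpleGraph V} {S : Finset V} {v : V}
    (h : ∀ a ∈ S, G.Adj v a ↔ G'.Adj v a) : nbrs G S v = nbrs G' S v :=
  Finset.filter_congr h

theorem phi_congr {G' : SimpleGraph V} (h : ∀ v ∈ D, ∀ a, a ∈ D ∨ a ∈ K → (G.Adj v a ↔ G'.Adj v a)) :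
    phi G K D = phi G' K D :=
  Finset.sum_congr rfl fun v hv => by
    rw [nbrs_congr fun a ha => h v hv a (.inl ha), nbrs_congr fun a ha => h v hv a (.inr ha)]

/-! ### Contraction of an edge -/

/-- The graph obtained from `G` by contracting `w` into `v` (and isolating `w`). -/
def merge (G : SimpleGraph V) (v w : V) : SimpleGraph V where
  Adj a b := a ≠ b ∧ a ≠ w ∧ b ≠ w ∧ (G.Adj a b ∨ (a = v ∧ G.Adj w b) ∨ (b = v ∧ G.Adj w a))
  symm := ⟨fun a b h => ⟨h.1.symm, h.2.2.1, h.2.1, by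
    rcases h.2.2.2 with h | h | h
    · exact .inl h.symm
    · exact .inr (.inr h)
    · exact .inr (.inl h)⟩⟩
  loopless := ⟨fun _ h => h.1 rfl⟩

theorem merge_adj {v w a b : V} : (merge G v w).Adj a b ↔
    a ≠ b ∧ a ≠ w ∧ b ≠ w ∧ (G.Adj a b ∨ (a = v ∧ G.Adj w b) ∨ (b = v ∧ G.Adj w a)) := Iff.rfl

theorem merge_adj_of_ne {v w a b : V} (ha : a ≠ v) (ha' : a ≠ w) (hb : b ≠ v) (hb' : b ≠ w) :
    (merge G v w).Adj a b ↔ G.Adj a b := by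
  rw [merge_adj]
  constructor
  · rintro ⟨-, -, -, h | h | h⟩
    · exact h
    · exact (ha h.1).elim
    · exact (hb h.1).elim
  · intro h; exact ⟨h.ne, ha', hb', .inl h⟩

theorem merge_adj_left {v w b : V} (hvw : v ≠ w) (hb : b ≠ v) (hb' : b ≠ w) :
    (merge G v w).Adj v b ↔ G.Adj v b ∨ G.Adj w b := by
  rw [merge_adj]
  constructor
  · rintro ⟨-, -, -, h | h | h⟩
    · exact .inl h
    · exact .inr h.2
    · exact (hb h.1).elim
  · rintro (h | h)
    · exact ⟨hb.symm, hvw, hb', .inl h⟩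
    · exact ⟨hb.symm, hvw, hb', .inr (.inl ⟨rfl, h⟩)⟩

/-- Contracting the edge `vw` loses this edge and one edge at each common neighbour of `v` and
`w`. -/
theorem phi_merge {v w : V} (hv : v ∈ D) (hw : w ∈ D) (hvK : v ∉ K) (hwK : w ∉ K)
    (hvw : G.Adj v w) :
    phi G K D = phi (merge G v w) K (D.erase w) +
      2 * (1 + (nbrs G D v ∩ nbrs G D w).card + (nbrs G K v ∩ nbrs G K w).card) := by
  set D₀ := (D.erase w).erase v with hD₀
  have hne := hvw.ne
  have hDw : D.erase w = insert v D₀ := by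
    rw [hD₀, Finset.insert_erase]; simp [hv, hne]
  have hD : D = insert w (insert v D₀) := by rw [← hDw, Finset.insert_erase hw]
  have hvD : v ∉ D₀ := by simp [hD₀]
  have hwD : w ∉ insert v D₀ := by rw [← hDw]; simp
  have hwD₀ : w ∉ D₀ := fun h => hwD (Finset.mem_insert_of_mem h)
  have e1 : nbrs G D v ∩ nbrs G D w = nbrs G D₀ v ∩ nbrs G D₀ w := by
    ext a
    simp only [Finset.mem_inter, mem_nbrs, hD, Finset.mem_insert]
    constructor
    · rintro ⟨⟨rfl | rfl | h, h1⟩, -, h2⟩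
      · exact (G.loopless.irrefl _ h2).elim
      · exact (G.loopless.irrefl _ h1).elim
      · exact ⟨⟨h, h1⟩, h, h2⟩
    · rintro ⟨⟨h, h1⟩, -, h2⟩
      exact ⟨⟨.inr (.inr h), h1⟩, .inr (.inr h), h2⟩
  have e2 : (nbrs G (insert v D₀) w).card = (nbrs G D₀ w).card + 1 := by
    rw [nbrs, Finset.filter_insert, if_pos hvw.symm, Finset.card_insert_of_notMem (by simp [hvD])]
    rfl
  have hu : ∀ S : Finset V, v ∉ S → w ∉ S →
      (nbrs (merge G v w) S v).card + (nbrs G S v ∩ nbrs G S w).card =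
        (nbrs G S v).card + (nbrs G S w).card := by
    intro S hvS hwS
    rw [← Finset.card_union_add_card_inter (nbrs G S v)]
    congr 2
    ext a
    simp only [Finset.mem_union, mem_nbrs]
    constructor
    · rintro ⟨h, h'⟩
      rw [merge_adj_left hne (by rintro rfl; exact hvS h) (by rintro rfl; exact hwS h)] at h'
      tauto
    · intro h'
      have h : a ∈ S := by tauto
      refine ⟨h, ?_⟩
      rw [merge_adj_left hne (by rintro rfl; exact hvS h) (by rintro rfl; exact hwS h)]
      tauto
  have h1 := hu D₀ hvD hwD₀
  have h2 := hu K hvK hwK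
  have h3 : phi (merge G v w) K D₀ = phi G K D₀ := phi_congr fun a ha b hb => by
    apply merge_adj_of_ne
    · rintro rfl; exact hvD ha
    · rintro rfl; exact hwD₀ ha
    · rintro rfl; exact hb.elim hvD hvK
    · rintro rfl; exact hb.elim hwD₀ hwK
  rw [e1, hDw, phi_insert hvD, h3]
  conv_lhs => rw [hD, phi_insert hwD, phi_insert hvD, e2]
  omega

/-- Contraction preserves reachability inside a vertex set, with `w` replaced by `v`. -/
theorem merge_reachable {v w : V} {S S' : Set V} (hS : ∀ a ∈ S, a ≠ w → a ∈ S')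
    (hv : w ∈ S → v ∈ S') (hvw : v ≠ w) {a b : V} (h : (within G S).Reachable a b) :
    (within (merge G v w) S').Reachable (if a = w then v else a) (if b = w then v else b) := by
  refine reachable_induction h
    (fun y => (within (merge G v w) S').Reachable (if a = w then v else a)
      (if y = w then v else y)) (.refl _) ?_
  rintro x y hx ⟨hxy, hxS, hyS⟩
  refine hx.trans ?_
  by_cases hxw : x = w
  · subst hxw
    rw [if_pos rfl, if_neg hxy.ne.symm]
    by_cases hyv : y = v
    · rw [hyv]
    · exact SimpleGraph.Adj.reachable ⟨(merge_adj_left hvw hyv hxy.ne.symm).2 (.inr hxy),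
        hv hxS, hS y hyS hxy.ne.symm⟩
  · by_cases hyw : y = w
    · subst hyw
      rw [if_pos rfl, if_neg hxw]
      by_cases hxv : x = v
      · rw [hxv]
      · exact SimpleGraph.Adj.reachable ⟨((merge_adj_left hvw hxv hxw).2 (.inr hxy.symm)).symm,
          hS x hxS hxw, hv hyS⟩
    · rw [if_neg hxw, if_neg hyw]
      exact SimpleGraph.Adj.reachable ⟨⟨hxy.ne, hxw, hyw, .inl hxy⟩, hS x hxS hxw, hS y hyS hyw⟩

/-- A path of the contracted graph ending in the contracted vertex lifts to a path ending in
`v` or in `w`. -/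
theorem merge_lift {v w d z : V} {P : List V} (hvw : v ≠ w)
    (hP : ListPath (merge G v w) d v (P ++ [v])) (hwP : w ∉ P) (hzv : z ≠ v) (hzw : z ≠ w)
    (hd : (merge G v w).Adj d z) :
    ∃ t, (t = v ∨ t = w) ∧ ∃ d', ListPath G d' t (P ++ [t]) ∧ G.Adj d' z := by
  rcases List.eq_nil_or_concat' P with rfl | ⟨P', a, rfl⟩
  · have : d = v := by simpa using hP.head.symm
    subst this
    rcases (merge_adj_left hvw hzv hzw).1 hd with h | h
    · exact ⟨d, .inl rfl, d, ListPath.singleton d, h⟩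
    · exact ⟨w, .inr rfl, w, ListPath.singleton w, h⟩
  · have hnd := hP.nodup
    have hvP : v ∉ P' ++ [a] := by
      intro h
      exact (List.nodup_append'.1 hnd).2.2 h (by simp)
    have hav : a ≠ v := by rintro rfl; simp at hvP
    have haw : a ≠ w := by rintro rfl; simp at hwP
    have hch := hP.chain
    have hch1 : (P' ++ [a]).IsChain G.Adj :=
      hch.left_of_append.imp_of_mem_imp fun x y hx hy hxy =>
        (merge_adj_of_ne (by rintro rfl; exact hvP hx) (by rintro rfl; exact hwP hx)
          (by rintro rfl; exact hvP hy) (by rintro rfl; exact hwP hy)).1 hxy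
    have hadj : (merge G v w).Adj a v := by
      rw [List.append_assoc, List.isChain_append] at hch
      have := hch.2.1
      simpa using this
    have hhead : (P' ++ [a]).head? = some d := by
      have := hP.head
      rw [List.head?_append_of_ne_nil _ (by simp)] at this; exact this
    have hPath : ListPath G d a (P' ++ [a]) :=
      ⟨hhead, by simp, hch1, (List.nodup_append'.1 hnd).1⟩
    have hdv : d ≠ v := by rintro rfl; exact hvP hPath.head_mem
    have hdw : d ≠ w := by rintro rfl; exact hwP hPath.head_mem
    have hdz := (merge_adj_of_ne hdv hdw hzv hzw).1 hd
    rcases (merge_adj_left hvw hav haw).1 hadj.symm with h | h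
    · exact ⟨v, .inl rfl, d, hPath.concat h.symm hvP, hdz⟩
    · exact ⟨w, .inr rfl, d, hPath.concat h.symm hwP, hdz⟩

/-- The attachment conditions survive the contraction of an edge whose ends do not separate a part
of `D` from `K`: a path of the contracted graph through `D` lifts to one of `G` which is at least
as long. -/
theorem Attached.contract (h : Attached G c u K D) {v w : V} (hv : v ∈ D) (hw : w ∈ D)
    (hvw : G.Adj v w)
    (hcut : ∀ y ∈ D, y ≠ v → y ≠ w → ∃ a ∈ D, ∃ z ∈ K,
      (within G {a | a ∈ D ∧ a ≠ v ∧ a ≠ w}).Reachable y a ∧ G.Adj a z) :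
    Attached (merge G v w) c u K (D.erase w) where
  pos := h.pos
  eq_iff := h.eq_iff
  mem_K := h.mem_K
  disj a ha := h.disj a (Finset.mem_of_mem_erase ha)
  conn a ha b hb := by
    have := merge_reachable (v := v) (w := w) (S := (D : Set V)) (S' := (D.erase w : Finset V))
      (by intro a ha haw; simp at ha; simp [ha, haw]) (by intro _; simp [hv, hvw.ne]) hvw.ne
      (h.conn a (Finset.mem_of_mem_erase ha) b (Finset.mem_of_mem_erase hb))
    rwa [if_neg (Finset.ne_of_mem_erase ha), if_neg (Finset.ne_of_mem_erase hb)] at this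
  two x y hy hyx := by
    have hyD := Finset.mem_of_mem_erase hy
    have hyw := Finset.ne_of_mem_erase hy
    have hKv : ∀ z ∈ K, z ≠ v ∧ z ≠ w := fun z hz =>
      ⟨fun e => h.disj v hv (e ▸ hz), fun e => h.disj w hw (e ▸ hz)⟩
    by_cases hxv : x = v
    · subst hxv
      obtain ⟨a, ha, z, hz, hya, haz⟩ := hcut y hyD hyx hyw
      have haS := mem_of_within_reachable hya ⟨hyD, hyx, hyw⟩
      refine ⟨a, Finset.mem_erase.2 ⟨haS.2.2, ha⟩, z, hz, ?_, (hKv z hz).1, ?_⟩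
      · have := merge_reachable (v := x) (w := w) (S' := {a | a ∈ D.erase w ∧ a ≠ x})
          (by rintro b ⟨h1, h2, h3⟩ -; exact ⟨Finset.mem_erase.2 ⟨h3, h1⟩, h2⟩)
          (fun h => (h.2.2 rfl).elim) hvw.ne hya
        rwa [if_neg hyw, if_neg haS.2.2] at this
      · exact (merge_adj_of_ne haS.2.1 haS.2.2 (hKv z hz).1 (hKv z hz).2).2 haz
    · obtain ⟨a, ha, z, hz, hya, hzx, haz⟩ := h.two x y hyD hyx
      have := merge_reachable (v := v) (w := w) (S' := {a | a ∈ D.erase w ∧ a ≠ x})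
          (by rintro b ⟨h1, h2⟩ h3; exact ⟨Finset.mem_erase.2 ⟨h3, h1⟩, h2⟩)
          (fun _ => ⟨Finset.mem_erase.2 ⟨hvw.ne, hv⟩, Ne.symm hxv⟩) hvw.ne hya
      rw [if_neg hyw] at this
      refine ⟨_, ?_, z, hz, this, hzx, ?_⟩
      · split_ifs with haw
        · exact Finset.mem_erase.2 ⟨hvw.ne, hv⟩
        · exact Finset.mem_erase.2 ⟨haw, ha⟩
      · split_ifs with haw
        · subst haw
          exact (merge_adj_left hvw.ne (hKv z hz).1 (hKv z hz).2).2 (.inr haz)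
        · exact ⟨haz.ne, haw, (hKv z hz).2, .inl haz⟩
  gap i j hij hj d e R hR hRD hd he := by
    have hne : ∀ s, u s ≠ v ∧ u s ≠ w := fun s =>
      ⟨fun e => h.disj v hv ((h.mem_K _).2 ⟨s, e⟩), fun e => h.disj w hw ((h.mem_K _).2 ⟨s, e⟩)⟩
    have hRw : w ∉ R := fun hh => by simpa using hRD w hh
    have hRD' : ∀ a ∈ R, a ∈ D := fun a ha => Finset.mem_of_mem_erase (hRD a ha)
    by_cases hvR : v ∈ R
    · obtain ⟨P, Q, rfl⟩ := List.append_of_mem hvR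
      have hnd := hR.nodup
      have hPv : ListPath (merge G v w) d v (P ++ [v]) := hR.left
      have hQv : ListPath (merge G v w) e v (Q.reverse ++ [v]) := by simpa using hR.right.reverse
      obtain ⟨t, ht, d', hd', hdz⟩ := merge_lift hvw.ne hPv
        (fun hh => hRw (by simp [hh])) (hne i).1 (hne i).2 hd
      obtain ⟨t', ht', e', he', hez⟩ := merge_lift hvw.ne hQv
        (fun hh => hRw (by simp at hh; simp [hh])) (hne j).1 (hne j).2 he
      have hQ' := he'.reverse
      simp only [List.reverse_append, List.reverse_reverse, List.reverse_singleton,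
        List.singleton_append] at hQ'
      have hvD : ∀ t, t = v ∨ t = w → t ∈ D := by rintro t (rfl | rfl) <;> assumption
      have hmem : ∀ a ∈ P ++ [t], a ∈ D := by
        intro a ha
        simp only [List.mem_append, List.mem_singleton] at ha
        rcases ha with ha | rfl
        · exact hRD' a (by simp [ha])
        · exact hvD _ ht
      have hmem' : ∀ a ∈ t' :: Q, a ∈ D := by
        intro a ha
        simp only [List.mem_cons] at ha
        rcases ha with rfl | ha
        · exact hvD _ ht'
        · exact hRD' a (by simp [ha])
      have hPQ : ∀ a ∈ P, a ∉ Q := fun a ha ha' =>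
        (List.nodup_append'.1 hnd).2.2 ha (List.mem_cons_of_mem _ ha')
      have hPt : t ∉ P := fun hh => (List.nodup_append'.1 hd'.nodup).2.2 hh (by simp)
      have hQt : t' ∉ Q := (List.nodup_cons.1 hQ'.nodup).1
      have hvP : v ∉ P := fun hh => (List.nodup_append'.1 hPv.nodup).2.2 hh (by simp)
      have hvQ : v ∉ Q := fun hh =>
        (List.nodup_append'.1 hQv.nodup).2.2 (by simpa using hh) (by simp)
      have hwP : w ∉ P := fun hh => hRw (by simp [hh])
      have hwQ : w ∉ Q := fun hh => hRw (by simp [hh])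
      have htQ : t ∉ Q := by rcases ht with rfl | rfl <;> assumption
      have htP : t' ∉ P := by rcases ht' with rfl | rfl <;> assumption
      by_cases htt : t = t'
      · subst htt
        have hL : ListPath G d' e' (P ++ t :: Q) := by
          refine ⟨?_, ?_, ?_, ?_⟩
          · have := hd'.head
            cases P <;> simpa using this
          · have := hQ'.last
            rwa [List.getLast?_append_of_ne_nil _ (by simp)]
          · exact List.isChain_split.2 ⟨hd'.chain, hQ'.chain⟩
          · refine List.nodup_append'.2 ⟨(List.nodup_append'.1 hd'.nodup).1, hQ'.nodup, ?_⟩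
            intro a ha ha'
            rcases List.mem_cons.1 ha' with rfl | ha'
            · exact hPt ha
            · exact hPQ a ha ha'
        have := h.gap i j hij hj d' e' _ hL (by
          intro a ha
          rcases List.mem_append.1 ha with ha | ha
          · exact hmem a (by simp [ha])
          · exact hmem' a ha) hdz hez
        simpa using this
      · have hadj : G.Adj t t' := by
          rcases ht with rfl | rfl <;> rcases ht' with rfl | rfl
          · exact (htt rfl).elim
          · exact hvw
          · exact hvw.symm
          · exact (htt rfl).elim
        have hL := hd'.append hQ' hadj (by
          intro a ha ha'
          simp only [List.mem_append, List.mem_cons, List.not_mem_nil, or_false] at ha ha'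
          rcases ha with ha | rfl
          · rcases ha' with rfl | ha'
            · exact htP ha
            · exact hPQ a ha ha'
          · rcases ha' with rfl | ha'
            · exact htt rfl
            · exact htQ ha')
        have := h.gap i j hij hj d' e' _ hL (by
          intro a ha
          rcases List.mem_append.1 ha with ha | ha
          · exact hmem a ha
          · exact hmem' a ha) hdz hez
        simp at this ⊢; omega
    · have hRv : ∀ a ∈ R, a ≠ v ∧ a ≠ w := fun a ha =>
        ⟨fun e => hvR (e ▸ ha), fun e => hRw (e ▸ ha)⟩
      refine h.gap i j hij hj d e R ⟨hR.head, hR.last, ?_, hR.nodup⟩ hRD'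
        ((merge_adj_of_ne (hRv d hR.head_mem).1 (hRv d hR.head_mem).2 (hne i).1 (hne i).2).1 hd)
        ((merge_adj_of_ne (hRv e hR.last_mem).1 (hRv e hR.last_mem).2 (hne j).1 (hne j).2).1 he)
      exact hR.chain.imp_of_mem_imp fun x y hx hy hxy =>
        (merge_adj_of_ne (hRv x hx).1 (hRv x hx).2 (hRv y hy).1 (hRv y hy).2).1 hxy

end
end BondyStability

namespace BondyStability
section
open scoped Classical
variable {V : Type*} {G : SimpleGraph V} {c k : ℕ} {u : ℤ → V} {K D : Finset V}

/-! ### Longest paths between attachment vertices -/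

/-- `R` is a path in `D` from `d` to `e`, and `d`, `e` have distinct neighbours in `K`. -/
structure EarPath (G : SimpleGraph V) (K D : Finset V) (d e : V) (R : List V) : Prop where
  path : ListPath G d e R
  sub : ∀ a ∈ R, a ∈ D
  ends : ∃ z ∈ K, ∃ z' ∈ K, z ≠ z' ∧ G.Adj d z ∧ G.Adj e z'

/-- A path as in `EarPath` with the maximum number of vertices. -/
structure LongestEar (G : SimpleGraph V) (K D : Finset V) (d e : V) (R : List V) : Prop
    extends EarPath G K D d e R where
  le : ∀ d' e' R', EarPath G K D d' e' R' → R'.length ≤ R.length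

theorem EarPath.reverse {d e : V} {R : List V} (h : EarPath G K D d e R) :
    EarPath G K D e d R.reverse where
  path := h.path.reverse
  sub := by simpa using h.sub
  ends := by
    obtain ⟨z, hz, z', hz', hne, hd, he⟩ := h.ends
    exact ⟨z', hz', z, hz, hne.symm, he, hd⟩

theorem LongestEar.reverse {d e : V} {R : List V} (h : LongestEar G K D d e R) :
    LongestEar G K D e d R.reverse where
  toEarPath := h.toEarPath.reverse
  le := by simpa using h.le

/-- The ends of each edge in `D` which does not separate a part of `D` from `K` have at least `r`
common neighbours in `D ∪ K`. If this fails for `r = k - 1`, contracting the edge loses at most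
`k - 1` edges. -/
def Rigid (G : SimpleGraph V) (K D : Finset V) (r : ℕ) : Prop :=
  ∀ v ∈ D, ∀ w ∈ D, G.Adj v w →
    (∀ y ∈ D, y ≠ v → y ≠ w → ∃ a ∈ D, ∃ z ∈ K,
      (within G {a | a ∈ D ∧ a ≠ v ∧ a ≠ w}).Reachable y a ∧ G.Adj a z) →
    r ≤ (nbrs G D v ∩ nbrs G D w).card + (nbrs G K v ∩ nbrs G K w).card

theorem exists_longestEar {d e : V} {R : List V} (hR : EarPath G K D d e R) :
    ∃ d' e' R', LongestEar G K D d' e' R' ∧ R.length ≤ R'.length := by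
  have hb : ∀ d' e' R', EarPath G K D d' e' R' → R'.length ≤ D.card := by
    intro d' e' R' h
    rw [← List.toFinset_card_of_nodup h.path.nodup]
    exact Finset.card_le_card fun a ha => h.sub a (List.mem_toFinset.1 ha)
  let P : ℕ → Prop := fun n => ∃ d' e' R', EarPath G K D d' e' R' ∧ R'.length = n
  have hP : P R.length := ⟨d, e, R, hR, rfl⟩
  obtain ⟨d', e', R', h', hlen⟩ := Nat.findGreatest_spec (P := P) (hb d e R hR) hP
  refine ⟨d', e', R', ⟨h', fun d'' e'' R'' h'' => ?_⟩, ?_⟩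
  · rw [hlen]; exact Nat.le_findGreatest (hb _ _ _ h'') ⟨_, _, _, h'', rfl⟩
  · rw [hlen]; exact Nat.le_findGreatest (hb _ _ _ hR) hP

/-- The first edge of a longest ear does not separate: otherwise the ear could be rerouted through
the separated part. -/
theorem LongestEar.not_cut (hA : Attached G c u K D) {d w e : V} {Q : List V}
    (h : LongestEar G K D d e (d :: w :: Q)) :
    ∀ y ∈ D, y ≠ d → y ≠ w → ∃ a ∈ D, ∃ z ∈ K,
      (within G {a | a ∈ D ∧ a ≠ d ∧ a ≠ w}).Reachable y a ∧ G.Adj a z := by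
  intro y hy hyd hyw
  by_contra! hcon
  set S : Set V := {a | a ∈ D ∧ a ≠ d ∧ a ≠ w} with hS
  have hdD : d ∈ D := h.sub d (by simp)
  have hwD : w ∈ D := h.sub w (by simp)
  have hnd := h.path.nodup
  simp only [List.nodup_cons, List.mem_cons, not_or] at hnd
  have hyS : y ∈ S := ⟨hy, hyd, hyw⟩
  have hQF : ∀ q ∈ Q, ¬ (within G S).Reachable y q := by
    intro q hq hyq
    obtain ⟨Q₁, Q₂, rfl⟩ := List.append_of_mem hq
    have hqe : ListPath G q e (q :: Q₂) := h.path.right (P := d :: w :: Q₁)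
    obtain ⟨z, -, z', hz', -, -, hez'⟩ := h.ends
    refine hcon e (h.sub e h.path.last_mem) z' hz' (hyq.trans (hqe.reachable fun x hx => ?_)) hez'
    have hx' : x ∈ Q₁ ++ q :: Q₂ := List.mem_append_right _ hx
    exact ⟨h.sub x (by simp only [List.mem_cons]; exact .inr (.inr hx')),
      by rintro rfl; exact hnd.1.2 hx', by rintro rfl; exact hnd.2.1 hx'⟩
  have key : ∀ p q, ((p = d ∧ q = w) ∨ (p = w ∧ q = d)) →
      ∃ f, (within G S).Reachable y f ∧ G.Adj f q := by
    intro p q hpq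
    have hyp : y ≠ p := by rcases hpq with ⟨rfl, -⟩ | ⟨rfl, -⟩ <;> assumption
    obtain ⟨a, ha, z, hz, hya, -, haz⟩ := hA.two p y hy hyp
    obtain ⟨f, f', hf, hf', hadj⟩ := exists_exit hya (fun x => (within G S).Reachable y x)
      (.refl _) (fun hh => hcon a ha z hz hh haz)
    refine ⟨f, hf, ?_⟩
    have hfS := mem_of_within_reachable hf hyS
    by_cases hfq : f' = q
    · exact hfq ▸ hadj.1
    · refine (hf' (hf.trans (SimpleGraph.Adj.reachable ⟨hadj.1, hfS, hadj.2.2.1, ?_, ?_⟩))).elim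
      · rintro rfl; rcases hpq with ⟨rfl, -⟩ | ⟨-, rfl⟩
        · exact hadj.2.2.2 rfl
        · exact hfq rfl
      · rintro rfl; rcases hpq with ⟨-, rfl⟩ | ⟨rfl, -⟩
        · exact hfq rfl
        · exact hadj.2.2.2 rfl
  obtain ⟨f, hf, hfw⟩ := key d w (.inl ⟨rfl, rfl⟩)
  obtain ⟨g, hg, hgd⟩ := key w d (.inr ⟨rfl, rfl⟩)
  obtain ⟨W, hW, hWS⟩ := exists_listPath (hg.symm.trans hf) (mem_of_within_reachable hg hyS)
  have hp1 := hW.append h.path.tail hfw (by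
    intro x hx hx'
    rcases List.mem_cons.1 hx' with rfl | hx'
    · exact (hWS _ hx).1.2.2 rfl
    · exact hQF x hx' (hg.trans (hWS x hx).2))
  have hp2 := hp1.cons hgd.symm (by
    simp only [List.mem_append, List.mem_cons, not_or]
    exact ⟨fun hd => (hWS d hd).1.2.1 rfl, hnd.1.1, hnd.1.2⟩)
  have := h.le _ _ _ ⟨hp2, by
    intro x hx
    simp only [List.mem_append, List.mem_cons] at hx
    rcases hx with rfl | hx | rfl | hx
    · exact hdD
    · exact (hWS x hx).1.1
    · exact hwD
    · exact h.sub x (by simp [hx]), h.ends⟩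
  have hpos := hW.length_pos
  simp only [List.length_cons, List.length_append] at this
  omega

/-- A common neighbour in `D` of the first two vertices of a longest ear lies on the ear, as it
could be inserted between them otherwise. -/
theorem LongestEar.common_sub {d w e : V} {Q : List V}
    (h : LongestEar G K D d e (d :: w :: Q)) :
    nbrs G D d ∩ nbrs G D w ⊆ Q.toFinset := by
  intro a ha
  simp only [Finset.mem_inter, mem_nbrs] at ha
  by_contra hQ
  rw [List.mem_toFinset] at hQ
  have hnd := h.path.nodup
  simp only [List.nodup_cons, List.mem_cons, not_or] at hnd
  have := h.le _ _ _ ⟨(h.path.tail.cons ha.2.2.symm (by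
      simp only [List.mem_cons, not_or]; exact ⟨ha.2.2.ne.symm, hQ⟩)).cons ha.1.2 (by
      simp only [List.mem_cons, not_or]; exact ⟨ha.1.2.ne, hnd.1⟩), by
    intro x hx
    rcases List.mem_cons.1 hx with rfl | hx
    · exact h.sub x (by simp)
    · rcases List.mem_cons.1 hx with rfl | hx
      · exact ha.1.1
      · exact h.sub x (List.mem_cons_of_mem _ hx), h.ends⟩
  simp at this

theorem LongestEar.common_card (hA : Attached G c u K D) {r : ℕ} (hr : Rigid G K D r) {d w e : V}
    {Q : List V} (h : LongestEar G K D d e (d :: w :: Q)) :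
    r ≤ (nbrs G D d ∩ nbrs G D w).card + (nbrs G K d ∩ nbrs G K w).card :=
  hr d (h.sub d (by simp)) w (h.sub w (by simp)) (by
    have := h.path.chain; simp at this; exact this.1) (h.not_cut hA)

theorem LongestEar.common_card_le {d w e : V}
    {Q : List V} (h : LongestEar G K D d e (d :: w :: Q)) :
    (nbrs G D d ∩ nbrs G D w).card ≤ Q.length :=
  (Finset.card_le_card h.common_sub).trans (List.toFinset_card_le _)

theorem exists_cons_cons {d e : V} {R : List V} (h : ListPath G d e R) (h2 : 2 ≤ R.length) :
    ∃ w Q, R = d :: w :: Q := by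
  match R, h2 with
  | a :: w :: Q, _ =>
    have : a = d := by simpa using h.head
    exact ⟨w, Q, by rw [this]⟩

/-- In a rigid system a longest ear is as short as possible: the first two vertices have `k - 1`
common neighbours, in conflict with `union_card` and `common_card` unless the ear has exactly
`k - 1` vertices, its ends have the same two neighbours in `K`, and the first vertex is joined to
all the others. -/
theorem LongestEar.extremal (hA : Attached G c u K D) (hk : 5 ≤ k) (hc : c ≤ 2 * k + 1)
    (hr : Rigid G K D (k - 1)) {d e : V} {R : List V} (h : LongestEar G K D d e R)
    (h2 : 2 ≤ R.length) :
    R.length = k - 1 ∧ nbrs G K d = nbrs G K e ∧ (nbrs G K d).card = 2 ∧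
      ∀ a ∈ R, a ≠ d → G.Adj d a := by
  obtain ⟨z, hz, z', hz', hne, hd, he⟩ := h.ends
  have hlen := hA.two_mul_length_le h.path h.sub hz hz' hne hd he
  obtain ⟨w, Q, rfl⟩ := exists_cons_cons h.path h2
  have key : ∀ {d e w Q}, LongestEar G K D d e (d :: w :: Q) →
      k - 1 ≤ Q.length + (nbrs G K d).card := by
    intro d e w Q h
    have h1 := h.common_card hA hr
    have h2 := h.common_card_le
    have h3 := Finset.card_le_card (Finset.inter_subset_left : nbrs G K d ∩ nbrs G K w ⊆ _)
    omega
  have ht := key h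
  have ht' : k - 1 ≤ Q.length + (nbrs G K e).card := by
    have hrev := h.reverse
    obtain ⟨w', Q', hQ'⟩ := exists_cons_cons hrev.path (by simp)
    have hl : Q'.length = Q.length := by
      have := congrArg List.length hQ'
      simp at this; omega
    rw [hQ'] at hrev
    rw [← hl]; exact key hrev
  have hu := hA.union_card h.path h.sub hz hz' hne hd he
  simp only [List.length_cons] at hu hlen ⊢
  have hsub1 : nbrs G K d ⊆ nbrs G K d ∪ nbrs G K e := Finset.subset_union_left
  have hsub2 : nbrs G K e ⊆ nbrs G K d ∪ nbrs G K e := Finset.subset_union_right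
  have hc1 := Finset.card_le_card hsub1
  have hc2 := Finset.card_le_card hsub2
  have heq : nbrs G K d = nbrs G K e := by
    rw [Finset.eq_of_subset_of_card_le hsub1 (by omega)]
    exact (Finset.eq_of_subset_of_card_le hsub2 (by omega)).symm
  have hcom := hA.common_card h.path h.sub heq (by omega)
  simp only [List.length_cons] at hcom
  have hcard : (nbrs G K d).card = 2 := by
    obtain ⟨t, ht⟩ : ∃ t, (nbrs G K d).card = t + 2 := ⟨_, (Nat.sub_add_cancel (by omega)).symm⟩
    have hQ : Q.length + t + 3 = k := by omega
    rw [ht] at hcom ⊢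
    rcases Nat.eq_zero_or_pos t with rfl | htpos
    · rfl
    · exfalso
      obtain ⟨t', rfl⟩ : ∃ t', t = t' + 1 := ⟨t - 1, by omega⟩
      have : (Q.length + 1 + 1 + 1) * (t' + 1 + 2) =
        t' * Q.length + 3 * Q.length + 3 * t' + 9 := by ring
      have := Nat.zero_le (t' * Q.length)
      omega
  refine ⟨by omega, heq, hcard, ?_⟩
  have h1 := h.common_card hA hr
  have h3 := Finset.card_le_card (Finset.inter_subset_left : nbrs G K d ∩ nbrs G K w ⊆ _)
  have hfull := Finset.eq_of_subset_of_card_le h.common_sub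
    ((List.toFinset_card_le Q).trans (by omega))
  intro a ha had
  rcases List.mem_cons.1 ha with rfl | ha
  · exact (had rfl).elim
  · rcases List.mem_cons.1 ha with rfl | ha
    · have := h.path.chain; simp at this; exact this.1
    · rw [← List.mem_toFinset, ← hfull] at ha
      exact (mem_nbrs.1 (Finset.mem_inter.1 ha).1).2

/-- As the ends of a longest ear in a rigid system are adjacent, the ear may be opened at its first
edge instead. -/
theorem LongestEar.rotate (hA : Attached G c u K D) (hk : 5 ≤ k) (hc : c ≤ 2 * k + 1)
    (hr : Rigid G K D (k - 1)) {d w e : V} {Q : List V}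
    (h : LongestEar G K D d e (d :: w :: Q)) : LongestEar G K D w d (w :: Q ++ [d]) := by
  obtain ⟨h1, h2, h3, h4⟩ := h.extremal hA hk hc hr (by simp)
  have hnd := h.path.nodup
  simp only [List.nodup_cons] at hnd
  have hp := h.path.tail.concat (a := d) (h4 e h.path.last_mem (by
    rintro rfl; exact hnd.1 h.path.tail.last_mem)).symm hnd.1
  refine ⟨⟨hp, ?_, ?_⟩, fun d' e' R' h' => ?_⟩
  · intro a ha
    refine h.sub a ?_
    simp only [List.mem_append, List.mem_cons, List.not_mem_nil, or_false] at ha ⊢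
    tauto
  · have h5 := h.common_card hA hr
    have h6 := h.common_card_le
    simp only [List.length_cons] at h1
    have : 1 < (nbrs G K d ∩ nbrs G K w).card := by omega
    obtain ⟨z, hz, z', hz', hne⟩ := Finset.one_lt_card.1 this
    simp only [Finset.mem_inter, mem_nbrs] at hz hz'
    exact ⟨z, hz.1.1, z', hz'.1.1, hne, hz.2.2, hz'.1.2⟩
  · have := h.le _ _ _ h'
    simp at this ⊢; omega

/-- By repeated rotation, a longest ear of a rigid system may be made to start at any of its
vertices. -/
theorem LongestEar.rotate_append (hA : Attached G c u K D) (hk : 5 ≤ k) (hc : c ≤ 2 * k + 1)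
    (hr : Rigid G K D (k - 1)) {q : V} {P S : List V} : ∀ {d e : V},
    LongestEar G K D d e (P ++ q :: S) → 2 ≤ (P ++ q :: S).length →
    ∃ e', LongestEar G K D q e' (q :: S ++ P) ∧ nbrs G K q = nbrs G K d := by
  induction P generalizing S with
  | nil =>
    intro d e h _
    have : q = d := by simpa using h.path.head
    subst this
    exact ⟨e, by simpa using h, rfl⟩
  | cons a P ih =>
    intro d e h h2
    have : a = d := by simpa using h.path.head
    subst this
    obtain ⟨w, Q, hQ⟩ : ∃ w Q, P ++ q :: S = w :: Q := by
      cases P with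
      | nil => exact ⟨q, S, rfl⟩
      | cons b P => exact ⟨b, P ++ q :: S, rfl⟩
    have hR : (a :: P ++ q :: S) = a :: w :: Q := by rw [← hQ]; rfl
    rw [hR] at h
    have hrot := h.rotate hA hk hc hr
    have hR' : w :: Q ++ [a] = P ++ q :: (S ++ [a]) := by rw [← hQ]; simp
    have hs := hrot.extremal hA hk hc hr (by simp)
    rw [hR'] at hrot
    obtain ⟨e', h1, h2⟩ := ih hrot (by simp; omega)
    exact ⟨e', by simpa using h1, h2.trans hs.2.1⟩

/-- In a rigid system all vertices of a longest ear are joined to each other and to the same two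
vertices of `K`. -/
theorem LongestEar.clique (hA : Attached G c u K D) (hk : 5 ≤ k) (hc : c ≤ 2 * k + 1)
    (hr : Rigid G K D (k - 1)) {d e : V} {R : List V} (h : LongestEar G K D d e R)
    (h2 : 2 ≤ R.length) {q : V} (hq : q ∈ R) :
    nbrs G K q = nbrs G K d ∧ ∀ a ∈ R, a ≠ q → G.Adj q a := by
  obtain ⟨P, S, rfl⟩ := List.append_of_mem hq
  obtain ⟨e', h1, h3⟩ := h.rotate_append hA hk hc hr h2
  refine ⟨h3, fun a ha haq => (h1.extremal hA hk hc hr ?_).2.2.2 a ?_ haq⟩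
  · simp at h2 ⊢; omega
  · simp at ha ⊢; tauto

theorem listPath_of_clique {L : List V} (hL : L.Nodup) (hne : L ≠ [])
    (hcl : ∀ a ∈ L, ∀ b ∈ L, a ≠ b → G.Adj a b) :
    ListPath G (L.head hne) (L.getLast hne) L where
  head := List.head?_eq_some_head hne
  last := List.getLast?_eq_some_getLast hne
  chain := List.Pairwise.isChain <|
    List.Pairwise.imp_of_mem (fun {a b} ha hb hab => hcl a ha b hb hab) hL
  nodup := hL

/-- In a rigid system a longest ear covers `D`. -/
theorem LongestEar.covers (hA : Attached G c u K D) (hk : 5 ≤ k) (hc : c ≤ 2 * k + 1)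
    (hr : Rigid G K D (k - 1)) {d e : V} {R : List V} (h : LongestEar G K D d e R)
    (h2 : 2 ≤ R.length) : ∀ a ∈ D, a ∈ R := by
  intro a₀ ha₀
  by_contra haR
  obtain ⟨hlen, -, hZ2, -⟩ := h.extremal hA hk hc hr h2
  have hcl := fun q hq => h.clique hA hk hc hr h2 (q := q) hq
  have hZ : ∀ q ∈ R, ∀ t, ∃ z ∈ K, z ≠ t ∧ G.Adj q z := by
    intro q hq t
    obtain ⟨z, hz, hzt⟩ := Finset.exists_mem_ne (s := nbrs G K q)
      (by rw [(hcl q hq).1, hZ2]; norm_num) t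
    exact ⟨z, (mem_nbrs.1 hz).1, hzt, (mem_nbrs.1 hz).2⟩
  obtain ⟨q, w, hq, hw, hqw⟩ := exists_exit
    (hA.conn d (h.sub d h.path.head_mem) a₀ ha₀) (· ∈ R) h.path.head_mem haR
  have hwD : w ∈ D := hqw.2.2
  have hqw' : G.Adj q w := hqw.1
  clear hqw
  set S : Set V := {a | a ∈ D ∧ a ∉ R} with hS
  have hwS : w ∈ S := ⟨hwD, hw⟩
  -- A path through `R` with one vertex `r` possibly left out, ending in `q`.
  have hpath : ∀ r, r ≠ q → ∃ d', d' ∈ R ∧ ListPath G d' q ((R.erase q).erase r ++ [q]) := by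
    intro r hrq
    have hmem : ∀ a ∈ (R.erase q).erase r ++ [q], a ∈ R := by
      intro a ha
      simp only [List.mem_append, List.mem_singleton] at ha
      rcases ha with ha | rfl
      · exact List.mem_of_mem_erase (List.mem_of_mem_erase ha)
      · exact hq
    have hnd : ((R.erase q).erase r ++ [q]).Nodup := by
      refine List.nodup_append'.2 ⟨(h.path.nodup.erase q).erase r, List.nodup_singleton q, ?_⟩
      intro a ha ha'
      rw [List.mem_singleton] at ha'
      subst ha'
      exact h.path.nodup.not_mem_erase (List.mem_of_mem_erase ha)
    have := listPath_of_clique (G := G) hnd (by simp)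
      (fun a ha b hb hab => (hcl a (hmem a ha)).2 b (hmem b hb) hab.symm)
    rw [List.getLast_append_singleton] at this
    exact ⟨_, hmem _ this.head_mem, this⟩
  have hsubR : ∀ r, ∀ a ∈ (R.erase q).erase r ++ [q], a ∈ R := by
    intro r a ha
    simp only [List.mem_append, List.mem_singleton] at ha
    rcases ha with ha | rfl
    · exact List.mem_of_mem_erase (List.mem_of_mem_erase ha)
    · exact hq
  have hlR : (R.erase q).length = R.length - 1 := List.length_erase_of_mem hq
  -- No vertex reached from `w` outside `R` has a neighbour in `K`.
  have hnoK : ∀ f, (within G S).Reachable w f → ∀ z ∈ K, ¬ G.Adj f z := by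
    intro f hf z hz hfz
    obtain ⟨W, hW, hWS⟩ := exists_listPath hf hwS
    obtain ⟨d', hd'R, hd'⟩ := hpath w (by rintro rfl; exact hw hq)
    have hp := hd'.append hW hqw' (fun x hx hx' => (hWS x hx').1.2 (hsubR _ x hx))
    obtain ⟨z₁, hz₁, hne, hdz₁⟩ := hZ d' hd'R z
    have := h.le _ _ _ ⟨hp, by
      intro x hx
      rcases List.mem_append.1 hx with hx | hx
      · exact h.sub x (hsubR _ x hx)
      · exact (hWS x hx).1.1, z₁, hz₁, z, hz, hne, hdz₁, hfz⟩
    rw [List.erase_of_not_mem (fun hh => hw (List.mem_of_mem_erase hh))] at this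
    have := hW.length_pos
    simp at *
    omega
  -- So it is joined to `R` by a vertex other than `q` as well.
  obtain ⟨a, ha, z, hz, hwa, -, haz⟩ := hA.two q w hwD (by rintro rfl; exact hw hq)
  obtain ⟨f, r, hf, hr', hfr⟩ := exists_exit hwa (fun x => (within G S).Reachable w x) (.refl _)
    (fun hh => hnoK a hh z hz haz)
  have hfS := mem_of_within_reachable hf hwS
  have hrR : r ∈ R := by
    by_contra hrR
    exact hr' (hf.trans (SimpleGraph.Adj.reachable ⟨hfr.1, hfS, hfr.2.2.1, hrR⟩))
  have hrq : r ≠ q := hfr.2.2.2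
  obtain ⟨W, hW, hWS⟩ := exists_listPath hf hwS
  obtain ⟨d', hd'R, hd'⟩ := hpath r hrq
  have hp := hd'.append hW hqw' (fun x hx hx' => (hWS x hx').1.2 (hsubR _ x hx))
  have hp' := hp.concat hfr.1 (by
    simp only [List.mem_append, List.mem_singleton, not_or]
    exact ⟨⟨(h.path.nodup.erase q).not_mem_erase, hrq⟩, fun hh => (hWS r hh).1.2 hrR⟩)
  obtain ⟨z₁, hz₁, -, hdz₁⟩ := hZ d' hd'R r
  obtain ⟨z₂, hz₂, hne, hrz₂⟩ := hZ r hrR z₁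
  have := h.le _ _ _ ⟨hp', by
    intro x hx
    simp only [List.mem_append (s := _ ++ W), List.mem_append (t := W), List.mem_singleton] at hx
    rcases hx with (hx | hx) | rfl
    · exact h.sub x (hsubR _ x hx)
    · exact (hWS x hx).1.1
    · exact h.sub _ hrR, z₁, hz₁, z₂, hz₂, hne.symm, hdz₁, hrz₂⟩
  have h1 := hW.length_pos
  have h2 : ((R.erase q).erase r).length = R.length - 1 - 1 := by
    rw [List.length_erase_of_mem ((List.mem_erase_of_ne hrq).2 hrR), hlR]
  simp only [List.length_append, List.length_singleton] at this
  omega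

/-! ### The edge bound -/

/-- A rigid `D` is a clique on `k - 1` vertices, each of which has two neighbours in `K`. -/
theorem phi_le_of_rigid (hA : Attached G c u K D) (hk : 5 ≤ k) (hc : c ≤ 2 * k + 1)
    (hr : Rigid G K D (k - 1)) (hD : 2 ≤ D.card) : phi G K D ≤ 2 * (k - 1) * D.card := by
  obtain ⟨b, hb, -⟩ := Finset.one_lt_card.1 hD
  obtain ⟨w, hw, z, hz, -, -, hwz⟩ := hA.two (u 0) b hb
    (fun e => hA.disj b hb ((hA.mem_K b).2 ⟨0, e.symm⟩))
  obtain ⟨d, hd, e, he, hde, z', hz', hne, hdz, hez'⟩ := hA.exists_pair hD hw hz hwz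
  obtain ⟨l, hl, hlD⟩ := exists_listPath (hA.conn d hd e he) hd
  obtain ⟨d', e', R, hR, hlen⟩ := exists_longestEar
    ⟨hl, fun x hx => (hlD x hx).1, z, hz, z', hz', hne.symm, hdz, hez'⟩
  have h2 : 2 ≤ R.length := by
    refine le_trans ?_ hlen
    rw [← List.toFinset_card_of_nodup hl.nodup]
    exact Finset.one_lt_card.2 ⟨d, by simpa using hl.head_mem, e, by simpa using hl.last_mem, hde⟩
  obtain ⟨hRlen, -, hZ2, -⟩ := hR.extremal hA hk hc hr h2
  have hDR : D = R.toFinset := by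
    ext a
    rw [List.mem_toFinset]
    exact ⟨hR.covers hA hk hc hr h2 a, hR.sub a⟩
  have hDc : D.card = k - 1 := by
    rw [hDR, List.toFinset_card_of_nodup hR.path.nodup, hRlen]
  have hterm : ∀ v ∈ D, (nbrs G D v).card + 2 * (nbrs G K v).card ≤ 2 * (k - 1) := by
    intro v hv
    rw [(hR.clique hA hk hc hr h2 (by rw [hDR] at hv; simpa using hv)).1, hZ2]
    have : (nbrs G D v).card ≤ (D.erase v).card := by
      refine Finset.card_le_card fun a ha => ?_
      rw [mem_nbrs] at ha
      exact Finset.mem_erase.2 ⟨ha.2.ne.symm, ha.1⟩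
    rw [Finset.card_erase_of_mem hv] at this
    omega
  calc phi G K D ≤ ∑ v ∈ D, 2 * (k - 1) := Finset.sum_le_sum hterm
    _ = _ := by rw [Finset.sum_const]; simp; ring

/-- The edge bound for two vertices, where contractions end: `union_card` and `common_card` bound
the numbers of neighbours on the cycle. -/
theorem phi_le_of_card_eq_two (hA : Attached G c u K D) (hk : 5 ≤ k) (hc : c ≤ 2 * k + 1)
    (hD : D.card = 2) : phi G K D ≤ 2 * (k - 1) * D.card := by
  obtain ⟨v, w, hvw, rfl⟩ := Finset.card_eq_two.1 hD
  have hadj : G.Adj v w := by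
    obtain ⟨x, y, rfl, hy, h1, h2, h3⟩ := exists_exit
      (hA.conn v (by simp) w (by simp)) (· = v) rfl (by simpa using hvw.symm)
    have : y = w := by simpa [hy] using h3
    exact this ▸ h1
  have hphi : phi G K {v, w} = 2 + 2 * (nbrs G K v).card + 2 * (nbrs G K w).card := by
    have e1 : nbrs G {w} v = {w} := by simp [nbrs, hadj]
    have e2 : nbrs G ∅ w = ∅ := rfl
    have e3 : phi G K ∅ = 0 := rfl
    rw [phi_insert (by simpa using hvw), ← insert_empty_eq, phi_insert (by simp), e2, e3,
      insert_empty_eq, e1]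
    simp; ring
  rw [hphi, hD]
  by_contra! hcon
  have hself : ∀ a ∈ ({v, w} : Finset V), 2 ≤ (nbrs G K a).card → 2 * (nbrs G K a).card ≤ c := by
    intro a ha h2
    have := hA.common_card (ListPath.singleton a) (by simpa using ha) rfl h2
    simpa using this
  have hv2 : 2 ≤ (nbrs G K v).card := by
    by_contra h
    have := hself w (by simp) (by omega)
    omega
  have hw2 : 2 ≤ (nbrs G K w).card := by
    by_contra h
    have := hself v (by simp) (by omega)
    omega
  have hpath : ListPath G v w [v, w] := (ListPath.singleton w).cons hadj (by simpa using hvw)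
  obtain ⟨z, hz⟩ := Finset.card_pos.1 (show 0 < (nbrs G K v).card by omega)
  obtain ⟨z', hz', hne⟩ := Finset.exists_mem_ne hw2 z
  have hu := hA.union_card hpath (by simp) (mem_nbrs.1 hz).1 (mem_nbrs.1 hz').1 hne.symm
    (mem_nbrs.1 hz).2 (mem_nbrs.1 hz').2
  have hsub1 : nbrs G K v ⊆ nbrs G K v ∪ nbrs G K w := Finset.subset_union_left
  have hsub2 : nbrs G K w ⊆ nbrs G K v ∪ nbrs G K w := Finset.subset_union_right
  have hc1 := Finset.card_le_card hsub1
  have hc2 := Finset.card_le_card hsub2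
  simp at hu
  have heq : nbrs G K v = nbrs G K w := by
    rw [Finset.eq_of_subset_of_card_le hsub1 (by omega)]
    exact (Finset.eq_of_subset_of_card_le hsub2 (by omega)).symm
  have hcom := hA.common_card hpath (by simp) heq hv2
  rw [← heq] at hcon
  simp at hcom
  omega

/-- **Edge bound.** At least two vertices, connected off a longest cycle of length at most `2k + 1`,
are together incident with at most `(k - 1) |D|` edges. An edge with fewer than `k - 1` common
neighbours of its ends is contracted, if there is one which does not separate; if there is none, `D`
is rigid. -/
theorem phi_le (hA : Attached G c u K D) (hk : 5 ≤ k) (hc : c ≤ 2 * k + 1)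
    (hD : 2 ≤ D.card) : phi G K D ≤ 2 * (k - 1) * D.card := by
  induction hn : D.card using Nat.strong_induction_on generalizing G D with
  | _ n ih =>
    rw [← hn]
    rcases hD.eq_or_lt with h2 | h3
    · exact phi_le_of_card_eq_two hA hk hc h2.symm
    by_cases hr : Rigid G K D (k - 1)
    · exact phi_le_of_rigid hA hk hc hr hD
    · unfold Rigid at hr
      push Not at hr
      obtain ⟨v, hv, w, hw, hvw, hcut, hlt⟩ := hr
      have hcard : (D.erase w).card = D.card - 1 := Finset.card_erase_of_mem hw
      have := ih (D.card - 1) (by omega) (hA.contract hv hw hvw hcut) (by omega) hcard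
      rw [phi_merge hv hw (hA.disj v hv) (hA.disj w hw) hvw]
      obtain ⟨m, hm⟩ : ∃ m, D.card = m + 1 := ⟨D.card - 1, by omega⟩
      rw [hm] at this ⊢
      have e : 2 * (k - 1) * (m + 1) = 2 * (k - 1) * m + 2 * (k - 1) := by ring
      simp only [Nat.add_sub_cancel] at this
      omega

end
end BondyStability

namespace BondyStability
section
open scoped Classical
variable {V : Type*} {G : SimpleGraph V} {c k : ℕ} {u : ℤ → V}

/-! ### Two-connectivity -/

theorem IsTwoConnected.reachable [Fintype V] (hG : IsTwoConnected G) {x v z : V} (hv : v ≠ x)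
    (hz : z ≠ x) : (within G {a | a ≠ x}).Reachable v z := by
  have h := (hG.2.2 x).preconnected ⟨v, by simpa using hv⟩ ⟨z, by simpa using hz⟩
  let f : G.induce ({x}ᶜ : Set V) →g within G {a | a ≠ x} :=
    ⟨Subtype.val, fun {a b} hab => ⟨hab, fun e => a.2 (Set.mem_singleton_iff.2 e),
      fun e => b.2 (Set.mem_singleton_iff.2 e)⟩⟩
  exact h.map f

/-- After deletion of `x`, a vertex outside `S` is still connected to `S`. -/
theorem IsTwoConnected.exists_attachment [Fintype V] (hG : IsTwoConnected G) {S : Set V}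
    {x y z : V} (hy : y ∉ S) (hyx : y ≠ x) (hz : z ∈ S) (hzx : z ≠ x) :
    ∃ w z', (within G {a | a ∉ S ∧ a ≠ x}).Reachable y w ∧ z' ∈ S ∧ z' ≠ x ∧ G.Adj w z' := by
  obtain ⟨w, z', hw, hz', hadj⟩ := exists_exit (hG.reachable hyx hzx)
    (fun a => (within G {a | a ∉ S ∧ a ≠ x}).Reachable y a) (.refl _)
    (fun h => (mem_of_within_reachable h ⟨hy, hyx⟩).1 hz)
  refine ⟨w, z', hw, ?_, hadj.2.2, hadj.1⟩
  by_contra hzS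
  exact hz' (hw.trans (SimpleGraph.Adj.reachable
    ⟨hadj.1, mem_of_within_reachable hw ⟨hy, hyx⟩, hzS, hadj.2.2⟩))

theorem IsCyc.exists_ne (h : IsCyc G c u) (x : V) : ∃ z ∈ Set.range u, z ≠ x := by
  by_cases h0 : u 0 = x
  · exact ⟨u 1, ⟨1, rfl⟩, by rw [← h0]; exact (by simpa using (h.adj 0).ne.symm)⟩
  · exact ⟨u 0, ⟨0, rfl⟩, h0⟩

/-- The components of `G - C`, for a longest cycle `C` of a 2-connected graph `G`, are attached
to `C`. -/
theorem IsCyc.attached [Fintype V] (h : IsCyc G c u) (hG : IsTwoConnected G) (hc : CircLE G c)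
    {y : V} (hy : y ∉ Set.range u) :
    Attached G c u (Finset.univ.filter (· ∈ Set.range u))
      (Finset.univ.filter fun a => (within G (Set.range u)ᶜ).Reachable y a) where
  pos := by have := h.three_le; omega
  eq_iff := h.eq_iff
  mem_K z := by simp
  disj v hv := by
    simp only [Finset.mem_filter, Finset.mem_univ, true_and] at hv ⊢
    exact mem_of_within_reachable hv hy
  conn a ha b hb := by
    simp only [Finset.mem_filter, Finset.mem_univ, true_and] at ha hb
    refine (reachable_induction (ha.symm.trans hb) (fun x => (within G (Set.range u)ᶜ).Reachable y x ∧
      (within G _).Reachable a x) ⟨ha, .refl _⟩ ?_).2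
    rintro p q ⟨h1, h2⟩ hpq
    have h3 := h1.trans (SimpleGraph.Adj.reachable hpq)
    exact ⟨h3, h2.trans (SimpleGraph.Adj.reachable ⟨hpq.1, by simpa using h1, by simpa using h3⟩)⟩
  two x v hv hvx := by
    simp only [Finset.mem_filter, Finset.mem_univ, true_and] at hv ⊢
    obtain ⟨z, hz, hzx⟩ := h.exists_ne x
    obtain ⟨w, z', hw, hz', hne, hadj⟩ := hG.exists_attachment (S := Set.range u)
      (mem_of_within_reachable hv hy) hvx hz hzx
    have := reachable_induction hw (fun a => (within G (Set.range u)ᶜ).Reachable y a ∧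
      (within G {a | (within G (Set.range u)ᶜ).Reachable y a ∧ a ≠ x}).Reachable v a)
      ⟨hv, .refl _⟩ (by
        rintro p q ⟨h1, h2⟩ hpq
        have h3 := h1.trans (SimpleGraph.Adj.reachable ⟨hpq.1, hpq.2.1.1, hpq.2.2.1⟩)
        exact ⟨h3, h2.trans (SimpleGraph.Adj.reachable ⟨hpq.1, ⟨h1, hpq.2.1.2⟩, h3, hpq.2.2.2⟩)⟩)
    exact ⟨w, this.1, z', hz', this.2, hne, hadj⟩
  gap i j hij hj d e R hR hRD hd he := by
    refine h.gap hc hij hj hR (fun a ha => ?_) hd.symm he.symm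
    have := hRD a ha
    simp only [Finset.mem_filter, Finset.mem_univ, true_and] at this
    exact mem_of_within_reachable this hy

/-! ### A vertex off the cycle with many neighbours on it -/

/-- The edges with at most one end in `S` are those counted by `phi`, for the complement of
`S`. -/
theorem two_mul_ncard_edgesAtMostOneEnd [Fintype V] (G : SimpleGraph V) (S : Set V) :
    2 * (edgesAtMostOneEnd G S).ncard =
      phi G (Finset.univ.filter (· ∈ S)) (Finset.univ.filter (· ∉ S)) := by
  set K := Finset.univ.filter (· ∈ S) with hK
  set O := Finset.univ.filter (· ∉ S) with hO
  let G' : SimpleGraph V :=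
    { Adj := fun a b => G.Adj a b ∧ (a ∉ S ∨ b ∉ S)
      symm := ⟨fun a b h => ⟨h.1.symm, h.2.symm⟩⟩
      loopless := ⟨fun a h => G.loopless.irrefl a h.1⟩ }
  have hE : edgesAtMostOneEnd G S = G'.edgeSet := by
    ext e
    induction e with
    | _ a b =>
      simp only [edgesAtMostOneEnd, Set.mem_sep_iff, SimpleGraph.mem_edgeSet, Sym2.mem_iff, G']
      refine and_congr_right fun _ => ?_
      constructor
      · intro h
        by_contra! hcon
        exact h fun v hv => by rcases hv with rfl | rfl; exacts [hcon.1, hcon.2]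
      · intro h hcon
        rcases h with h | h
        · exact h (hcon a (.inl rfl))
        · exact h (hcon b (.inr rfl))
  have hsum := G'.sum_degrees_eq_twice_card_edges
  have h1 : (edgesAtMostOneEnd G S).ncard = G'.edgeFinset.card := by
    rw [hE, ← SimpleGraph.coe_edgeFinset, Set.ncard_coe_finset]
  rw [h1, ← hsum]
  have hdeg : ∀ v, G'.degree v = (Finset.univ.filter (G'.Adj v)).card := by
    intro v
    rw [← SimpleGraph.card_neighborFinset_eq_degree]
    congr 1; ext a; simp
  have hdO : ∀ v ∈ O, G'.degree v = (nbrs G O v).card + (nbrs G K v).card := by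
    intro v hv
    have hv' : v ∉ S := by simpa [hO] using hv
    rw [hdeg, ← Finset.card_union_of_disjoint]
    · congr 1; ext a
      simp only [Finset.mem_filter, Finset.mem_univ, true_and, Finset.mem_union, mem_nbrs, hO, hK, G']
      tauto
    · rw [Finset.disjoint_left]
      intro a ha ha'
      simp only [mem_nbrs, hO, hK, Finset.mem_filter, Finset.mem_univ, true_and] at ha ha'
      exact ha.1 ha'.1
  have hdK : ∀ v ∈ K, G'.degree v = (nbrs G O v).card := by
    intro v hv
    have hv' : v ∈ S := by simpa [hK] using hv
    rw [hdeg]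
    congr 1; ext a
    simp only [Finset.mem_filter, Finset.mem_univ, true_and, mem_nbrs, hO, G']
    tauto
  have hswap : ∑ v ∈ K, (nbrs G O v).card = ∑ v ∈ O, (nbrs G K v).card := by
    simp only [nbrs, Finset.card_filter]
    rw [Finset.sum_comm]
    simp only [G.adj_comm]
  rw [← Finset.sum_filter_add_sum_filter_not Finset.univ (· ∈ S), ← hK, ← hO,
    Finset.sum_congr rfl hdK, Finset.sum_congr rfl hdO, hswap, phi, ← Finset.sum_add_distrib]
  exact Finset.sum_congr rfl fun v _ => by ring

/-- Many edges off a longest cycle force a vertex `x` off the cycle, isolated there, with at least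
`k` neighbours on the cycle: the edges split according to the components of `G - C`, and the
components with two or more vertices obey the edge bound `phi_le`. -/
theorem IsCyc.exists_isolated [Fintype V] (h : IsCyc G c u) (hG : IsTwoConnected G)
    (hcirc : CircLE G c) (hk : 5 ≤ k) (hc : c ≤ 2 * k + 1)
    (hE : (k - 1) * (Finset.univ.filter (· ∉ Set.range u)).card <
      (edgesAtMostOneEnd G (Set.range u)).ncard) :
    ∃ x, x ∉ Set.range u ∧ (∀ a, G.Adj x a → a ∈ Set.range u) ∧
      k ≤ (nbrs G (Finset.univ.filter (· ∈ Set.range u)) x).card := by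
  by_contra! hcon
  have h2 := two_mul_ncard_edgesAtMostOneEnd G (Set.range u)
  set K := Finset.univ.filter (· ∈ Set.range u) with hK
  set O := Finset.univ.filter (· ∉ Set.range u) with hO
  have hO' : ∀ v, v ∈ O ↔ v ∉ Set.range u := by simp [hO]
  suffices hle : phi G K O ≤ 2 * (k - 1) * O.card by
    rw [← h2, mul_assoc] at hle
    omega
  set f : V → (within G (Set.range u)ᶜ).ConnectedComponent :=
    fun v => (within G (Set.range u)ᶜ).connectedComponentMk v with hf
  have hmaps : ∀ v ∈ O, f v ∈ O.image f := fun v hv => Finset.mem_image_of_mem f hv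
  rw [phi, ← Finset.sum_fiberwise_of_maps_to hmaps, Finset.card_eq_sum_card_fiberwise hmaps,
    Finset.mul_sum]
  refine Finset.sum_le_sum fun κ hκ => ?_
  obtain ⟨y, hy, rfl⟩ := Finset.mem_image.1 hκ
  have hy' := (hO' y).1 hy
  have hA := h.attached hG hcirc hy'
  rw [← hK] at hA
  set D := Finset.univ.filter fun a => (within G (Set.range u)ᶜ).Reachable y a with hD
  have hmemD : ∀ a, a ∈ D ↔ (within G (Set.range u)ᶜ).Reachable y a := by simp [hD]
  have hfib : O.filter (fun v => f v = f y) = D := by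
    ext a
    simp only [Finset.mem_filter, hmemD, hf, SimpleGraph.ConnectedComponent.eq, hO']
    constructor
    · rintro ⟨-, h⟩; exact h.symm
    · intro h; exact ⟨mem_of_within_reachable h hy', h.symm⟩
  rw [hfib]
  have hnb : ∀ v ∈ D, nbrs G O v = nbrs G D v := by
    intro v hv
    have hv' := mem_of_within_reachable ((hmemD v).1 hv) hy'
    ext a
    simp only [mem_nbrs, hO', hmemD]
    refine and_congr_left fun hva => ?_
    constructor
    · intro ha
      exact ((hmemD v).1 hv).trans (SimpleGraph.Adj.reachable ⟨hva, hv', ha⟩)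
    · intro ha; exact mem_of_within_reachable ha hy'
  have hphi : ∑ v ∈ D, ((nbrs G O v).card + 2 * (nbrs G K v).card) = phi G K D :=
    Finset.sum_congr rfl fun v hv => by rw [hnb v hv]
  rw [hphi]
  have hyD : y ∈ D := (hmemD y).2 (.refl _)
  rcases Nat.lt_or_ge 1 D.card with h1 | h1
  · exact phi_le hA hk hc h1
  · have hDy : D = {y} := by
      refine (Finset.eq_singleton_iff_unique_mem).2 ⟨hyD, fun a ha => ?_⟩
      exact Finset.card_le_one.1 h1 a ha y hyD
    have hiso : ∀ a, G.Adj y a → a ∈ Set.range u := by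
      intro a hya
      by_contra ha
      have : a ∈ D := (hmemD a).2 (SimpleGraph.Adj.reachable ⟨hya, hy', ha⟩)
      rw [hDy, Finset.mem_singleton] at this
      exact hya.ne this.symm
    have := hcon y hy' hiso
    have e : nbrs G {y} y = ∅ := by
      ext a; simp only [mem_nbrs, Finset.mem_singleton, Finset.notMem_empty, iff_false]
      rintro ⟨rfl, h⟩; exact G.loopless.irrefl _ h
    rw [hDy, phi, Finset.sum_singleton, e]
    simp
    omega

/-! ### Normal position -/

/-- A cycle `u 0, u 1, …` of length `c = 2k` or `2k + 1`, and a vertex `x` off it which is joined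
to exactly `u 0, u 2, …, u (2k - 2)`. -/
structure Config (G : SimpleGraph V) (c k : ℕ) (u : ℤ → V) (x : V) : Prop where
  cyc : IsCyc G c u
  circ : CircLE G c
  five_le : 5 ≤ k
  le_c : 2 * k ≤ c
  c_le : c ≤ 2 * k + 1
  x_notMem : x ∉ Set.range u
  adj : ∀ i : ℤ, 0 ≤ i → i < k → G.Adj x (u (2 * i))
  only : ∀ a, G.Adj x a → ∃ i : ℤ, 0 ≤ i ∧ i < k ∧ u (2 * i) = a

/-- The vertex `x` of `exists_isolated` has no two consecutive neighbours on the cycle, of length at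
most `2k + 1`, so its `k` neighbours alternate with other vertices, up to a rotation of the cycle. -/
theorem IsCyc.exists_config [Fintype V] (h : IsCyc G c u) (hG : IsTwoConnected G)
    (hcirc : CircLE G c) (hk : 5 ≤ k) (hkc : 2 * k ≤ c) (hc : c ≤ 2 * k + 1)
    (hE : (k - 1) * (Finset.univ.filter (· ∉ Set.range u)).card <
      (edgesAtMostOneEnd G (Set.range u)).ncard) :
    ∃ (u' : ℤ → V) (x : V), Config G c k u' x := by
  obtain ⟨x, hx, hiso, hdeg⟩ := h.exists_isolated hG hcirc hk hc hE
  have hA := h.attached hG hcirc hx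
  set K := Finset.univ.filter (· ∈ Set.range u) with hK
  have hsub : ∀ a ∈ [x], a ∈ Finset.univ.filter
      (fun a => (within G (Set.range u)ᶜ).Reachable x a) := by simp
  have hgap : ∀ s : ℤ, G.Adj x (u s) → ¬ G.Adj x (u (s + 1)) := fun s h1 h2 => by
    have := hA.gap_both (i := s) (j := s + 1) (by omega) (by omega) (ListPath.singleton x) hsub
      h1 h2
    simp at this
  have hgap' : ∀ s t : ℤ, s < t → t < s + c → G.Adj x (u s) → G.Adj x (u t) → s + (2 : ℕ) ≤ t :=
    fun s t hst ht h1 h2 => by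
      have := hA.gap_both hst ht (ListPath.singleton x) hsub h1 h2
      simp at this ⊢; omega
  have hper : ∀ s, G.Adj x (u (s + c)) ↔ G.Adj x (u s) := fun s => by rw [h.add_c]
  have hle : (nbrs G K x).card ≤ k := by
    have := hA.common_card (ListPath.singleton x) hsub rfl (by omega)
    simp at this; omega
  obtain ⟨z, hz⟩ := Finset.card_pos.1 (show 0 < (nbrs G K x).card by omega)
  obtain ⟨hzK, hxz⟩ := mem_nbrs.1 hz
  obtain ⟨s₀, rfl⟩ : ∃ s, u s = z := by simpa [hK] using hzK
  -- A window of `2k - 1` positions holds all neighbours of `x`.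
  obtain ⟨r, hr⟩ : ∃ r : ℤ, ∀ s, r ≤ s → s < r + c → G.Adj x (u s) → s ≤ r + 2 * k - 2 := by
    rcases hkc.eq_or_lt with hc0 | hc1
    · refine ⟨s₀, fun s h1 h2 hs => ?_⟩
      by_contra hlt
      refine hgap s hs ?_
      have : s + 1 = s₀ + c := by omega
      rw [this, hper]; exact hxz
    · obtain ⟨s₁, hs₁, hs₁'⟩ : ∃ s, G.Adj x (u s) ∧ ¬ G.Adj x (u (s + 2)) := by
        by_contra! hcon
        have : ∀ n : ℕ, G.Adj x (u (s₀ + 2 * n)) := by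
          intro n
          induction n with
          | zero => simpa using hxz
          | succ n ih =>
            have := hcon _ ih
            convert this using 2
            push_cast; ring_nf
        have h1 := this (k + 1)
        rw [show s₀ + 2 * ((k + 1 : ℕ) : ℤ) = s₀ + 1 + c by push_cast; omega, hper] at h1
        exact hgap s₀ hxz h1
      refine ⟨s₁ + 3, fun s h1 h2 hs => ?_⟩
      by_contra hlt
      have : s = s₁ + 1 + c ∨ s = s₁ + 2 + c := by omega
      rcases this with rfl | rfl
      · rw [hper] at hs; exact hgap _ hs₁ hs
      · rw [hper] at hs; exact hs₁' hs
  have hcard := hA.card_eq (G.Adj x) r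
  set S := (Finset.Ico r (r + c)).filter fun s => G.Adj x (u s) with hS
  have hSmem : ∀ s ∈ S, r ≤ s ∧ s < r + c ∧ G.Adj x (u s) := by
    intro s hs; simpa [hS, and_assoc] using hs
  have hSk : k ≤ S.card := by rw [← hcard]; exact hdeg
  have hsep : ∀ s ∈ S, ∀ t ∈ S, s < t → s + (2 : ℕ) ≤ t := fun s hs t ht hst => by
    have h1 := hSmem s hs
    have h2 := hSmem t ht
    exact hgap' s t hst (by omega) h1.2.2 h2.2.2
  have hadj : ∀ i : ℤ, 0 ≤ i → i < k → G.Adj x (u (r + 2 * i)) := by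
    intro i h0 hik
    by_contra hni
    have c1 := separated_card (S := S.filter (· < r + 2 * i)) (a := r) (b := r + 2 * i) (r := 2)
      (by omega) (fun s hs => by
        have h1 := hSmem s (Finset.mem_filter.1 hs).1
        exact ⟨h1.1, (Finset.mem_filter.1 hs).2⟩)
      (fun s hs t ht => hsep s (Finset.mem_filter.1 hs).1 t (Finset.mem_filter.1 ht).1)
    have c2 := separated_card (S := S.filter fun s => ¬ s < r + 2 * i) (a := r + 2 * i + 1)
      (b := r + 2 * k - 1) (r := 2)
      (by omega) (fun s hs => by
        have h1 := hSmem s (Finset.mem_filter.1 hs).1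
        have h2 := (Finset.mem_filter.1 hs).2
        have h3 := hr s h1.1 h1.2.1 h1.2.2
        have h4 : s ≠ r + 2 * i := by rintro rfl; exact hni h1.2.2
        omega)
      (fun s hs t ht => hsep s (Finset.mem_filter.1 hs).1 t (Finset.mem_filter.1 ht).1)
    have := Finset.card_filter_add_card_filter_not (s := S) (· < r + 2 * i)
    push_cast at c1 c2
    omega
  have hrange : Set.range (fun s => u (s + r)) = Set.range u :=
    (Equiv.addRight r).surjective.range_comp u
  refine ⟨fun s => u (s + r), x, h.shift r, hcirc, hk, hkc, hc, by rwa [hrange], ?_, ?_⟩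
  · intro i h0 h1
    have := hadj i h0 h1
    rwa [add_comm] at this
  · intro a hxa
    have haK : a ∈ nbrs G K x := mem_nbrs.2 ⟨by simpa [hK] using hiso a hxa, hxa⟩
    have himg : (Finset.Ico (0 : ℤ) k).image (fun i => u (2 * i + r)) = nbrs G K x := by
      refine Finset.eq_of_subset_of_card_le ?_ ?_
      · intro b hb
        obtain ⟨i, hi, rfl⟩ := Finset.mem_image.1 hb
        rw [Finset.mem_Ico] at hi
        refine mem_nbrs.2 ⟨by simp [hK], ?_⟩
        have := hadj i hi.1 hi.2
        rwa [add_comm] at this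
      · rw [Finset.card_image_of_injOn]
        · simpa using hle
        · intro i hi j hj e
          simp only [Finset.coe_Ico, Set.mem_Ico] at hi hj
          have := h.inj e (by omega) (by omega)
          omega
    rw [← himg] at haK
    obtain ⟨i, hi, rfl⟩ := Finset.mem_image.1 haK
    rw [Finset.mem_Ico] at hi
    exact ⟨i, hi.1, hi.2, rfl⟩

end
end BondyStability

namespace BondyStability
variable {V : Type*} {G : SimpleGraph V} {c k : ℕ} {u : ℤ → V} {x : V}

/-! ### Links through the rest of the graph -/

/-- A path with `m` vertices off the cycle and avoiding `x`, joining `u s` to `u t`. -/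
def Link (G : SimpleGraph V) (u : ℤ → V) (x : V) (s t : ℤ) (m : ℕ) : Prop :=
  ∃ d e R, ListPath G d e R ∧ (∀ a ∈ R, a ∉ Set.range u ∧ a ≠ x) ∧ G.Adj (u s) d ∧
    G.Adj (u t) e ∧ R.length = m

theorem Link.symm {s t : ℤ} {m : ℕ} (h : Link G u x s t m) : Link G u x t s m := by
  obtain ⟨d, e, R, hR, hRo, hd, he, hm⟩ := h
  exact ⟨e, d, R.reverse, hR.reverse, by simpa using hRo, he, hd, by simpa using hm⟩

theorem Link.pos {s t : ℤ} {m : ℕ} (h : Link G u x s t m) : 1 ≤ m := by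
  obtain ⟨d, e, R, hR, -, -, -, rfl⟩ := h
  exact hR.length_pos

namespace Config

/-- The cycle traversed backwards, again in normal position. -/
theorem reverse (h : Config G c k u x) : Config G c k (fun s => u (2 * k - 2 - s)) x where
  cyc := by
    have := (h.cyc.shift (2 * k - 2)).neg
    convert this using 3
    ring
  circ := h.circ
  five_le := h.five_le
  le_c := h.le_c
  c_le := h.c_le
  x_notMem := by
    rintro ⟨s, hs⟩; exact h.x_notMem ⟨_, hs⟩
  adj i h0 h1 := by
    have := h.adj (k - 1 - i) (by omega) (by omega)
    rwa [show 2 * (k - 1 - i) = 2 * k - 2 - 2 * i by ring] at this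
  only a ha := by
    obtain ⟨i, h0, h1, rfl⟩ := h.only a ha
    exact ⟨k - 1 - i, by omega, by omega, by congr 1; ring⟩

theorem adj' (h : Config G c k u x) {s : ℤ} (h0 : 0 ≤ s) (h1 : s ≤ 2 * k - 2) (h2 : s % 2 = 0) :
    G.Adj x (u s) := by
  have := h.adj (s / 2) (by omega) (by omega)
  rwa [show 2 * (s / 2) = s by omega] at this

theorem adj_add (h : Config G c k u x) {s : ℤ} (h0 : 0 ≤ s) (h1 : s ≤ 2 * k - 2)
    (h2 : s % 2 = 0) : G.Adj x (u (s + c)) := by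
  rw [h.cyc.add_c]; exact h.adj' h0 h1 h2

theorem exists_pos (h : Config G c k u x) {a : V} (ha : a ∈ Set.range u) :
    ∃ s : ℤ, 0 ≤ s ∧ s < c ∧ u s = a := by
  obtain ⟨s, rfl⟩ := ha
  have hc : (0 : ℤ) < c := by have := h.cyc.three_le; omega
  refine ⟨s % c, Int.emod_nonneg _ hc.ne', Int.emod_lt_of_pos _ hc, ?_⟩
  rw [h.cyc.eq_iff]
  exact ⟨-(s / c), by have := Int.emod_add_mul_ediv s c; linarith⟩

section link
variable {s t : ℤ} {m : ℕ}

theorem link_add (h : Config G c k u x) (hl : Link G u x s t m) : Link G u x s (t + c) m := by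
  obtain ⟨d, e, R, hR, hRo, hd, he, hm⟩ := hl
  exact ⟨d, e, R, hR, hRo, hd, by rwa [h.cyc.add_c], hm⟩

/-- The two arcs of the cycle between the ends of a link are longer than the link. -/
theorem link_gap (h : Config G c k u x) (hl : Link G u x s t m) (hst : s < t) (ht : t < s + c) :
    s + (m + 1) ≤ t ∧ t + (m + 1) ≤ s + c := by
  have h2 := h.link_add hl.symm
  obtain ⟨d, e, R, hR, hRo, hd, he, rfl⟩ := hl
  obtain ⟨d', e', R', hR', hRo', hd', he', h'⟩ := h2
  have h1 := h.cyc.gap h.circ hst ht hR (fun a ha => (hRo a ha).1) hd he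
  have h2 := h.cyc.gap h.circ ht (by omega) hR' (fun a ha => (hRo' a ha).1) hd' he'
  omega

/-- A link, two arcs starting at its ends, and two edges at `x` joining the last vertices of these
arcs form a cycle. -/
theorem link_hop (h : Config G c k u x) (hl : Link G u x s t m) {l l' : ℤ} (h1 : s ≤ l)
    (h2 : l < t) (h3 : t ≤ l') (h4 : l' < s + c) (hx : G.Adj x (u l)) (hx' : G.Adj x (u l')) :
    (l - s) + (l' - t) + 3 + m ≤ c := by
  obtain ⟨d, e, R, hR, hRo, hd, he, rfl⟩ := hl.symm
  exact h.cyc.hop h.circ h.x_notMem h1 h2 h3 h4 hx hx' hR (fun a ha => (hRo a ha).1)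
    (fun hh => (hRo x hh).2 rfl) hd he

/-- A link, two arcs stopping at its ends, and two edges at `x` joining the first vertices of these
arcs form a cycle. -/
theorem link_hop' (h : Config G c k u x) (hl : Link G u x s t m) {i j : ℤ} (h1 : i ≤ s)
    (h2 : s < j) (h3 : j ≤ t) (h4 : t < i + c) (hx : G.Adj x (u i)) (hx' : G.Adj x (u j)) :
    (s - i) + (t - j) + 3 + m ≤ c := by
  obtain ⟨d, e, R, hR, hRo, hd, he, rfl⟩ := hl
  exact h.cyc.hop' h.circ h.x_notMem h1 h2 h3 h4 hx hx' hR (fun a ha => (hRo a ha).1)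
    (fun hh => (hRo x hh).2 rfl) hd he

/-- The successors on the cycle of two neighbours of `x` are not linked, as the cycle could be
rerouted through `x` and the link otherwise. -/
theorem not_link_right (h : Config G c k u x) (hst : s < t) (ht : t < s + c)
    (hs : G.Adj x (u (s - 1))) (ht' : G.Adj x (u (t - 1))) : ¬ Link G u x s t m := fun hl => by
  rcases (show s + 1 ≤ t by omega).eq_or_lt with rfl | h1
  · have := h.link_gap hl hst ht
    have := hl.pos
    omega
  · have := h.link_hop hl (l := t - 1) (l' := s - 1 + c) (by omega) (by omega) (by omega) (by omega)
      ht' (by rwa [h.cyc.add_c])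
    omega

/-- The successors on the cycle of two neighbours of `x` are not adjacent. -/
theorem not_adj_right (h : Config G c k u x) (hst : s < t) (ht : t < s + c)
    (hs : G.Adj x (u (s - 1))) (ht' : G.Adj x (u (t - 1))) : ¬ G.Adj (u s) (u t) := fun hl => by
  have := h.cyc.hop_adj h.circ h.x_notMem (i := s) (l := t - 1) (j := t) (l' := s - 1 + c)
    (by omega) (by omega) (by omega) (by omega) ht' (by rwa [h.cyc.add_c]) hl.symm
  omega

/-- The predecessors on the cycle of two neighbours of `x` are not adjacent. -/
theorem not_adj_left (h : Config G c k u x) (hst : s < t) (ht : t < s + c)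
    (hs : G.Adj x (u (s + 1))) (ht' : G.Adj x (u (t + 1))) : ¬ G.Adj (u s) (u t) := fun hl => by
  have := h.cyc.hop_adj' h.circ h.x_notMem (i := t + 1 - c) (l := s) (j := s + 1) (l' := t)
    (by omega) (by omega) (by omega) (by omega)
    (by rw [← h.cyc.add_c]; simpa using ht') hs hl
  omega

/-- The predecessors on the cycle of two neighbours of `x` are not linked. -/
theorem not_link_left (h : Config G c k u x) (hst : s < t) (ht : t < s + c)
    (hs : G.Adj x (u (s + 1))) (ht' : G.Adj x (u (t + 1))) : ¬ Link G u x s t m := fun hl => by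
  rcases (show s + 1 ≤ t by omega).eq_or_lt with rfl | h1
  · have := h.link_gap hl hst ht
    have := hl.pos
    omega
  · have := h.link_hop' hl (i := t + 1 - c) (j := s + 1) (by omega) (by omega) (by omega) (by omega)
      (by rw [← h.cyc.add_c]; simpa using ht') hs
    omega

end link

/-- Positions of the vertices which lie on the cycle between two consecutive neighbours of `x`. -/
def Mid (c k : ℕ) (s : ℤ) : Prop := 0 ≤ s ∧ s % 2 = 1 ∧ (s ≤ 2 * k - 3 ∨ s = 2 * k - 1 ∧ c = 2 * k)

theorem mid_adj (h : Config G c k u x) {s : ℤ} (hs : Mid c k s) :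
    G.Adj x (u (s - 1)) ∧ G.Adj x (u (s + 1)) := by
  obtain ⟨h0, h1, h2 | ⟨rfl, h2⟩⟩ := hs
  · exact ⟨h.adj' (by omega) (by omega) (by omega), h.adj' (by omega) (by omega) (by omega)⟩
  · refine ⟨h.adj' (by omega) (by omega) (by omega), ?_⟩
    have := h.adj_add (s := 0) (by omega) (by have := h.five_le; omega) (by omega)
    rw [h2] at this
    convert this using 2
    push_cast; ring

theorem mid_lt (h : Config G c k u x) {s : ℤ} (hs : Mid c k s) : s < c := by
  have := h.le_c
  obtain ⟨h0, h1, h2 | ⟨rfl, h2⟩⟩ := hs <;> omega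

/-- A position between two consecutive neighbours of `x` has no links: it both precedes and follows
a neighbour of `x`. So links to odd positions and to the last position of an odd cycle are excluded
by `not_link_right` and `not_link_left`, and links to neighbours of `x` by a longer cycle through `x`
and the link. -/
theorem not_link_mid (h : Config G c k u x) {s t : ℤ} {m : ℕ} (hs : Mid c k s) (h0 : 0 ≤ t)
    (ht : t < c) (hne : s ≠ t) : ¬ Link G u x s t m := fun hl => by
  have hsc := h.mid_lt hs
  obtain ⟨hs1, hs2⟩ := h.mid_adj hs
  have hkc := h.le_c
  have hck := h.c_le
  have hk := h.five_le
  have hs0 := hs.1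
  have hso := hs.2.1
  have hpos := hl.pos
  rcases Int.emod_two_eq_zero_or_one t with hte | hto
  · rcases (show t ≤ 2 * k by omega).eq_or_lt with rfl | ht2
    · -- the last position of an odd cycle
      have : c = 2 * k + 1 := by omega
      refine h.not_link_left (by omega) (by omega) hs2 ?_ hl
      have := h.adj_add (s := 0) (by omega) (by omega) (by omega)
      convert this using 2
      omega
    · rcases lt_or_gt_of_ne hne with hlt | hlt
      · rcases (show s + 1 ≤ t by omega).eq_or_lt with rfl | h1
        · have := h.link_gap hl (by omega) (by omega); omega
        · have := h.link_hop hl (l := t - 2) (l' := s - 1 + c) (by omega) (by omega) (by omega)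
            (by omega) (h.adj' (by omega) (by omega) (by omega)) (by rwa [h.cyc.add_c])
          omega
      · rcases (show t + 1 ≤ s by omega).eq_or_lt with h1 | h1
        · have := h.link_gap hl.symm (by omega) (by omega); omega
        · have hts : t + 2 ≤ 2 * k - 2 := by
            have := hs.2.2; omega
          have := h.link_hop' (h.link_add hl) (i := t + 2) (j := s + 1) (by omega) (by omega)
            (by omega) (by omega) (h.adj' (by omega) (by omega) (by omega)) hs2
          omega
  · have ht1 : G.Adj x (u (t - 1)) := h.adj' (by omega) (by omega) (by omega)
    rcases lt_or_gt_of_ne hne with hlt | hlt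
    · exact h.not_link_right hlt (by omega) hs1 ht1 hl
    · exact h.not_link_right hlt (by omega) ht1 hs1 hl.symm

/-- A vertex between two consecutive neighbours of `x` is joined, on the cycle, only to
neighbours of `x`. -/
theorem mid_adj_even (h : Config G c k u x) {s t : ℤ} (hs : Mid c k s) (h0 : 0 ≤ t) (ht : t < c)
    (hst : G.Adj (u s) (u t)) : t % 2 = 0 ∧ t ≤ 2 * k - 2 := by
  have hsc := h.mid_lt hs
  obtain ⟨hs1, hs2⟩ := h.mid_adj hs
  have hkc := h.le_c
  have hck := h.c_le
  have hk := h.five_le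
  have hs0 := hs.1
  have hso := hs.2.1
  have hne : s ≠ t := by rintro rfl; exact G.loopless.irrefl _ hst
  by_contra hcon
  rcases Int.emod_two_eq_zero_or_one t with hte | hto
  · have : t = 2 * k := by omega
    have hc : c = 2 * k + 1 := by omega
    refine h.not_adj_left (s := s) (t := t) (by have := hs.2.2; omega) (by omega) hs2 ?_ hst
    have := h.adj_add (s := 0) (by omega) (by omega) (by omega)
    convert this using 2
    omega
  · have ht1 : G.Adj x (u (t - 1)) := h.adj' (by omega) (by omega) (by omega)
    rcases lt_or_gt_of_ne hne with hlt | hlt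
    · exact h.not_adj_right hlt (by omega) hs1 ht1 hst
    · exact h.not_adj_right hlt (by omega) ht1 hs1 hst.symm

/-- Links of the first of the two exceptional positions `2k - 1`, `2k` of an odd cycle. -/
theorem link_exc (h : Config G c k u x) (hc : c = 2 * k + 1) {t : ℤ} {m : ℕ} (h0 : 0 ≤ t)
    (ht : t < c) (hne : t ≠ 2 * k - 1) (hl : Link G u x (2 * k - 1) t m) : t = 0 ∧ m = 1 := by
  have hk := h.five_le
  have hpos := hl.pos
  by_cases h2 : t = 2 * k
  · subst h2
    have := h.link_gap hl (by omega) (by omega); omega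
  rcases Int.emod_two_eq_zero_or_one t with hte | hto
  · rcases h0.eq_or_lt with rfl | h0
    · refine ⟨rfl, ?_⟩
      have := h.link_gap hl.symm (by omega) (by omega); omega
    · exfalso
      by_cases h3 : t = 2 * k - 2
      · subst h3
        have := h.link_gap hl.symm (by omega) (by omega); omega
      · have := h.link_hop (h.link_add hl) (l := t - 2 + c) (l' := 2 * k - 2 + c) (by omega)
          (by omega) (by omega) (by omega) (h.adj_add (by omega) (by omega) (by omega))
          (h.adj_add (by omega) (by omega) (by omega))
        omega
  · exfalso
    exact h.not_link_mid (s := t) ⟨by omega, hto, by omega⟩ (by omega) (by omega) hne hl.symm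

/-- Links of the second exceptional position of an odd cycle, by reversing the cycle. -/
theorem link_exc' (h : Config G c k u x) (hc : c = 2 * k + 1) {t : ℤ} {m : ℕ} (h0 : 0 ≤ t)
    (ht : t < c) (hne : t ≠ 2 * k) (hl : Link G u x (2 * k) t m) : t = 2 * k - 2 ∧ m = 1 := by
  have hk := h.five_le
  have hcyc := h.cyc
  obtain ⟨d, e, R, hR, hRo, hd, he, hm⟩ := hl
  have e1 : u (2 * k - 2 - (2 * k - 1)) = u (2 * k) := by
    rw [hcyc.eq_iff]; exact ⟨-1, by rw [hc]; push_cast; ring⟩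
  by_cases ht2 : t = 2 * k - 1
  · subst ht2
    exfalso
    have hl : Link G u x (2 * k - 1) (2 * k) m := ⟨e, d, R.reverse, hR.reverse, by simpa using hRo,
      he, hd, by simpa using hm⟩
    have := h.link_gap hl (by omega) (by omega)
    have := hl.pos
    omega
  · have := h.reverse.link_exc hc (t := 2 * k - 2 - t) (m := m) (by omega) (by omega) (by omega)
      ⟨d, e, R, hR, fun a ha => ⟨fun ⟨s, hs⟩ => (hRo a ha).1 ⟨_, hs⟩, (hRo a ha).2⟩,
        by simpa only [e1] using hd, by
          simpa only [show (2 * k - 2 - (2 * k - 2 - t) : ℤ) = t by ring] using he, hm⟩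
    omega

/-- Links with at least two inner vertices exist only on odd cycles, and then only between the two
neighbours of `x` next to the exceptional positions. -/
theorem link_two_le (h : Config G c k u x) {s t : ℤ} {m : ℕ} (hl : Link G u x s t m) (h2 : 2 ≤ m)
    (hs0 : 0 ≤ s) (hst : s < t) (ht : t < c) :
    c = 2 * k + 1 ∧ s = 0 ∧ t = 2 * k - 2 ∧ m = 2 := by
  have hk := h.five_le
  have hkc := h.le_c
  have hck := h.c_le
  have hg := h.link_gap hl hst (by omega)
  have hnm : ∀ a, Mid c k a → a ≠ s ∧ a ≠ t := by
    intro a ha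
    refine ⟨?_, ?_⟩
    · rintro rfl; exact h.not_link_mid ha (by omega) ht hst.ne hl
    · rintro rfl; exact h.not_link_mid ha hs0 (by omega) hst.ne' hl.symm
  have hodd : ∀ a : ℤ, a = s ∨ a = t → a % 2 = 0 ∧ a ≤ 2 * k - 2 := by
    intro a ha
    have hna : ¬ Mid c k a := fun hm => by
      have := hnm a hm; omega
    simp only [Mid, not_and, not_or] at hna
    by_contra hcon
    have hc : c = 2 * k + 1 := by omega
    have ha' : a = 2 * k - 1 ∨ a = 2 * k := by omega
    rcases ha with rfl | rfl
    · rcases ha' with rfl | rfl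
      · have := h.link_exc hc (by omega) ht (by omega) hl; omega
      · have := h.link_exc' hc (by omega) ht (by omega) hl; omega
    · rcases ha' with rfl | rfl
      · have := h.link_exc hc hs0 (by omega) (by omega) hl.symm; omega
      · have := h.link_exc' hc hs0 (by omega) (by omega) hl.symm; omega
  have hse := hodd s (.inl rfl)
  have hte := hodd t (.inr rfl)
  by_cases hsz : s = 0
  · subst hsz
    by_cases htk : t = 2 * k - 2
    · by_cases hc : c = 2 * k + 1
      · exact ⟨hc, rfl, htk, by omega⟩
      · have := h.link_gap hl hst (by omega)
        omega
    · have := h.link_hop' hl (i := t + 2 - c) (j := 2) (by omega) (by omega) (by omega) (by omega)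
        (by rw [← h.cyc.add_c]; simpa using h.adj' (s := t + 2) (by omega) (by omega) (by omega))
        (h.adj' (by omega) (by omega) (by omega))
      omega
  · have := h.link_hop hl (l := t - 2) (l' := s - 2 + c) (by omega) (by omega) (by omega) (by omega)
      (h.adj' (by omega) (by omega) (by omega)) (h.adj_add (by omega) (by omega) (by omega))
    omega

end Config
end BondyStability

namespace BondyStability
variable {V : Type*} {G : SimpleGraph V} {c k : ℕ} {u : ℤ → V} {x : V}

/-! ### Star components -/

/-- From every vertex of `D` one can leave `D` to `a` or `b`, also after deletion of another vertex
of `D`, and paths through `D` from a neighbour of `a` to a neighbour of `b` have at most two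
vertices. -/
structure Narrow (G : SimpleGraph V) (D : Set V) (a b : V) : Prop where
  two : ∀ x ∈ D, ∀ v ∈ D, v ≠ x → ∃ w, (within G {y | y ∈ D ∧ y ≠ x}).Reachable v w ∧
    (G.Adj w a ∨ G.Adj w b)
  short : ∀ d e R, ListPath G d e R → (∀ y ∈ R, y ∈ D) → G.Adj d a → G.Adj e b → R.length ≤ 2

namespace Narrow
variable {D : Set V} {a b : V}

theorem symm (h : Narrow G D a b) : Narrow G D b a where
  two x hx v hv hvx := by
    obtain ⟨w, h1, h2⟩ := h.two x hx v hv hvx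
    exact ⟨w, h1, h2.symm⟩
  short d e R hR hRD hd he := by
    simpa using h.short e d R.reverse hR.reverse (by simpa using hRD) he hd

/-- Let `de` be an edge of `D` with `d` joined to `a` and `e` joined to `b`. Every other neighbour
`w` of `d` in `D` is joined to `b` and not to `a`. -/
theorem leaf_adj (h : Narrow G D a b) {d e w : V} (hd : d ∈ D) (he : e ∈ D) (hw : w ∈ D)
    (hda : G.Adj d a) (heb : G.Adj e b) (hde : G.Adj d e) (hwd : G.Adj w d) (hwe : w ≠ e) :
    ¬ G.Adj w a ∧ G.Adj w b := by
  have hde' : ListPath G d e [d, e] := (ListPath.singleton e).cons hde (by simpa using hde.ne)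
  have hwa : ¬ G.Adj w a := fun hwa => by
    have := h.short w e [w, d, e] (hde'.cons hwd (by simp [hwd.ne, hwe])) (by simp [hd, he, hw])
      hwa heb
    simp at this
  refine ⟨hwa, ?_⟩
  obtain ⟨f, hwf, hf⟩ := h.two d hd w hw hwd.ne
  obtain ⟨R, hR, hRS⟩ := exists_listPath hwf ⟨hw, hwd.ne⟩
  have hdR : d ∉ R := fun hh => (hRS d hh).1.2 rfl
  rcases hf with hf | hf
  · exfalso
    have hfw : w ≠ f := by rintro rfl; exact hwa hf
    by_cases heR : e ∈ R
    · obtain ⟨P, S, rfl⟩ := List.append_of_mem heR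
      have hp := hR.left.cons (a := d) hwd.symm (fun hh => hdR (by
        simp at hh ⊢; tauto))
      have := h.short d e _ hp (by
        intro y hy
        simp only [List.mem_cons, List.mem_append, List.not_mem_nil, or_false] at hy
        rcases hy with rfl | hy | rfl
        · exact hd
        · exact (hRS y (by simp [hy])).1.1
        · exact he) hda heb
      simp at this
      subst this
      exact hwe (by simpa using hR.head.symm)
    · have hp := hR.reverse.append hde' hwd (by
        intro y hy hy'
        simp only [List.mem_cons, List.not_mem_nil, or_false, List.mem_reverse] at hy hy'
        rcases hy' with rfl | rfl
        · exact hdR hy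
        · exact heR hy)
      have := h.short f e _ hp (by
        intro y hy
        simp only [List.mem_append, List.mem_cons, List.not_mem_nil, or_false,
          List.mem_reverse] at hy
        rcases hy with hy | rfl | rfl
        · exact (hRS y hy).1.1
        · exact hd
        · exact he) hf heb
      have := hR.length_pos
      simp only [List.length_append, List.length_reverse, List.length_cons] at *
      omega
  · have := h.short d f _ (hR.cons hwd.symm hdR) (by
      intro y hy
      rcases List.mem_cons.1 hy with rfl | hy
      · exact hd
      · exact (hRS y hy).1.1) hda hf
    have hl := hR.length_pos
    simp at this
    obtain ⟨y, rfl⟩ := List.length_eq_one_iff.1 (show R.length = 1 by omega)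
    have h1 : y = w := by simpa using hR.head
    have h2 : y = f := by simpa using hR.last
    rw [← h1, h2]; exact hf

/-- If, in the situation of `leaf_adj`, `d` has a second neighbour `w` in `D`, then `d` is the only
neighbour of `e` in `D`. -/
theorem leaf_nbr (h : Narrow G D a b) {d e w w' : V} (hd : d ∈ D) (he : e ∈ D) (hw : w ∈ D)
    (hda : G.Adj d a) (heb : G.Adj e b) (hde : G.Adj d e) (hwd : G.Adj w d) (hwe : w ≠ e)
    (hw' : w' ∈ D) (hwe' : G.Adj w' e) : w' = d := by
  by_contra hne
  obtain ⟨h1, h2⟩ := h.leaf_adj hd he hw hda heb hde hwd hwe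
  obtain ⟨h3, h4⟩ := h.symm.leaf_adj he hd hw' heb hda hde.symm hwe' hne
  have hww : w' ≠ w := by rintro rfl; exact h1 h4
  have hp : ListPath G w' w [w', e, d, w] :=
    (((ListPath.singleton w).cons hwd.symm (by simpa using hwd.ne.symm)).cons hde.symm
      (by simp [hde.ne.symm, hwe.symm])).cons hwe' (by simp [hwe'.ne, hne, hww])
  have := h.short _ _ _ hp (by simp [hd, he, hw, hw']) h4 h2
  simp at this

end Narrow

/-- A star with a third vertex has only one center. -/
theorem IsStarOn.center_unique {S : Set V} {z z' : V} (h : IsStarOn G S z) (h' : IsStarOn G S z')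
    (h3 : 3 ≤ S.ncard) : z = z' := by
  by_contra hne
  obtain ⟨l, hl, hlz⟩ : ∃ l ∈ S, l ∉ ({z, z'} : Set V) := by
    by_contra! hcon
    have := Set.ncard_le_ncard (show S ⊆ {z, z'} from hcon) (Set.toFinite _)
    rw [Set.ncard_pair hne] at this
    omega
  simp only [Set.mem_insert_iff, Set.mem_singleton_iff, not_or] at hlz
  have h1 := (h'.2.2 l hl z' h'.1).2 ⟨hlz.2, .inr rfl⟩
  rcases ((h.2.2 l hl z' h'.1).1 h1).2 with h | h
  · exact hlz.1 h
  · exact hne h.symm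

/-- If the vertex `d` of the edge `de` has a second neighbour in `D`, then `D` is a star with center
`d`, whose leaves have `b` as their only neighbour besides `d`. -/
theorem Narrow.feasible_of_third {D : Set V} {a b : V} (h : Narrow G D a b) (hab : a ≠ b)
    (haD : a ∉ D) (hbD : b ∉ D)
    (hconn : ∀ v ∈ D, ∀ w ∈ D, (within G D).Reachable v w)
    (hN : ∀ v ∈ D, ∀ w, G.Adj v w → w ∈ D ∨ w = a ∨ w = b) {d e w : V} (hd : d ∈ D) (he : e ∈ D)
    (hw : w ∈ D) (hda : G.Adj d a) (heb : G.Adj e b) (hde : G.Adj d e) (hwd : G.Adj w d)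
    (hwe : w ≠ e) : IsStarOn G D d ∧ ∀ l ∈ D \ {d}, G.Adj l b ∧ (G.neighborSet l).ncard = 2 := by
  have hleaf : ∀ l ∈ D, G.Adj d l → G.Adj l b ∧ ¬ G.Adj l a ∧ ∀ w' ∈ D, G.Adj w' l → w' = d := by
    intro l hl hdl
    have hlb : G.Adj l b := by
      by_cases hle : l = e
      · rw [hle]; exact heb
      · exact (h.leaf_adj hd he hl hda heb hde hdl.symm hle).2
    obtain ⟨o, ho, hod, hol, hob⟩ : ∃ o ∈ D, G.Adj o d ∧ l ≠ o ∧ G.Adj o b := by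
      by_cases hle : l = e
      · subst hle
        exact ⟨w, hw, hwd, hwe.symm, (h.leaf_adj hd he hw hda heb hde hwd hwe).2⟩
      · exact ⟨e, he, hde.symm, hle, heb⟩
    exact ⟨hlb, (h.leaf_adj hd ho hl hda hob hod.symm hdl.symm hol).1,
      fun w' hw' hwl => h.leaf_nbr hd hl ho hda hlb hdl hod hol.symm hw' hwl⟩
  have hall : ∀ l ∈ D, l ≠ d → G.Adj d l := by
    intro l hl hld
    have := reachable_induction (hconn d hd l hl) (fun y => y = d ∨ y ∈ D ∧ G.Adj d y) (.inl rfl) (by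
      rintro p q (rfl | ⟨hp, hdp⟩) hpq
      · exact .inr ⟨hpq.2.2, hpq.1⟩
      · exact .inl ((hleaf p hp hdp).2.2 q hpq.2.2 hpq.1.symm))
    rcases this with h | h
    · exact (hld h).elim
    · exact h.2
  refine ⟨⟨hd, ⟨e, he, by simpa using hde.ne.symm⟩, fun p hp q hq => ⟨fun hpq => ⟨hpq.ne, ?_⟩, ?_⟩⟩, ?_⟩
  · by_contra! hcon
    exact hcon.2 ((hleaf p hp (hall p hp hcon.1)).2.2 q hq hpq.symm)
  · rintro ⟨hpq, rfl | rfl⟩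
    · exact hall q hq hpq.symm
    · exact (hall p hp hpq).symm
  · rintro l ⟨hl, hld⟩
    have hdl := hall l hl hld
    obtain ⟨h1, h2, h3⟩ := hleaf l hl hdl
    refine ⟨h1, ?_⟩
    have : G.neighborSet l = {d, b} := by
      ext y
      simp only [SimpleGraph.mem_neighborSet, Set.mem_insert_iff, Set.mem_singleton_iff]
      constructor
      · intro hly
        rcases hN l hl y hly with hy | rfl | rfl
        · exact .inl (h3 y hy hly.symm)
        · exact (h2 hly).elim
        · exact .inr rfl
      · rintro (rfl | rfl)
        · exact hdl.symm
        · exact h1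
    rw [this, Set.ncard_pair (by rintro rfl; exact hbD hd)]

/-- A narrow connected set with external neighbourhood in `{a, b}` is a feasible star, if it contains
an edge whose ends are joined to `a` and to `b`. -/
theorem Narrow.feasible {D : Set V} {a b : V} (h : Narrow G D a b) (hab : a ≠ b)
    (haD : a ∉ D) (hbD : b ∉ D)
    (hconn : ∀ v ∈ D, ∀ w ∈ D, (within G D).Reachable v w)
    (hN : ∀ v ∈ D, ∀ w, G.Adj v w → w ∈ D ∨ w = a ∨ w = b) {d e : V} (hd : d ∈ D) (he : e ∈ D)
    (hda : G.Adj d a) (heb : G.Adj e b) (hde : G.Adj d e) :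
    (∃ z, IsStarOn G D z) ∧ IsFeasible G a b D := by
  have hext : extNeighbors G D = {a, b} := by
    ext y
    simp only [extNeighbors, Set.mem_ofPred_eq, Set.mem_insert_iff, Set.mem_singleton_iff]
    constructor
    · rintro ⟨hy, v, hv, hvy⟩
      exact (hN v hv y hvy).resolve_left hy
    · rintro (rfl | rfl)
      · exact ⟨haD, d, hd, hda⟩
      · exact ⟨hbD, e, he, heb⟩
  by_cases hDe : D ⊆ {d, e}
  · have hD : D = {d, e} := by
      refine hDe.antisymm ?_
      rintro y (rfl | rfl) <;> assumption
    refine ⟨⟨d, hd, ⟨e, he, by simpa using hde.ne.symm⟩, ?_⟩, hext, fun h3 => ?_⟩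
    · intro p hp q hq
      rw [hD] at hp hq
      rcases hp with rfl | rfl <;> rcases hq with rfl | rfl
      · simp
      · simp [hde, hde.ne]
      · simp [hde.symm, hde.ne.symm]
      · simp
    · rw [hD, Set.ncard_pair hde.ne] at h3; omega
  · obtain ⟨y, hy, hyne⟩ := Set.not_subset.1 hDe
    obtain ⟨p, w, hp, hw, hpw⟩ := exists_exit (hconn d hd y hy) (· ∈ ({d, e} : Set V)) (by simp) hyne
    have hwD := hpw.2.2
    simp only [Set.mem_insert_iff, Set.mem_singleton_iff, not_or] at hw hp
    rcases hp with rfl | rfl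
    · obtain ⟨h1, h2⟩ := h.feasible_of_third hab haD hbD hconn hN hd he hwD hda heb hde
        hpw.1.symm hw.2
      refine ⟨⟨_, h1⟩, hext, fun h3 z hz => ?_⟩
      rw [← h1.center_unique hz h3]
      exact ⟨fun l hl => (h2 l hl).2, b, by simp, fun l hl => (h2 l hl).1⟩
    · obtain ⟨h1, h2⟩ := h.symm.feasible_of_third hab.symm hbD haD hconn
        (fun v hv w hvw => (hN v hv w hvw).imp_right Or.symm) he hd hwD heb hda hde.symm
        hpw.1.symm hw.1
      refine ⟨⟨_, h1⟩, hext, fun h3 z hz => ?_⟩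
      rw [← h1.center_unique hz h3]
      exact ⟨fun l hl => (h2 l hl).2, a, by simp, fun l hl => (h2 l hl).1⟩

/-! ### The vertices off the cycle -/

/-- The neighbours `u 0, u 2, …, u (2k - 2)` of `x`. -/
def evens (u : ℤ → V) (k : ℕ) : Set V := {a | ∃ i : ℤ, 0 ≤ i ∧ i < k ∧ u (2 * i) = a}

namespace Config

theorem mem_evens {s : ℤ} (h0 : 0 ≤ s) (h1 : s ≤ 2 * k - 2) (h2 : s % 2 = 0) : u s ∈ evens u k :=
  ⟨s / 2, by omega, by omega, by congr 1; omega⟩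

theorem mem_evens_iff (h : Config G c k u x) {s : ℤ} (h0 : 0 ≤ s) (hs : s < c) :
    u s ∈ evens u k ↔ s % 2 = 0 ∧ s ≤ 2 * k - 2 := by
  refine ⟨fun ⟨i, hi0, hi, e⟩ => ?_, fun ⟨h1, h2⟩ => mem_evens h0 h2 h1⟩
  have := h.le_c
  have := h.cyc.inj e (by omega) (by omega)
  omega

theorem evens_subset : evens u k ⊆ Set.range u := by
  rintro _ ⟨i, -, -, rfl⟩; exact ⟨_, rfl⟩

theorem ncard_evens (h : Config G c k u x) : (evens u k).ncard = k := by
  classical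
  have : evens u k = ((Finset.Ico (0 : ℤ) k).image fun i => u (2 * i) : Finset V) := by
    ext a; simp [evens, and_assoc]
  rw [this, Set.ncard_coe_finset, Finset.card_image_of_injOn]
  · simp
  · intro i hi j hj e
    simp only [Finset.coe_Ico, Set.mem_Ico] at hi hj
    have := h.le_c
    have := h.cyc.inj e (by omega) (by omega)
    omega

theorem adj_x (h : Config G c k u x) {a : V} (ha : G.Adj x a) : a ∈ evens u k := h.only a ha

/-- A vertex of the cycle which is not a neighbour of `x`. -/
theorem not_even_cases (h : Config G c k u x) {a : V} (ha : a ∈ Set.range u)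
    (hae : a ∉ evens u k) :
    (∃ s, Mid c k s ∧ u s = a) ∨ c = 2 * k + 1 ∧ (a = u (2 * k - 1) ∨ a = u (2 * k)) := by
  obtain ⟨s, h0, hs, rfl⟩ := h.exists_pos ha
  rw [h.mem_evens_iff h0 hs] at hae
  have := h.c_le
  have := h.le_c
  by_cases hm : Mid c k s
  · exact .inl ⟨s, hm, rfl⟩
  · simp only [Mid, not_and, not_or] at hm
    have : s = 2 * k - 1 ∨ s = 2 * k := by omega
    refine .inr ⟨by omega, ?_⟩
    rcases this with rfl | rfl
    · exact .inl rfl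
    · exact .inr rfl

/-- Paths off the cycle avoid `x`, all of whose neighbours are on the cycle. -/
theorem exists_out_path (h : Config G c k u x) {S : Set V} (hS : ∀ a ∈ S, a ∉ Set.range u)
    {y w : V} (hy : y ∈ S) (hyx : y ≠ x) (hr : (within G S).Reachable y w) :
    ∃ R, ListPath G y w R ∧ (∀ a ∈ R, a ∈ S) ∧ ∀ a ∈ R, a ∉ Set.range u ∧ a ≠ x := by
  obtain ⟨R, hR, hRS⟩ := exists_listPath hr hy
  refine ⟨R, hR, fun a ha => (hRS a ha).1, fun a ha => ⟨hS a (hRS a ha).1, ?_⟩⟩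
  refine reachable_induction (hRS a ha).2 (· ≠ x) hyx ?_
  rintro p q - hpq rfl
  exact hS p hpq.2.1 (evens_subset (h.adj_x hpq.1.symm))

theorem ne_x_of_adj {y w : V} (h : Config G c k u x) (hw : w ∉ Set.range u) (hyw : G.Adj y w) :
    y ≠ x := by
  rintro rfl; exact hw (evens_subset (h.adj_x hyw))

variable [Fintype V]

/-- From a vertex `y` off the cycle there is a path to the cycle avoiding a given vertex `z`. -/
theorem exists_link (h : Config G c k u x) (hG : IsTwoConnected G) {y z : V}
    (hy : y ∉ Set.range u) (hyx : y ≠ x) (hyz : y ≠ z) :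
    ∃ w R t, ListPath G y w R ∧ (∀ a ∈ R, a ∉ Set.range u ∧ a ≠ x) ∧ z ∉ R ∧ 0 ≤ t ∧ t < (c : ℤ) ∧
      u t ≠ z ∧ G.Adj w (u t) := by
  obtain ⟨z₀, hz₀, hne⟩ := h.cyc.exists_ne z
  obtain ⟨w, z', hw, hz', hne', hadj⟩ := hG.exists_attachment hy hyz hz₀ hne
  obtain ⟨R, hR, hRS, hRo⟩ := h.exists_out_path
    (S := {a | a ∉ Set.range u ∧ a ≠ z}) (fun a ha => ha.1) ⟨hy, hyz⟩ hyx hw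
  obtain ⟨t, h0, ht, rfl⟩ := h.exists_pos hz'
  exact ⟨w, R, t, hR, hRo, fun hz => (hRS z hz).2 rfl, h0, ht, hne', hadj⟩

theorem not_adj_mid (h : Config G c k u x) (hG : IsTwoConnected G) {y : V}
    (hy : y ∉ Set.range u) (hyx : y ≠ x) {s : ℤ} (hs : Mid c k s) : ¬ G.Adj (u s) y := fun hadj => by
  obtain ⟨w, R, t, hR, hRo, -, h0, ht, hne, hwt⟩ := h.exists_link hG hy hyx hadj.ne.symm
  have hl : Link G u x s t R.length := ⟨y, w, R, hR, hRo, hadj, hwt.symm, rfl⟩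
  exact h.not_link_mid hs h0 ht (by rintro rfl; exact hne rfl) hl

/-- All neighbours of a vertex in the middle between two neighbours of `x` are neighbours of `x`. -/
theorem mid_nbr (h : Config G c k u x) (hG : IsTwoConnected G) {s : ℤ} (hs : Mid c k s) {a : V}
    (ha : G.Adj (u s) a) : a ∈ evens u k := by
  by_cases haC : a ∈ Set.range u
  · obtain ⟨t, h0, ht, rfl⟩ := h.exists_pos haC
    have := h.mid_adj_even hs h0 ht ha
    exact mem_evens h0 this.2 this.1
  · by_cases hax : a = x
    · subst hax
      have := h.adj_x ha.symm
      have hsc := h.mid_lt hs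
      rw [h.mem_evens_iff hs.1 hsc] at this
      have := hs.2.1
      omega
    · exact (h.not_adj_mid hG haC hax hs ha).elim

/-- The neighbours of a vertex off the cycle which is joined to the first exceptional vertex. -/
theorem adj_exc_iff (h : Config G c k u x) (hG : IsTwoConnected G) (hc : c = 2 * k + 1) {y : V}
    (hy : y ∉ Set.range u) (hyp : G.Adj y (u (2 * k - 1))) (w : V) :
    G.Adj y w ↔ w = u (2 * k - 1) ∨ w = u 0 := by
  have hk := h.five_le
  have hyx : y ≠ x := by
    rintro rfl
    have := h.adj_x hyp
    rw [h.mem_evens_iff (by omega) (by omega)] at this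
    omega
  have hy0 : G.Adj y (u 0) := by
    obtain ⟨w, R, t, hR, hRo, -, h0, ht, hne, hwt⟩ := h.exists_link hG hy hyx hyp.ne
    obtain ⟨rfl, hm⟩ := h.link_exc hc h0 ht (by rintro rfl; exact hne rfl)
      ⟨y, w, R, hR, hRo, hyp.symm, hwt.symm, rfl⟩
    obtain ⟨a, rfl⟩ := List.length_eq_one_iff.1 hm
    have h1 : a = y := by simpa using hR.head
    have h2 : a = w := by simpa using hR.last
    rw [← h1, h2]; exact hwt
  constructor
  · intro hyw
    by_cases hwC : w ∈ Set.range u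
    · obtain ⟨t, h0, ht, rfl⟩ := h.exists_pos hwC
      by_cases htk : t = 2 * k - 1
      · exact .inl (by rw [htk])
      · obtain ⟨rfl, -⟩ := h.link_exc hc h0 ht htk
          ⟨y, y, [y], ListPath.singleton y, by simpa using ⟨by simpa using hy, hyx⟩, hyp.symm,
            hyw.symm, rfl⟩
        exact .inr rfl
    · exfalso
      have hwx : w ≠ x := by rintro rfl; exact hy (evens_subset (h.adj_x hyw.symm))
      obtain ⟨w', R, t, hR, hRo, hyR, h0, ht, -, hwt⟩ := h.exists_link hG hwC hwx hyw.ne.symm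
      have hp := hR.cons hyw hyR
      have hpo : ∀ a ∈ y :: R, a ∉ Set.range u ∧ a ≠ x := by
        intro a ha
        rcases List.mem_cons.1 ha with rfl | ha
        · exact ⟨hy, hyx⟩
        · exact hRo a ha
      have hpos := hR.length_pos
      by_cases htk : t = 2 * k - 1
      · subst htk
        have := (h.link_exc hc (t := 0) le_rfl (by omega) (by omega)
          (Link.symm ⟨y, w', y :: R, hp, hpo, hy0.symm, hwt.symm, rfl⟩)).2
        simp at this; simp [this] at hpos
      · have := (h.link_exc hc h0 ht htk ⟨y, w', y :: R, hp, hpo, hyp.symm, hwt.symm, rfl⟩).2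
        simp at this; simp [this] at hpos
  · rintro (rfl | rfl)
    · exact hyp
    · exact hy0

section multi
variable {y w : V}

/-- A component of `G - C` with at least two vertices sends edges only to `u 0` and `u (2k - 2)`, and
contains two adjacent vertices with edges to these: by `exists_pair` it contains a link with at least
two inner vertices from each of its neighbours on `C`, and `link_two_le` applies. -/
theorem multi_nbr (h : Config G c k u x) (hG : IsTwoConnected G) (hy : y ∉ Set.range u)
    (hw : w ∉ Set.range u) (hyw : G.Adj y w) {a : V}
    (ha : (within G (Set.range u)ᶜ).Reachable y a) {s : ℤ} (h0 : 0 ≤ s) (hs : s < c)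
    (has : G.Adj a (u s)) :
    c = 2 * k + 1 ∧ (s = 0 ∨ s = 2 * k - 2) ∧ ∃ d e, (within G (Set.range u)ᶜ).Reachable y d ∧
      (within G (Set.range u)ᶜ).Reachable y e ∧ G.Adj d (u 0) ∧ G.Adj e (u (2 * k - 2)) ∧
      G.Adj d e := by
  classical
  have hyx := h.ne_x_of_adj hw hyw
  have hA := h.cyc.attached hG h.circ hy
  set D := Finset.univ.filter fun a => (within G (Set.range u)ᶜ).Reachable y a with hD
  have hmem : ∀ a, a ∈ D ↔ (within G (Set.range u)ᶜ).Reachable y a := by simp [hD]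
  have hD2 : 2 ≤ D.card := Finset.one_lt_card.2 ⟨y, (hmem y).2 (.refl _), w,
    (hmem w).2 (SimpleGraph.Adj.reachable ⟨hyw, hy, hw⟩), hyw.ne⟩
  obtain ⟨d, hd, e, he, hde, z', hz', hne, hdz, hez'⟩ := hA.exists_pair hD2 ((hmem a).2 ha)
    (by simp) has
  obtain ⟨t, ht0, ht, rfl⟩ := h.exists_pos (by simpa using hz')
  have hdr := (hmem d).1 hd
  have her := (hmem e).1 he
  have hdC := mem_of_within_reachable hdr hy
  have hdx : d ≠ x := by
    obtain ⟨R, hR, -, hRo⟩ := h.exists_out_path (S := (Set.range u)ᶜ) (fun a ha => ha) hy hyx hdr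
    exact (hRo d hR.last_mem).2
  obtain ⟨R, hR, -, hRo⟩ := h.exists_out_path (S := (Set.range u)ᶜ) (fun a ha => ha) hdC hdx
    (hdr.symm.trans her)
  have hR2 : 2 ≤ R.length := by
    rw [← List.toFinset_card_of_nodup hR.nodup]
    exact Finset.one_lt_card.2 ⟨d, by simpa using hR.head_mem, e, by simpa using hR.last_mem, hde⟩
  have hlink : Link G u x s t R.length := ⟨d, e, R, hR, hRo, hdz.symm, hez'.symm, rfl⟩
  have hadj : R.length = 2 → G.Adj d e := by
    intro h2
    obtain ⟨p, q, rfl⟩ := List.length_eq_two.1 h2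
    have h1 : p = d := by simpa using hR.head
    have h2 : q = e := by simpa using hR.last
    have := hR.chain
    rw [List.isChain_pair] at this
    rwa [← h1, ← h2]
  rcases lt_trichotomy s t with hst | rfl | hst
  · obtain ⟨hc, rfl, rfl, h2⟩ := h.link_two_le hlink hR2 h0 hst ht
    exact ⟨hc, .inl rfl, d, e, hdr, her, hdz, hez', hadj h2⟩
  · exact (hne rfl).elim
  · obtain ⟨hc, rfl, rfl, h2⟩ := h.link_two_le hlink.symm hR2 ht0 hst hs
    exact ⟨hc, .inr rfl, e, d, her, hdr, hez', hdz, (hadj h2).symm⟩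

/-- The component of `v` in `G - {u 0, u 2, …, u (2k - 2)}`. -/
def comp (G : SimpleGraph V) (u : ℤ → V) (k : ℕ) (v : V) : Set V :=
  {a | (within G (evens u k)ᶜ).Reachable v a}

/-- The structure of a component of `G - C` with at least two vertices: it is also a component of
`G` minus the neighbours of `x`, and a feasible star. -/
theorem multi_spec (h : Config G c k u x) (hG : IsTwoConnected G) (hy : y ∉ Set.range u)
    (hw : w ∉ Set.range u) (hyw : G.Adj y w) :
    c = 2 * k + 1 ∧ (∃ d e, d ∈ comp G u k y ∧ e ∈ comp G u k y ∧ G.Adj d (u 0) ∧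
      G.Adj e (u (2 * k - 2)) ∧ G.Adj d e) ∧ (∀ a ∈ comp G u k y, a ∉ Set.range u) ∧
      (∃ z, IsStarOn G (comp G u k y) z) ∧
      IsFeasible G (u 0) (u (2 * k - 2)) (comp G u k y) := by
  have hyx := h.ne_x_of_adj hw hyw
  have hk := h.five_le
  -- The component of `y` in `G - C` has an edge to `C`.
  obtain ⟨hc, d, e, hd, he, hda, heb, hde⟩ : c = 2 * k + 1 ∧
      ∃ d e, (within G (Set.range u)ᶜ).Reachable y d ∧
      (within G (Set.range u)ᶜ).Reachable y e ∧ G.Adj d (u 0) ∧ G.Adj e (u (2 * k - 2)) ∧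
      G.Adj d e := by
    obtain ⟨a, R, t, hR, hRo, -, h0, ht, -, hat⟩ := h.exists_link hG hy hyx hyx
    have := h.multi_nbr hG hy hw hyw
      (hR.reachable (S := (Set.range u)ᶜ) fun a ha => (hRo a ha).1) h0 ht hat
    exact ⟨this.1, this.2.2⟩
  have hcomp : comp G u k y = {a | (within G (Set.range u)ᶜ).Reachable y a} := by
    ext a
    constructor
    · intro ha
      refine reachable_induction ha (fun a => (within G (Set.range u)ᶜ).Reachable y a) (.refl _) ?_
      intro p q hp hpq
      refine hp.trans (SimpleGraph.Adj.reachable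
        ⟨hpq.1, mem_of_within_reachable hp hy, fun hq => ?_⟩)
      obtain ⟨s, h0, hs, rfl⟩ := h.exists_pos hq
      rcases (h.multi_nbr hG hy hw hyw hp h0 hs hpq.1).2.1 with rfl | rfl
      · exact hpq.2.2 (mem_evens (by omega) (by omega) (by omega))
      · exact hpq.2.2 (mem_evens (by omega) (by omega) (by omega))
    · intro ha
      exact SimpleGraph.Reachable.mono (within_mono (Set.compl_subset_compl.2 evens_subset)) ha
  have hout : ∀ a ∈ comp G u k y, a ∉ Set.range u := by
    intro a ha
    rw [hcomp] at ha
    exact mem_of_within_reachable ha hy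
  have hdD : d ∈ comp G u k y := by rw [hcomp]; exact hd
  have heD : e ∈ comp G u k y := by rw [hcomp]; exact he
  refine ⟨hc, ⟨d, e, hdD, heD, hda, heb, hde⟩, hout, ?_⟩
  have hoc : ∀ a ∈ comp G u k y, a ≠ x := by
    intro a ha
    rw [hcomp] at ha
    obtain ⟨R, hR, -, hRo⟩ := h.exists_out_path (S := (Set.range u)ᶜ) (fun a ha => ha) hy hyx ha
    exact (hRo a hR.last_mem).2
  have hN : ∀ v ∈ comp G u k y, ∀ w, G.Adj v w →
      w ∈ comp G u k y ∨ w = u 0 ∨ w = u (2 * k - 2) := by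
    intro v hv w' hvw
    by_cases hwC : w' ∈ Set.range u
    · obtain ⟨s, h0, hs, rfl⟩ := h.exists_pos hwC
      rw [hcomp] at hv
      rcases (h.multi_nbr hG hy hw hyw hv h0 hs hvw).2.1 with rfl | rfl
      · exact .inr (.inl rfl)
      · exact .inr (.inr rfl)
    · refine .inl ?_
      rw [hcomp] at hv ⊢
      exact hv.trans (SimpleGraph.Adj.reachable ⟨hvw, mem_of_within_reachable hv hy, hwC⟩)
  have hnarrow : Narrow G (comp G u k y) (u 0) (u (2 * k - 2)) := by
    refine ⟨fun z hz v hv hvz => ?_, fun d e R hR hRD hd he => ?_⟩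
    · obtain ⟨f, R, t, hR, hRo, hzR, h0, ht, -, hft⟩ := h.exists_link hG (hout v hv) (hoc v hv) hvz
      have hRreach : ∀ a ∈ R, a ∈ comp G u k y := by
        intro a ha
        obtain ⟨P, S, rfl⟩ := List.append_of_mem ha
        rw [hcomp] at hv ⊢
        refine hv.trans (hR.left.reachable (S := (Set.range u)ᶜ) fun b hb => (hRo b ?_).1)
        simp at hb ⊢; tauto
      refine ⟨f, hR.reachable fun a ha => ⟨hRreach a ha, by rintro rfl; exact hzR ha⟩, ?_⟩
      have hf := hRreach f hR.last_mem
      rw [hcomp] at hf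
      rcases (h.multi_nbr hG hy hw hyw hf h0 ht hft).2.1 with rfl | rfl
      · exact .inl hft
      · exact .inr hft
    · have hl : Link G u x 0 (2 * k - 2) R.length :=
        ⟨d, e, R, hR, fun a ha => ⟨hout a (hRD a ha), hoc a (hRD a ha)⟩, hd.symm, he.symm, rfl⟩
      have := h.link_gap hl (by omega) (by omega)
      omega
  refine hnarrow.feasible ?_ ?_ ?_ ?_ hN hdD heD hda heb hde
  · intro e
    have := h.cyc.inj e (by omega) (by omega)
    omega
  · intro hh; exact hout _ hh ⟨_, rfl⟩
  · intro hh; exact hout _ hh ⟨_, rfl⟩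
  · intro v hv w' hw'
    have hvw : (within G (evens u k)ᶜ).Reachable v w' := hv.symm.trans hw'
    refine (reachable_induction hvw (fun a => a ∈ comp G u k y ∧
      (within G (comp G u k y)).Reachable v a) ⟨hv, .refl _⟩ ?_).2
    rintro p q ⟨h1, h2⟩ hpq
    have h3 : q ∈ comp G u k y := h1.trans (SimpleGraph.Adj.reachable hpq)
    exact ⟨h3, h2.trans (SimpleGraph.Adj.reachable ⟨hpq.1, h1, h3⟩)⟩

end multi
end Config
end BondyStability

namespace BondyStability
variable {V : Type*} {G : SimpleGraph V} {c k : ℕ} {u : ℤ → V} {x : V}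

/-! ### Exchange of the exceptional vertices -/

namespace Config

/-- In an odd cycle the edge joining the two exceptional vertices may be replaced by any other edge
`pq` off the rest of the cycle with `p` joined to `u (2k - 2)` and `q` to `u 0`. -/
theorem exchange (h : Config G c k u x) (hc : c = 2 * k + 1) {p q : V}
    (hp : ∀ s : ℤ, 0 ≤ s → s ≤ 2 * k - 2 → p ≠ u s)
    (hq : ∀ s : ℤ, 0 ≤ s → s ≤ 2 * k - 2 → q ≠ u s)
    (hpx : p ≠ x) (hqx : q ≠ x) (hup : G.Adj (u (2 * k - 2)) p) (hpq : G.Adj p q)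
    (hqu : G.Adj q (u 0)) :
    ∃ u', Config G c k u' x ∧ (∀ s : ℤ, 0 ≤ s → s ≤ 2 * k - 2 → u' s = u s) ∧ u' (2 * k - 1) = p ∧
      u' (2 * k) = q ∧
      ∀ a, a ∈ Set.range u' ↔ a = p ∨ a = q ∨ ∃ s : ℤ, 0 ≤ s ∧ s ≤ 2 * k - 2 ∧ u s = a := by
  classical
  have hk := h.five_le
  have hcpos : (0 : ℤ) < c := by omega
  let g : ℤ → V := fun s => if s = 2 * k - 1 then p else if s = 2 * k then q else u s
  have g1 : ∀ s : ℤ, s ≤ 2 * k - 2 → g s = u s := fun s hs => by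
    simp only [g]; rw [if_neg (by omega), if_neg (by omega)]
  have g2 : g (2 * k - 1) = p := by simp [g]
  have g3 : g (2 * k) = q := by
    simp only [g]; rw [if_neg (by omega), if_pos trivial]
  have hcases : ∀ s : ℤ, s < c → s ≤ 2 * k - 2 ∨ s = 2 * k - 1 ∨ s = 2 * k := fun s hs => by omega
  have ginj : ∀ s t : ℤ, 0 ≤ s → s < c → 0 ≤ t → t < c → g s = g t → s = t := by
    intro s t hs0 hs ht0 ht e
    rcases hcases s hs with h1 | rfl | rfl <;> rcases hcases t ht with h2 | rfl | rfl
    · rw [g1 s h1, g1 t h2] at e; exact h.cyc.inj e (by omega) (by omega)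
    · rw [g1 s h1, g2] at e; exact (hp s hs0 h1 e.symm).elim
    · rw [g1 s h1, g3] at e; exact (hq s hs0 h1 e.symm).elim
    · rw [g1 t h2, g2] at e; exact (hp t ht0 h2 e).elim
    · rfl
    · rw [g2, g3] at e; exact (hpq.ne e).elim
    · rw [g1 t h2, g3] at e; exact (hq t ht0 h2 e).elim
    · rw [g2, g3] at e; exact (hpq.ne e.symm).elim
    · rfl
  have hmod : ∀ s : ℤ, 0 ≤ s → s < c → s % c = s := fun s h0 h1 => Int.emod_eq_of_lt h0 h1
  have hrange : ∀ a, a ∈ Set.range (fun s : ℤ => g (s % c)) ↔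
      a = p ∨ a = q ∨ ∃ s : ℤ, 0 ≤ s ∧ s ≤ 2 * k - 2 ∧ u s = a := by
    intro a
    constructor
    · rintro ⟨s, rfl⟩
      have h0 := Int.emod_nonneg s hcpos.ne'
      rcases hcases (s % c) (Int.emod_lt_of_pos s hcpos) with h1 | h1 | h1
      · exact .inr (.inr ⟨_, h0, h1, (g1 _ h1).symm⟩)
      · exact .inl (by simp only [h1, g2])
      · exact .inr (.inl (by simp only [h1, g3]))
    · rintro (rfl | rfl | ⟨s, h0, h1, rfl⟩)
      · exact ⟨2 * k - 1, by simp only [hmod _ (by omega : (0 : ℤ) ≤ 2 * k - 1) (by omega), g2]⟩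
      · exact ⟨2 * k, by simp only [hmod _ (by omega : (0 : ℤ) ≤ 2 * k) (by omega), g3]⟩
      · exact ⟨s, by simp only [hmod _ h0 (by omega), g1 s h1]⟩
  refine ⟨fun s => g (s % c), ⟨⟨h.cyc.three_le, fun s t => ?_, fun s => ?_⟩, h.circ, hk, h.le_c,
    h.c_le, ?_, ?_, ?_⟩, ?_, ?_, ?_, hrange⟩
  · constructor
    · intro e
      have := ginj _ _ (Int.emod_nonneg s hcpos.ne') (Int.emod_lt_of_pos s hcpos)
        (Int.emod_nonneg t hcpos.ne') (Int.emod_lt_of_pos t hcpos) e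
      exact Int.dvd_of_emod_eq_zero (Int.emod_eq_emod_iff_emod_sub_eq_zero.1 this)
    · intro e
      have : s % c = t % c := Int.emod_eq_emod_iff_emod_sub_eq_zero.2 (Int.emod_eq_zero_of_dvd e)
      simp only [this]
  · have h0 := Int.emod_nonneg s hcpos.ne'
    have hlt := Int.emod_lt_of_pos s hcpos
    have hs1 : (s + 1) % c = (s % c + 1) % c := by rw [Int.emod_add_emod]
    simp only [hs1]
    generalize s % c = r at *
    rcases hcases r hlt with h1 | rfl | rfl
    · rw [hmod (r + 1) (by omega) (by omega), g1 r h1]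
      rcases h1.eq_or_lt with rfl | h1
      · rw [show (2 * k - 2 + 1 : ℤ) = 2 * k - 1 by ring, g2]; exact hup
      · rw [g1 (r + 1) (by omega)]; exact h.cyc.adj r
    · rw [hmod _ (by omega) (by omega), show (2 * k - 1 + 1 : ℤ) = 2 * k by ring, g2, g3]; exact hpq
    · rw [show (2 * k + 1 : ℤ) = c by omega, Int.emod_self, g3, g1 0 (by omega)]; exact hqu
  · rw [hrange]
    rintro (rfl | rfl | ⟨s, -, -, hs⟩)
    · exact hpx rfl
    · exact hqx rfl
    · exact h.x_notMem ⟨s, hs⟩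
  · intro i h0 h1
    simp only [hmod (2 * i) (by omega) (by omega), g1 (2 * i) (by omega)]
    exact h.adj i h0 h1
  · intro a ha
    obtain ⟨i, h0, h1, rfl⟩ := h.only a ha
    refine ⟨i, h0, h1, ?_⟩
    simp only [hmod (2 * i) (by omega) (by omega), g1 (2 * i) (by omega)]
  · intro s h0 h1
    simp only [hmod s h0 (by omega), g1 s h1]
  · simp only [hmod _ (by omega : (0 : ℤ) ≤ 2 * k - 1) (by omega), g2]
  · simp only [hmod _ (by omega : (0 : ℤ) ≤ 2 * k) (by omega), g3]

theorem evens_congr {u' : ℤ → V} (h : ∀ s : ℤ, 0 ≤ s → s ≤ 2 * k - 2 → u' s = u s) :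
    evens u' k = evens u k := by
  ext a
  constructor
  · rintro ⟨i, h0, h1, rfl⟩; exact ⟨i, h0, h1, (h _ (by omega) (by omega)).symm⟩
  · rintro ⟨i, h0, h1, rfl⟩; exact ⟨i, h0, h1, h _ (by omega) (by omega)⟩

/-- Reversing the cycle swaps the two exceptional vertices. -/
theorem reverse_exc (h : Config G c k u x) (hc : c = 2 * k + 1) :
    u (2 * k - 2 - (2 * k - 1)) = u (2 * k) := by
  rw [h.cyc.eq_iff]; exact ⟨-1, by rw [hc]; push_cast; ring⟩

theorem range_reverse : Set.range (fun s => u (2 * k - 2 - s)) = Set.range u :=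
  (Equiv.subLeft (2 * k - 2 : ℤ)).surjective.range_comp u

/-- The first exceptional vertex is not a neighbour of `x`. -/
theorem exc_notMem (h : Config G c k u x) (hc : c = 2 * k + 1) : u (2 * k - 1) ∉ evens u k := by
  have := h.five_le
  rw [h.mem_evens_iff (by omega) (by omega)]; omega

theorem exc_notMem' (h : Config G c k u x) (hc : c = 2 * k + 1) : u (2 * k) ∉ evens u k := by
  have := h.five_le
  rw [h.mem_evens_iff (by omega) (by omega)]; omega

theorem adj_exc_exc (h : Config G c k u x) : G.Adj (u (2 * k - 1)) (u (2 * k)) := by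
  have := h.cyc.adj (2 * k - 1)
  rwa [show (2 * k - 1 + 1 : ℤ) = 2 * k by ring] at this

end Config

/-! ### Subgraphs of the extremal graphs -/

/-- A graph all of whose edges lie inside the `c + 1 - k` vertices of `T` or have an end among
the `k` vertices of `A ⊆ T` is contained in `W_{n,k,c}`. -/
theorem isContained_W [Fintype V] {n : ℕ} (hn : Fintype.card V = n) {A T : Set V} (hAT : A ⊆ T)
    (hA : A.ncard = k) (hT : T.ncard = c + 1 - k)
    (hE : ∀ v w, G.Adj v w → v ∈ A ∨ w ∈ A ∨ v ∈ T ∧ w ∈ T) : G.IsContained (W n k c) := by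
  classical
  have hlen : ∀ (S : Set V) [DecidablePred (· ∈ S)],
      (Finset.univ.filter (· ∈ S)).toList.length = S.ncard := by
    intro S _
    rw [Finset.length_toList, ← Set.ncard_coe_finset]
    congr 1; ext a; simp
  set lA := (Finset.univ.filter (· ∈ A)).toList with hlA
  set lT := (Finset.univ.filter (· ∈ T \ A)).toList with hlT
  set lR := (Finset.univ.filter (· ∈ Tᶜ)).toList with hlR
  have mA : ∀ a, a ∈ lA ↔ a ∈ A := by simp [hlA]
  have mT : ∀ a, a ∈ lT ↔ a ∈ T ∧ a ∉ A := by simp [hlT]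
  have mR : ∀ a, a ∈ lR ↔ a ∉ T := by simp [hlR]
  have cA : lA.length = k := by rw [hlA, hlen, hA]
  have cT : lT.length = c + 1 - k - k := by
    rw [hlT, hlen, Set.ncard_sdiff hAT, hA, hT]
  have hkT : k ≤ c + 1 - k := by have := Set.ncard_le_ncard hAT; omega
  set L := lA ++ (lT ++ lR) with hL
  have hmem : ∀ a, a ∈ L := by
    intro a; simp only [hL, List.mem_append, mA, mT, mR]; tauto
  have hnd : L.Nodup := by
    refine List.nodup_append'.2 ⟨Finset.nodup_toList _, List.nodup_append'.2
      ⟨Finset.nodup_toList _, Finset.nodup_toList _, ?_⟩, ?_⟩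
    · intro a h1 h2; exact (mR a).1 h2 ((mT a).1 h1).1
    · intro a h1 h2
      rcases List.mem_append.1 h2 with h2 | h2
      · exact ((mT a).1 h2).2 ((mA a).1 h1)
      · exact (mR a).1 h2 (hAT ((mA a).1 h1))
  have hLn : L.length = n := by
    rw [← hn, ← List.toFinset_card_of_nodup hnd, ← Finset.card_univ]
    congr 1; ext a; simp [hmem a]
  let f : V → Fin n := fun a => ⟨L.idxOf a, by rw [← hLn]; exact List.idxOf_lt_length_of_mem (hmem a)⟩
  have hf : Function.Injective f := by
    intro a b e
    simp only [f, Fin.mk.injEq] at e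
    exact (List.idxOf_inj (hmem a)).1 e
  have fA : ∀ a ∈ A, (f a).val < k := by
    intro a ha
    simp only [f, hL]
    rw [List.idxOf_append_of_mem ((mA a).2 ha), ← cA]
    exact List.idxOf_lt_length_of_mem ((mA a).2 ha)
  have fT : ∀ a ∈ T, (f a).val < c + 1 - k := by
    intro a ha
    by_cases haA : a ∈ A
    · have := fA a haA; omega
    · have h1 : a ∈ lT := (mT a).2 ⟨ha, haA⟩
      have h2 := List.idxOf_lt_length_of_mem h1
      simp only [f, hL]
      rw [List.idxOf_append_of_notMem (by rwa [mA]), List.idxOf_append_of_mem h1]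
      omega
  refine ⟨⟨⟨f, ?_⟩, hf⟩⟩
  intro v w hvw
  refine ⟨fun e => hvw.ne (hf e), ?_⟩
  rcases hE v w hvw with h | h | ⟨h1, h2⟩
  · have := fA v h; omega
  · have := fA w h; omega
  · exact .inl ⟨fT v h1, fT w h2⟩

/-- The graph obtained from `G` by joining all vertices of `A` to each other and to all vertices
outside `Y`. -/
def joined (G : SimpleGraph V) (A Y : Set V) : SimpleGraph V where
  Adj a b := a ≠ b ∧ (G.Adj a b ∨ (a ∈ A ∧ b ∉ Y) ∨ (b ∈ A ∧ a ∉ Y))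
  symm := ⟨fun _ _ h => ⟨h.1.symm, h.2.imp (fun h => h.symm) Or.symm⟩⟩
  loopless := ⟨fun _ h => h.1 rfl⟩

theorem le_joined {A Y : Set V} : G ≤ joined G A Y := fun _ _ h => ⟨h.ne, .inl h⟩

theorem joined_adj {A Y : Set V} {v w : V} (hv : v ∈ Y) (hvA : v ∉ A) :
    (joined G A Y).Adj v w ↔ G.Adj v w := by
  constructor
  · rintro ⟨-, h | h | h⟩
    · exact h
    · exact (hvA h.1).elim
    · exact (h.2 hv).elim
  · exact fun h => le_joined h

theorem isBase_joined {A Y : Set V} (hA : A.ncard = c / 2) (hAY : ∀ a ∈ Y, a ∉ A)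
    (hE : ∀ v w, G.Adj v w → v ∈ A ∨ w ∈ A ∨ v ∈ Y ∨ w ∈ Y) :
    IsBase c (joined G A Y) A (A ∪ Y)ᶜ Y where
  union := by
    ext a; simp only [Set.mem_union, Set.mem_compl_iff, Set.mem_univ, iff_true]; tauto
  disjoint_AB := Set.disjoint_left.2 fun a h h' => h' (.inl h)
  disjoint_AR := Set.disjoint_left.2 fun a h h' => hAY a h' h
  disjoint_BR := Set.disjoint_left.2 fun a h h' => h (.inr h')
  card_A := hA
  clique_A := fun a ha b hb hab => ⟨hab, .inr (.inl ⟨ha, fun h => hAY b h hb⟩)⟩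
  stable_B := by
    rintro v hv w hw - ⟨-, h | h | h⟩
    · rcases hE v w h with h | h | h | h
      · exact hv (.inl h)
      · exact hw (.inl h)
      · exact hv (.inr h)
      · exact hw (.inr h)
    · exact hv (.inl h.1)
    · exact hw (.inl h.1)
  complete_AB := by
    intro a ha b hb
    exact ⟨by rintro rfl; exact hb (.inl ha), .inr (.inl ⟨ha, fun h => hb (.inr h)⟩)⟩

theorem neighborSet_joined {A Y : Set V} {v : V} (hv : v ∈ Y) (hvA : v ∉ A) :
    (joined G A Y).neighborSet v = G.neighborSet v := by
  ext w; exact joined_adj hv hvA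

theorem isStarOn_joined {A Y S : Set V} (hS : S ⊆ Y) (hAY : ∀ a ∈ Y, a ∉ A) {z : V} :
    IsStarOn (joined G A Y) S z ↔ IsStarOn G S z := by
  refine and_congr_right fun _ => and_congr_right fun _ => ?_
  refine forall₂_congr fun v hv => forall₂_congr fun w _ => ?_
  rw [joined_adj (hS hv) (hAY v (hS hv))]

theorem IsFeasible.joined {A Y S : Set V} (hS : S ⊆ Y) (hAY : ∀ a ∈ Y, a ∉ A) {a b : V}
    (h : IsFeasible G a b S) : IsFeasible (joined G A Y) a b S := by
  refine ⟨?_, fun h3 z hz => ?_⟩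
  · rw [← h.1]
    ext v
    refine and_congr_right fun _ => exists_congr fun w => and_congr_right fun hw => ?_
    exact joined_adj (hS hw) (hAY w (hS hw))
  · obtain ⟨h1, w, hw, h2⟩ := h.2 h3 z ((isStarOn_joined hS hAY).1 hz)
    refine ⟨fun l hl => ?_, w, hw, fun l hl => le_joined (h2 l hl)⟩
    rw [neighborSet_joined (hS hl.1) (hAY l (hS hl.1))]
    exact h1 l hl

namespace Config
variable [Fintype V]

/-- If two vertices off the cycle are adjacent, the cycle is odd and `G` is a subgraph of a member of
`𝒴`: the stars are the components of `G - {u 0, u 2, …, u (2k - 2)}` with at least two vertices.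
One of them contains the exceptional vertices; it is a feasible star like the others, since the edge
joining these may be exchanged for an edge off the cycle. -/
theorem exists_inY (h : Config G c k u x) (hG : IsTwoConnected G) {n : ℕ}
    (hn : Fintype.card V = n) {y w : V} (hy : y ∉ Set.range u)
    (hw : w ∉ Set.range u) (hyw : G.Adj y w) :
    c = 2 * k + 1 ∧ ∃ H : SimpleGraph V, G ≤ H ∧ InY n c H := by
  have hk := h.five_le
  obtain ⟨hc, ⟨d, e, hd, he, hd0, heb, hde⟩, hout, -⟩ := h.multi_spec hG hy hw hyw
  refine ⟨hc, ?_⟩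
  set A := evens u k with hA
  set p := u (2 * k - 1) with hp
  set q := u (2 * k) with hq
  have hpA : p ∉ A := h.exc_notMem hc
  have hqA : q ∉ A := h.exc_notMem' hc
  -- The component of the exceptional vertices: exchange them with `e` and `d`.
  have hpq : (∃ z, IsStarOn G (comp G u k p) z) ∧
      IsFeasible G (u 0) (u (2 * k - 2)) (comp G u k p) := by
    have hdx : d ≠ x := h.ne_x_of_adj (hout e he) hde
    have hex : e ≠ x := h.ne_x_of_adj (hout d hd) hde.symm
    obtain ⟨u', h', hu', -, -, hr⟩ := h.exchange hc (p := e) (q := d)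
      (fun s _ _ hs => hout e he ⟨s, hs.symm⟩) (fun s _ _ hs => hout d hd ⟨s, hs.symm⟩)
      hex hdx heb.symm hde.symm hd0
    have hoff : ∀ t : ℤ, 2 * k - 1 ≤ t → t ≤ 2 * k → u t ∉ Set.range u' := by
      intro t ht1 ht2 hh
      rcases (hr _).1 hh with hh | hh | ⟨s, hs0, hs, hh⟩
      · exact hout e he ⟨t, hh⟩
      · exact hout d hd ⟨t, hh⟩
      · have := h.cyc.inj hh (by omega) (by omega); omega
    have := (h'.multi_spec hG (hoff (2 * k - 1) (by omega) (by omega))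
      (hoff (2 * k) (by omega) (by omega)) h.adj_exc_exc).2.2.2
    rwa [hu' 0 (by omega) (by omega), hu' (2 * k - 2) (by omega) (by omega), comp,
      evens_congr hu'] at this
  have hcompeq : ∀ {v w : V}, G.Adj v w → v ∉ A → w ∉ A → comp G u k v = comp G u k w := by
    intro v w hvw hv hw
    have hr : (within G (evens u k)ᶜ).Reachable v w := SimpleGraph.Adj.reachable ⟨hvw, hv, hw⟩
    ext a
    exact ⟨fun ha => hr.symm.trans ha, fun ha => hr.trans ha⟩
  have hqcomp : comp G u k q = comp G u k p := (hcompeq h.adj_exc_exc hpA hqA).symm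
  have key : ∀ v w, G.Adj v w → v ∉ A → w ∉ A → (∃ z, IsStarOn G (comp G u k v) z) ∧
      IsFeasible G (u 0) (u (2 * k - 2)) (comp G u k v) := by
    intro v w hvw hvA hwA
    have hcyc : ∀ {v w}, G.Adj v w → v ∉ A → w ∉ A → v ∈ Set.range u → v = p ∨ v = q := by
      intro v w hvw hvA hwA hv
      rcases h.not_even_cases hv hvA with ⟨s, hs, rfl⟩ | ⟨-, hv⟩
      · exact (hwA (h.mid_nbr hG hs hvw)).elim
      · exact hv
    by_cases hv : v ∈ Set.range u
    · rcases hcyc hvw hvA hwA hv with rfl | rfl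
      · exact hpq
      · rw [hqcomp]; exact hpq
    · by_cases hw : w ∈ Set.range u
      · rw [hcompeq hvw hvA hwA]
        rcases hcyc hvw.symm hwA hvA hw with rfl | rfl
        · exact hpq
        · rw [hqcomp]; exact hpq
      · exact (h.multi_spec hG hv hw hvw).2.2.2
  set 𝒮 : Set (Set V) := {S | ∃ v w, G.Adj v w ∧ v ∉ A ∧ w ∉ A ∧ S = comp G u k v} with h𝒮
  set Y : Set V := ⋃₀ 𝒮 with hY
  have hself : ∀ v, v ∈ comp G u k v := fun v => .refl _
  have hYA : ∀ a ∈ Y, a ∉ A := by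
    rintro a ⟨S, ⟨v, w, -, hv, -, rfl⟩, ha⟩
    exact mem_of_within_reachable ha hv
  have hSY : ∀ S ∈ 𝒮, S ⊆ Y := fun S hS => Set.subset_sUnion_of_mem hS
  have hmeet : ∀ S ∈ 𝒮, ∀ T ∈ 𝒮, ∀ a ∈ S, ∀ b ∈ T, (a = b ∨ G.Adj a b) → S = T := by
    intro S hS T hT a ha b hb hab
    have haA := hYA a (hSY S hS ha)
    have hbA := hYA b (hSY T hT hb)
    obtain ⟨v, -, -, -, -, rfl⟩ := hS
    obtain ⟨v', -, -, -, -, rfl⟩ := hT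
    have hr : (within G (evens u k)ᶜ).Reachable a b := by
      rcases hab with rfl | hab
      · exact .refl _
      · exact SimpleGraph.Adj.reachable ⟨hab, haA, hbA⟩
    have hr' : (within G (evens u k)ᶜ).Reachable v v' :=
      (SimpleGraph.Reachable.trans ha hr).trans (SimpleGraph.Reachable.symm hb)
    ext z
    exact ⟨fun hz => hr'.symm.trans hz, fun hz => hr'.trans hz⟩
  refine ⟨joined G A Y, le_joined, hn, A, (A ∪ Y)ᶜ, Y, isBase_joined ?_ hYA ?_, 𝒮, ?_, u 0, ?_,
    u (2 * k - 2), ?_, ?_, ?_⟩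
  · rw [h.ncard_evens]; omega
  · intro v w hvw
    by_cases hv : v ∈ A
    · exact .inl hv
    by_cases hw : w ∈ A
    · exact .inr (.inl hw)
    exact .inr (.inr (.inl (hSY _ ⟨v, w, hvw, hv, hw, rfl⟩ (hself v))))
  · refine ⟨?_, ?_, rfl, ?_, ?_⟩
    · rintro S hS
      obtain ⟨v, w, hvw, hv, hw, rfl⟩ := id hS
      obtain ⟨z, hz⟩ := (key v w hvw hv hw).1
      exact ⟨z, (isStarOn_joined (hSY _ hS) hYA).2 hz⟩
    · intro S hS T hT hne
      refine Set.disjoint_left.2 fun a ha hb => hne (hmeet S hS T hT a ha a hb (.inl rfl))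
    · intro S hS T hT hne a ha b hb hab
      rw [joined_adj (hSY S hS ha) (hYA a (hSY S hS ha))] at hab
      exact hne (hmeet S hS T hT a ha b hb (.inr hab))
    · have hyA : y ∉ A := fun hh => hy (evens_subset hh)
      have hwA : w ∉ A := fun hh => hw (evens_subset hh)
      refine ⟨_, ⟨y, w, hyw, hyA, hwA, rfl⟩, _, ⟨p, q, h.adj_exc_exc, hpA, hqA, rfl⟩, fun e => ?_⟩
      have : p ∈ comp G u k y := by rw [e]; exact hself p
      exact hout p this ⟨_, rfl⟩
  · exact mem_evens (by omega) (by omega) (by omega)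
  · exact mem_evens (by omega) (by omega) (by omega)
  · intro e
    have := h.cyc.inj e (by omega) (by omega)
    omega
  · intro S hS
    obtain ⟨v, w, hvw, hv, hw, rfl⟩ := id hS
    exact (key v w hvw hv hw).2.joined (hSY _ hS) hYA

/-- If the vertices off the cycle are pairwise non-adjacent and one of them is joined to the first
exceptional vertex, then `G` is a subgraph of a member of `𝒳`. -/
theorem exists_inX (h : Config G c k u x) (hG : IsTwoConnected G) {n : ℕ}
    (hn : Fintype.card V = n) (hc : c = 2 * k + 1)
    (hind : ∀ v w, v ∉ Set.range u → w ∉ Set.range u → ¬ G.Adj v w) {y : V}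
    (hy : y ∉ Set.range u) (hyp : G.Adj y (u (2 * k - 1))) :
    ∃ H : SimpleGraph V, G ≤ H ∧ InX n c H := by
  have hk := h.five_le
  set A := evens u k with hA
  set p := u (2 * k - 1) with hp
  set q := u (2 * k) with hq
  have hpA : p ∉ A := h.exc_notMem hc
  have hqA : q ∉ A := h.exc_notMem' hc
  -- In the role of `b`, the vertex `p` stays outside `X`, while `q` belongs to `X`.
  set X : Set V := {a | a ∉ A ∧ G.Adj a p} with hX
  have h0A : u 0 ∈ A := mem_evens (by omega) (by omega) (by omega)
  have hyx : y ≠ x := by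
    rintro rfl; exact hpA (h.adj_x hyp)
  -- After an exchange of `q` for `y`, the vertex `q` is off the cycle and joined to `p` as well.
  have hqX : ∀ w, G.Adj q w ↔ w = p ∨ w = u 0 := by
    have hq0 : G.Adj (u (2 * k - 2)) p := by
      have := h.cyc.adj (2 * k - 2)
      rwa [show (2 * k - 2 + 1 : ℤ) = 2 * k - 1 by ring] at this
    have hpx : p ≠ x := by rintro e; exact h.x_notMem ⟨_, e⟩
    obtain ⟨u', h', hu', hu1, hu2, hr⟩ := h.exchange hc (p := p) (q := y)
      (fun s h0 h1 hs => by have := h.cyc.inj hs (by omega) (by omega); omega)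
      (fun s _ _ hs => hy ⟨s, hs.symm⟩) hpx hyx hq0 hyp.symm
      ((h.adj_exc_iff hG hc hy hyp _).2 (.inr rfl))
    have hqr : q ∉ Set.range u' := by
      rw [hr]
      rintro (e | e | ⟨s, h0, h1, e⟩)
      · exact h.adj_exc_exc.ne e.symm
      · exact hy ⟨_, e⟩
      · have := h.cyc.inj e (by omega) (by omega); omega
    intro w
    have := h'.adj_exc_iff hG hc hqr (by rw [hu1]; exact h.adj_exc_exc.symm) w
    rwa [hu1, hu' 0 le_rfl (by omega)] at this
  have hNX : ∀ a ∈ X, ∀ w, G.Adj a w ↔ w = p ∨ w = u 0 := by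
    rintro a ⟨haA, hap⟩ w
    by_cases ha : a ∈ Set.range u
    · rcases h.not_even_cases ha haA with ⟨s, hs, rfl⟩ | ⟨-, rfl | rfl⟩
      · exact (hpA (h.mid_nbr hG hs hap)).elim
      · exact (G.loopless.irrefl _ hap).elim
      · exact hqX w
    · exact h.adj_exc_iff hG hc ha hap w
  have hXA : ∀ a ∈ X, a ∉ A := fun a ha => ha.1
  have hqX' : q ∈ X := ⟨hqA, h.adj_exc_exc.symm⟩
  have hpX : p ∉ X := fun hh => G.loopless.irrefl _ hh.2
  have hcross : ∀ v w, G.Adj v w → v ∈ Set.range u → v ∈ A ∨ w ∈ A ∨ v ∈ X ∨ w ∈ X := by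
    intro v w hvw hv
    by_cases hvA : v ∈ A
    · exact .inl hvA
    rcases h.not_even_cases hv hvA with ⟨s, hs, rfl⟩ | ⟨-, rfl | rfl⟩
    · exact .inr (.inl (h.mid_nbr hG hs hvw))
    · by_cases hwA : w ∈ A
      · exact .inr (.inl hwA)
      · exact .inr (.inr (.inr ⟨hwA, hvw.symm⟩))
    · exact .inr (.inr (.inl hqX'))
  refine ⟨joined G A X, le_joined, hn, A, (A ∪ X)ᶜ, X, isBase_joined ?_ hXA ?_, ?_, u 0, h0A, p, ?_,
    ?_⟩
  · rw [h.ncard_evens]; omega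
  · intro v w hvw
    by_cases hv : v ∈ Set.range u
    · exact hcross v w hvw hv
    by_cases hw : w ∈ Set.range u
    · have := hcross w v hvw.symm hw; tauto
    · exact (hind v w hv hw hvw).elim
  · rintro v hv w hw - hvw
    rw [joined_adj hv (hXA v hv)] at hvw
    rcases (hNX v hv w).1 hvw with rfl | rfl
    · exact hpX hw
    · exact hXA _ hw h0A
  · rintro (hh | hh)
    · exact hpA hh
    · exact hpX hh
  · intro a ha
    rw [neighborSet_joined ha (hXA a ha)]
    ext w
    simp only [SimpleGraph.mem_neighborSet, Set.mem_insert_iff, Set.mem_singleton_iff]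
    rw [hNX a ha, or_comm]

/-- If the vertices off the cycle are pairwise non-adjacent and none of them is joined to an
exceptional vertex, then `G` is contained in `W_{n,k,c}`: the clique has the `k` neighbours of `x` and
either one further vertex, for which `x` will do, or the two exceptional vertices. -/
theorem isContained_W (h : Config G c k u x) (hG : IsTwoConnected G) {n : ℕ}
    (hn : Fintype.card V = n)
    (hind : ∀ v w, v ∉ Set.range u → w ∉ Set.range u → ¬ G.Adj v w)
    (hexc : c = 2 * k + 1 → ∀ v, v ∉ Set.range u →
      ¬ G.Adj v (u (2 * k - 1)) ∧ ¬ G.Adj v (u (2 * k))) :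
    G.IsContained (W n k c) := by
  have hk := h.five_le
  have hkc := h.le_c
  have hck := h.c_le
  rcases hkc.eq_or_lt with hc | hc
  · have hxA : x ∉ evens u k := fun hh => h.x_notMem (evens_subset hh)
    refine BondyStability.isContained_W hn (Set.subset_insert x (evens u k)) h.ncard_evens ?_ ?_
    · rw [Set.ncard_insert_of_notMem hxA, h.ncard_evens]; omega
    · have hcross : ∀ v w, G.Adj v w → v ∈ Set.range u → v ∈ evens u k ∨ w ∈ evens u k := by
        intro v w hvw hv
        by_cases hvA : v ∈ evens u k
        · exact .inl hvA
        rcases h.not_even_cases hv hvA with ⟨s, hs, rfl⟩ | ⟨hc', -⟩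
        · exact .inr (h.mid_nbr hG hs hvw)
        · omega
      intro v w hvw
      by_cases hv : v ∈ Set.range u
      · have := hcross v w hvw hv; tauto
      by_cases hw : w ∈ Set.range u
      · have := hcross w v hvw.symm hw; tauto
      · exact (hind v w hv hw hvw).elim
  · have hc : c = 2 * k + 1 := by omega
    have hpA := h.exc_notMem hc
    have hqA := h.exc_notMem' hc
    refine BondyStability.isContained_W hn (T := insert (u (2 * k - 1)) (insert (u (2 * k)) (evens u k)))
      ((Set.subset_insert _ _).trans (Set.subset_insert _ _)) h.ncard_evens ?_ ?_
    · rw [Set.ncard_insert_of_notMem, Set.ncard_insert_of_notMem hqA, h.ncard_evens]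
      · omega
      · rintro (e | e)
        · exact h.adj_exc_exc.ne e
        · exact hpA e
    · have hcross : ∀ v w, G.Adj v w → v ∈ Set.range u → v ∈ evens u k ∨ w ∈ evens u k ∨
          v = u (2 * k - 1) ∨ v = u (2 * k) := by
        intro v w hvw hv
        by_cases hvA : v ∈ evens u k
        · exact .inl hvA
        rcases h.not_even_cases hv hvA with ⟨s, hs, rfl⟩ | ⟨-, hv⟩
        · exact .inr (.inl (h.mid_nbr hG hs hvw))
        · exact .inr (.inr hv)
      have hT : ∀ {v}, v = u (2 * k - 1) ∨ v = u (2 * k) →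
          v ∈ insert (u (2 * k - 1)) (insert (u (2 * k)) (evens u k)) := by
        rintro v (rfl | rfl)
        · exact .inl rfl
        · exact .inr (.inl rfl)
      have hoff : ∀ v w, G.Adj v w → v ∈ Set.range u → w ∉ Set.range u →
          v ∈ evens u k ∨ w ∈ evens u k := by
        intro v w hvw hv hw
        rcases hcross v w hvw hv with h1 | h1 | rfl | rfl
        · exact .inl h1
        · exact .inr h1
        · exact ((hexc hc w hw).1 hvw.symm).elim
        · exact ((hexc hc w hw).2 hvw.symm).elim
      intro v w hvw
      by_cases hv : v ∈ Set.range u <;> by_cases hw : w ∈ Set.range u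
      · rcases hcross v w hvw hv with h1 | h1 | h1
        · exact .inl h1
        · exact .inr (.inl h1)
        · rcases hcross w v hvw.symm hw with h2 | h2 | h2
          · exact .inr (.inl h2)
          · exact .inl h2
          · exact .inr (.inr ⟨hT h1, hT h2⟩)
      · have := hoff v w hvw hv hw; tauto
      · have := hoff w v hvw.symm hw hv; tauto
      · exact (hind v w hv hw hvw).elim

/-- The three cases for the vertices off the cycle: two of them are adjacent (`𝒴`), they are stable
with an edge to an exceptional vertex (`𝒳`), or neither (`W`). -/
theorem contained_or_mem (h : Config G c k u x) (hG : IsTwoConnected G) {n : ℕ}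
    (hn : Fintype.card V = n) :
    G.IsContained (W n k c) ∨
      (Odd c ∧ ∃ H : SimpleGraph V, G ≤ H ∧ (InX n c H ∨ InY n c H)) := by
  by_cases hind : ∀ v w, v ∉ Set.range u → w ∉ Set.range u → ¬ G.Adj v w
  · by_cases hexc : c = 2 * k + 1 → ∀ v, v ∉ Set.range u →
        ¬ G.Adj v (u (2 * k - 1)) ∧ ¬ G.Adj v (u (2 * k))
    · exact .inl (h.isContained_W hG hn hind hexc)
    · push Not at hexc
      obtain ⟨hc, y, hy, hpq⟩ := hexc
      refine .inr ⟨⟨k, hc⟩, ?_⟩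
      by_cases hyp : G.Adj y (u (2 * k - 1))
      · obtain ⟨H, hH, hX⟩ := h.exists_inX hG hn hc hind hy hyp
        exact ⟨H, hH, .inl hX⟩
      · obtain ⟨H, hH, hX⟩ := h.reverse.exists_inX hG hn hc (by rwa [range_reverse]) (y := y)
          (by rwa [range_reverse]) (by simp only [h.reverse_exc hc]; exact hpq hyp)
        exact ⟨H, hH, .inl hX⟩
  · push Not at hind
    obtain ⟨v, w, hv, hw, hvw⟩ := hind
    obtain ⟨hc, H, hH, hY⟩ := h.exists_inY hG hn hv hw hvw
    exact .inr ⟨⟨k, hc⟩, H, hH, .inr hY⟩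

end Config
end BondyStability

theorem theorem1p13 {V : Type*} [Fintype V] (G : SimpleGraph V) (n c : ℕ)
    (hn : Fintype.card V = n) (hG : BondyStability.IsTwoConnected G)
    (v : V) (C : G.Walk v v) (hC : BondyStability.IsLongestCycle C) (hCc : C.length = c)
    (hc : 10 ≤ c) (hcn : c ≤ n - 1)
    (hE : (c / 2 - 1) * (n - c) <
      (BondyStability.edgesAtMostOneEnd G {u | u ∈ C.support}).ncard) :
    G.IsContained (BondyStability.W n (c / 2) c) ∨
      (Odd c ∧ ∃ H : SimpleGraph V, G ≤ H ∧
        (BondyStability.InX n c H ∨ BondyStability.InY n c H)) := by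
  classical
  subst hCc
  obtain ⟨u, hu, hrange⟩ := BondyStability.exists_isCyc hC.1
  rw [← hrange] at hE
  have hK : (Finset.univ.filter (· ∈ Set.range u)).card = C.length := by
    have hA : Finset.univ.filter (· ∈ Set.range u) =
        (Finset.Ico (0 : ℤ) C.length).image u := by
      ext a
      simp only [Finset.mem_filter, Finset.mem_univ, true_and, Finset.mem_image, Finset.mem_Ico]
      constructor
      · rintro ⟨s, rfl⟩
        refine ⟨s % C.length, ⟨Int.emod_nonneg _ (by omega), Int.emod_lt_of_pos _ (by omega)⟩, ?_⟩
        rw [hu.eq_iff]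
        exact ⟨-(s / C.length), by have := Int.emod_add_mul_ediv s C.length; linarith⟩
      · rintro ⟨s, -, rfl⟩; exact ⟨s, rfl⟩
    rw [hA, Finset.card_image_of_injOn]
    · simp
    · intro s hs t ht e
      simp only [Finset.coe_Ico, Set.mem_Ico] at hs ht
      exact hu.inj e (by omega) (by omega)
  have hO : (Finset.univ.filter (· ∉ Set.range u)).card = n - C.length := by
    have := Finset.card_filter_add_card_filter_not (s := (Finset.univ : Finset V))
      (· ∈ Set.range u)
    rw [Finset.card_univ, hn] at this
    omega
  obtain ⟨u', x, h⟩ := hu.exists_config hG hC.circLE (k := C.length / 2) (by omega) (by omega)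
    (by omega) (by rw [hO]; exact hE)
  exact h.contained_or_mem hG hn
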